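/- **Setting.** Fix integers $d_{\mathcal X}, H$, the state space $\mathcal X=\mathbb R^{d_{\mathcal X}}$, an arbitrary set $\mathcal U$ of controls, a separable real Hilbert space $\mathcal H$, a feature map $\phi:\mathcal X\times\mathcal U\to\mathcal H$, a nonzero bounded linear map $W^\star:\mathcal H\to\mathcal X$ with operator norm $\|W^\star\|_2$, a noise level $\sigma>0$, an initial state $x_0$, a set $\Pi$ of policies $\pi:\mathcal X\times\{0,\dots,H-1\}\to\mathcal U$, and non-negative cost functions $c^t:\mathcal X\times\mathcal U\to\mathbb R^+$, $t=0,1,\dots$. For a linear map $W$, $J^\pi(x_0;c,W)$ is the expectation of $\sum_{h=0}^{H-1}c(x_h,u_h)$ when $u_h=\pi(x_h,h)$ and $x_{h+1}=W\phi(x_h,u_h)+\epsilon_h$ with independent $\epsilon_h\sim\mathcal N(0,\sigma^2I)$. Put $J^\star(x_0;c)=\inf_{\pi\in\Pi}J^\pi(x_0;c,W^\star)$. In episode $t$ an algorithm picks a policy $\pi^t\in\Pi$ as a function of the history of the episodes $0,\dots,t-1$, and a trajectory $(x^t_h,u^t_h)$ of $\pi^t$ is sampled from the true model $W^\star$, with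 noise independent across time steps and episodes. Its regret is $$\mathrm{Regret}_T=\sum_{t<T}\sum_{h<H}c^t(x^t_h,u^t_h)-\sum_{t<T}J^\star(x_0;c^t).$$ For $\lambda>0$ let $\Sigma^t=\lambda I+\sum_{\tau<t}\sum_{h<H}\phi(x^\tau_h,u^\tau_h)\phi(x^\tau_h,u^\tau_h)^\top$, so that $\det\Sigma^t/\det\Sigma^0=\det\big(I+\lambda^{-1}\sum_{\tau<t}\sum_{h<H}\phi(x^\tau_h,u^\tau_h)\phi(x^\tau_h,u^\tau_h)^\top\big)$. The maximum information gain is $\gamma_T(\lambda)=\sup_{\mathcal A}\mathbb E_{\mathcal A}[\log(\det\Sigma^T/\det\Sigma^0)]$, the supremum being over all such algorithms. **LC³.** Given $\lambda$, $C_1$ and an initial set $\mathrm{Ball}^0\ni W^\star$, let, for $t\ge1$, $\overline W^t$ be the minimizer of $\sum_{\tau<t}\sum_{h<H}\|W\phi(x^\tau_h,u^\tau_h)-x^\tau_{h+1}\|_2^2+\lambda\|W\|_F^2$ and $$\mathrm{Ball}^t=\big\{W:\|(W-\overline W^t)(\Sigma^t)^{1/2}\|_2^2\le\beta^t\big\},\qquad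 \beta^t=C_1\Big(\lambda\|W^\star\|_2^2+\sigma^2\big(d_{\mathcal X}+\log(t\det\Sigma^t/\det\Sigma^0)\big)\Big).$$ In each episode $t$, LC³ executes $\pi^t\in\operatorname{argmin}_{\pi\in\Pi}\min_{W\in\mathrm{Ball}^t}J^\pi(x_0;c^t,W)$. **Theorem 1 (LC³ regret bound).** There are absolute constants $0<C_1,C_2\le20$ such that the following holds in every such setting. Assume that LC³ is run with an exact planning oracle for this optimization (so that the minima exist), and that for every $t$ $$\sup_{\pi\in\Pi}\mathbb E\Big[\Big(\sum_{h=0}^{H-1}c^t(x_h,u_h)\Big)^2\,\Big|\,x_0,\pi\Big]\le V_{\max}$$ (expectation under the true model). Set $\lambda=\sigma^2/\|W^\star\|_2^2$ and $\widetilde d_T^{\,2}=\gamma_T(\lambda)\big(\gamma_T(\lambda)+d_{\mathcal X}+\log T+H\big)$. Then for every $T$ the regret is integrable, and, if $\gamma_T(\lambda)<\infty$: 1. if $\mathrm{Ball}^0$ is contained in the initial confidence ball $\{W:\lambda\|W\|_2^2\le C_1(\lambda\|W^\star\|_2^2+\sigma^2d_{\mathcal X})\}$, then $$\mathbb E_{\mathrm{LC}^3}[\mathrm{Regret}_T]\le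 C_2\,\widetilde d_T\sqrt{V_{\max}HT};$$ 2. for an arbitrary initial set $\mathrm{Ball}^0\ni W^\star$, $$\mathbb E_{\mathrm{LC}^3}[\mathrm{Regret}_T]\le C_2\,\widetilde d_T\sqrt{V_{\max}HT}+\sqrt{V_{\max}}.$$ -/

import Mathlib

open MeasureTheory ProbabilityTheory
open scoped ENNReal NNReal

universe u v

namespace LC3

/-- The state space `ℝ^d` with its Euclidean norm. -/
abbrev State (d : ℕ) := EuclideanSpace ℝ (Fin d)

section Regression

variable {d : ℕ} {E : Type v} [NormedAddCommGroup E] [InnerProductSpace ℝ E]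
variable {ι : Type*} [Fintype ι]

/-- The feature covariance operator `Σ = lam • I + ∑ i, φᵢ φᵢᵀ` of the features `f i = φᵢ`. -/
noncomputable def cov (lam : ℝ) (f : ι → E) : E →L[ℝ] E :=
  lam • ContinuousLinearMap.id ℝ E + ∑ i, InnerProductSpace.rankOne ℝ (f i) (f i)

/-- `det (lam • I + ∑ i, φᵢ φᵢᵀ) / det (lam • I) = det (I + lam⁻¹ ∑ i, φᵢ φᵢᵀ)`. As the Hilbert space
may have infinite dimension, this (Fredholm) determinant of a finite rank perturbation of the
identity is written as the determinant of `I + lam⁻¹ G` with `G` the Gram matrix of the features;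
see `det_cov_div_det`. -/
noncomputable def detRatio [DecidableEq ι] (lam : ℝ) (f : ι → E) : ℝ :=
  (1 + lam⁻¹ • Matrix.gram ℝ f).det

/-- In finite dimension `detRatio` is the quotient of the determinants of `Σ` and of `lam • I`. -/
theorem det_cov_div_det [DecidableEq ι] [FiniteDimensional ℝ E] {lam : ℝ} (hlam : lam ≠ 0)
    (f : ι → E) :
    LinearMap.det (cov lam f : E →ₗ[ℝ] E) /
        LinearMap.det (cov lam (Fin.elim0 : Fin 0 → E) : E →ₗ[ℝ] E) = detRatio lam f := by
  classical
  let b := stdOrthonormalBasis ℝ E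
  let n := Module.finrank ℝ E
  let F : Matrix (Fin n) ι ℝ := Matrix.of fun k i => inner ℝ (b k) (f i)
  have hgram : Matrix.gram ℝ f = F.transpose * F := by
    ext i j
    rw [Matrix.gram_apply, Matrix.mul_apply, ← b.sum_inner_mul_inner (f i) (f j)]
    refine Finset.sum_congr rfl fun k _ => ?_
    simp [F, real_inner_comm]
  have h1 : LinearMap.toMatrix b.toBasis b.toBasis (cov lam f : E →ₗ[ℝ] E)
      = lam • (1 + (lam⁻¹ • F) * F.transpose) := by
    ext k l
    have hs : ∀ a : ℝ, lam * (lam⁻¹ * a) = a := fun a => mul_inv_cancel_left₀ hlam a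
    rw [LinearMap.toMatrix_apply]
    by_cases hkl : k = l
    · subst hkl
      simp [cov, Matrix.mul_apply, F, Finset.mul_sum, mul_add, hs, mul_assoc, real_inner_comm, b,
        OrthonormalBasis.repr_apply_apply]
    · simp [cov, Matrix.mul_apply, F, Finset.mul_sum, hs, mul_assoc, real_inner_comm, b, hkl,
        OrthonormalBasis.repr_apply_apply]
      exact Finset.sum_congr rfl fun _ _ => mul_comm _ _
  have h0 : (cov lam (Fin.elim0 : Fin 0 → E) : E →ₗ[ℝ] E) = lam • LinearMap.id := by
    ext x; simp [cov]
  rw [← LinearMap.det_toMatrix b.toBasis, h1, h0, LinearMap.det_smul, LinearMap.det_id,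
    Matrix.det_smul, Fintype.card_fin, detRatio, hgram, Matrix.det_one_add_mul_comm,
    Matrix.mul_smul]
  field_simp [n]

variable [CompleteSpace E]

/-- Squared Frobenius (Hilbert–Schmidt) norm of `W : E → ℝ^d`: the sum of the squared norms of its
rows `Wᵀ eⱼ`. -/
noncomputable def frobSq (W : E →L[ℝ] State d) : ℝ :=
  ∑ j : Fin d, ‖ContinuousLinearMap.adjoint W (EuclideanSpace.single j 1)‖ ^ 2

/-- The regularized least squares objective for features `f i` and observed next states `y i`. -/
noncomputable def ridgeObjective (lam : ℝ) (f : ι → E) (y : ι → State d)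
    (W : E →L[ℝ] State d) : ℝ :=
  ∑ i, ‖W (f i) - y i‖ ^ 2 + lam * frobSq W

/-- `‖D S^{1/2}‖₂²` for a positive operator `S`, written without the square root as the spectral
norm of `D S Dᵀ`; see `norm_comp_sqrt_sq`. -/
noncomputable def weightedSpecNormSq (D : E →L[ℝ] State d) (S : E →L[ℝ] E) : ℝ :=
  ‖D ∘L S ∘L ContinuousLinearMap.adjoint D‖

/-- If `R` is the (self-adjoint) square root of `S`, then `‖D R‖₂² = weightedSpecNormSq D S`. -/
theorem norm_comp_sqrt_sq (D : E →L[ℝ] State d) (S R : E →L[ℝ] E) (hR : IsSelfAdjoint R)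
    (hRS : R ∘L R = S) : ‖D ∘L R‖ ^ 2 = weightedSpecNormSq D S := by
  have h := ContinuousLinearMap.norm_adjoint_comp_self (ContinuousLinearMap.adjoint (D ∘L R))
  rw [ContinuousLinearMap.adjoint_adjoint, LinearIsometryEquiv.norm_map] at h
  rw [weightedSpecNormSq, ← hRS, sq, ← h, ContinuousLinearMap.adjoint_comp,
    (ContinuousLinearMap.isSelfAdjoint_iff'.mp hR)]
  rfl

end Regression

/-- The data of an online kernelized nonlinear regulator with state space `ℝ^d`, horizon `H`,
an arbitrary set `U` of controls and feature Hilbert space `E`. -/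
structure KNR (d H : ℕ) (U : Type u) (E : Type v) [NormedAddCommGroup E]
    [InnerProductSpace ℝ E] where
  /-- the feature map -/
  φ : State d → U → E
  /-- the true model: the mean dynamics is `Wstar (φ x u)` -/
  Wstar : E →L[ℝ] State d
  /-- the noise level -/
  σ : ℝ
  /-- the initial state -/
  x₀ : State d
  /-- the set of feasible policies -/
  policies : Set (State d → Fin H → U)
  /-- the non-negative immediate cost function of each episode -/
  c : ℕ → State d → U → ℝ≥0

section Model

variable {d H : ℕ} {U : Type u} {E : Type v} [NormedAddCommGroup E] [InnerProductSpace ℝ E]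

/-- The law of the noise of one episode: `H` independent `N(0, σ² I)` vectors. -/
noncomputable def episodeNoise (d H : ℕ) (σ : ℝ) : Measure (Fin H → State d) :=
  Measure.pi fun _ => multivariateGaussian 0 (σ ^ 2 • (1 : Matrix (Fin d) (Fin d) ℝ))

/-- The law of the noise of all episodes, which are independent. -/
noncomputable def noise (d H : ℕ) (σ : ℝ) : Measure (ℕ → Fin H → State d) :=
  Measure.infinitePi fun _ => episodeNoise d H σ

namespace KNR

variable (M : KNR d H U E)

/-- The states `x_0, …, x_H` visited by the policy `π` under the dynamics
`x_{h+1} = W φ(x_h, u_h) + ε_h`, `u_h = π(x_h, h)`. -/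
noncomputable def traj (W : E →L[ℝ] State d) (π : State d → Fin H → U) (ε : Fin H → State d) :
    Fin (H + 1) → State d :=
  Fin.induction (motive := fun _ => State d) M.x₀ (fun h x => W (M.φ x (π x h)) + ε h)

/-- The realized cumulative cost `∑ h, c^t(x_h, π(x_h, h))` along the states `x`. -/
noncomputable def cumCost (t : ℕ) (π : State d → Fin H → U) (x : Fin (H + 1) → State d) : ℝ≥0 :=
  ∑ h : Fin H, M.c t (x h.castSucc) (π (x h.castSucc) h)

/-- `J^π(x₀; c^t, W)`, a possibly infinite expectation of a non-negative quantity. -/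
noncomputable def J (t : ℕ) (W : E →L[ℝ] State d) (π : State d → Fin H → U) : ℝ≥0∞ :=
  ∫⁻ ε, (M.cumCost t π (M.traj W π ε) : ℝ≥0∞) ∂episodeNoise d H M.σ

/-- The best-in-class expected cost `J^⋆(x₀; c^t)` under the true model. -/
noncomputable def Jstar (t : ℕ) : ℝ≥0∞ :=
  ⨅ π ∈ M.policies, M.J t M.Wstar π

/-- Second moment of the realized cumulative cost of `π` under the true model. -/
noncomputable def secondMoment (t : ℕ) (π : State d → Fin H → U) : ℝ≥0∞ :=
  ∫⁻ ε, (M.cumCost t π (M.traj M.Wstar π ε) : ℝ≥0∞) ^ 2 ∂episodeNoise d H M.σ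

end KNR

/-- A history before episode `t`: the states `x_0, …, x_H` observed in the episodes `0, …, t-1`. -/
abbrev History (d H t : ℕ) := Fin t → Fin (H + 1) → State d

/-- An algorithm chooses the policy of episode `t` from the history before episode `t`. (The past
policies and controls are functions of the past states and of the algorithm.) -/
abbrev Algorithm (d H : ℕ) (U : Type u) := (t : ℕ) → History d H t → State d → Fin H → U

/-- The policy chosen by `A` in the past episode `s < t` of a history before episode `t`. -/
def Algorithm.pastPolicy (A : Algorithm d H U) {t : ℕ} (hist : History d H t) (s : Fin t) :
    State d → Fin H → U :=
  A s fun r => hist (r.castLE s.isLt.le)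

namespace KNR

variable (M : KNR d H U E)

/-- The features `φ(x^s_h, u^s_h)` in a history, for `s < t` and `h < H`. -/
def features (A : Algorithm d H U) {t : ℕ} (hist : History d H t) (i : Fin t × Fin H) : E :=
  M.φ (hist i.1 i.2.castSucc) (A.pastPolicy hist i.1 (hist i.1 i.2.castSucc) i.2)

/-- The next states `x^s_{h+1}` in a history, for `s < t` and `h < H`. -/
def nextStates {t : ℕ} (hist : History d H t) (i : Fin t × Fin H) : State d :=
  hist i.1 i.2.succ

/-- The random history before episode `t` when `A` is run in the true model, as a function of the
noise. -/
noncomputable def history (A : Algorithm d H U) (ε : ℕ → Fin H → State d) :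
    (t : ℕ) → History d H t
  | 0 => fun s => s.elim0
  | t + 1 => Fin.snoc (α := fun _ => Fin (H + 1) → State d) (history A ε t)
      (M.traj M.Wstar (A t (history A ε t)) (ε t))

/-- The realized cost of `A` in episode `t`. -/
noncomputable def realizedCost (A : Algorithm d H U) (ε : ℕ → Fin H → State d) (t : ℕ) : ℝ≥0 :=
  M.cumCost t (A t (M.history A ε t)) (M.traj M.Wstar (A t (M.history A ε t)) (ε t))

/-- The regret of `A` over the episodes `0, …, T-1`. -/
noncomputable def regret (A : Algorithm d H U) (T : ℕ) (ε : ℕ → Fin H → State d) : ℝ :=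
  ∑ t ∈ Finset.range T, (M.realizedCost A ε t : ℝ) - ∑ t ∈ Finset.range T, (M.Jstar t).toReal

/-- The measurability taken for granted of the feasible policies. -/
def MeasurablePolicies [MeasurableSpace E] : Prop :=
  ∀ π ∈ M.policies, ∀ h : Fin H, Measurable (fun x => M.φ x (π x h)) ∧
    ∀ t, Measurable (fun x => M.c t x (π x h))

/-- `A` always chooses feasible policies, and the features it generates depend measurably on the
history and on the state. -/
def Admissible [MeasurableSpace E] (A : Algorithm d H U) : Prop :=
  ∀ t, (∀ hist, A t hist ∈ M.policies) ∧
    ∀ h : Fin H, Measurable fun p : History d H t × State d => M.φ p.2 (A t p.1 p.2 h)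

/-- The immediate costs generated by `A` depend measurably on the history and on the state. -/
def MeasurableCosts (A : Algorithm d H U) : Prop :=
  ∀ t, ∀ h : Fin H,
    Measurable fun p : History d H t × State d => M.c t p.2 (A t p.1 p.2 h)

/-- The expected maximum information gain `γ_T(lam)`: the supremum over all algorithms of the
expectation of `log (det Σ^T / det Σ^0)` (a non-negative quantity). -/
noncomputable def infoGain [MeasurableSpace E] (lam : ℝ) (T : ℕ) : ℝ≥0∞ :=
  ⨆ (A : Algorithm d H U) (_ : M.Admissible A),
    ∫⁻ ε, ENNReal.ofReal (Real.log (detRatio lam (M.features A (M.history A ε T))))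
      ∂noise d H M.σ

/-- `β^t = C₁ (lam ‖W⋆‖₂² + σ² (d + log (t det Σ^t / det Σ^0)))`; for `t = 0` the factor `t` is
replaced by `1`. -/
noncomputable def beta (lam C₁ : ℝ) (A : Algorithm d H U) {t : ℕ} (hist : History d H t) : ℝ :=
  C₁ * (lam * ‖M.Wstar‖ ^ 2 +
    M.σ ^ 2 * (d + Real.log (max (t : ℝ) 1 * detRatio lam (M.features A hist))))

variable [CompleteSpace E]

/-- The confidence ball `{W | ‖(W - W̄^t) (Σ^t)^{1/2}‖₂² ≤ β^t}`, whose centre `W̄^t` is the minimizer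
of the regularized least squares objective. -/
def confidenceBall (lam C₁ : ℝ) (A : Algorithm d H U) {t : ℕ} (hist : History d H t) :
    Set (E →L[ℝ] State d) :=
  {W | ∃ Wbar : E →L[ℝ] State d,
    (∀ W', ridgeObjective lam (M.features A hist) (nextStates hist) Wbar ≤
      ridgeObjective lam (M.features A hist) (nextStates hist) W') ∧
    weightedSpecNormSq (W - Wbar) (cov lam (M.features A hist)) ≤ M.beta lam C₁ A hist}

/-- `Ball^t`: the given initial set for `t = 0`, the confidence ball for `t ≥ 1`. -/
def ball (lam C₁ : ℝ) (Ball₀ : Set (E →L[ℝ] State d)) (A : Algorithm d H U) {t : ℕ}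
    (hist : History d H t) : Set (E →L[ℝ] State d) :=
  if t = 0 then Ball₀ else M.confidenceBall lam C₁ A hist

/-- `A` is a run of the algorithm LC³ with an exact planning oracle: the policy of episode `t` is a
feasible minimizer of `π ↦ min_{W ∈ Ball^t} J^π(x₀; c^t, W)`. -/
def IsLC3 (lam C₁ : ℝ) (Ball₀ : Set (E →L[ℝ] State d)) (A : Algorithm d H U) : Prop :=
  ∀ t (hist : History d H t), A t hist ∈ M.policies ∧
    ∃ What ∈ M.ball lam C₁ Ball₀ A hist,
      ∀ π ∈ M.policies, ∀ W ∈ M.ball lam C₁ Ball₀ A hist,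
        M.J t What (A t hist) ≤ M.J t W π

end KNR

/-- `d̃_T = √(γ (γ + d + log T + H))`. -/
noncomputable def dTilde (γ : ℝ) (d H T : ℕ) : ℝ :=
  √(γ * (γ + d + Real.log T + H))

end Model

end LC3

set_option linter.unusedSectionVars false

/-! The argument is optimism in the face of uncertainty. Let `Σ` be the feature covariance at the
start of an episode, `gain` the logarithm of its determinant ratio, and `γ` the maximum information
gain. If the true model `W⋆` lies in the ball of episode `t`, the planned model `W` satisfies `J t W
π ≤ Jstar t` for the executed policy `π`. The excess cost is then at most the difference of the
costs of one policy under two models. The simulation lemma `lintegral_cost_path_le` bounds this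
difference by `√(H V)` times the square root of the expected sum of `min 1 (‖(W⋆ - W) φ‖² / σ²)`;
second moment and sum are both taken under the true model only.

Two members of a confidence ball satisfy `‖(W⋆ - W) φ‖² ≤ 4 β φᵀ Σ⁻¹ φ`, where `β / σ²` has the
order of `d + log T + gain`. The sum of `φᵀ Σ⁻¹ φ` over an episode, truncated at `1`, is at most
`3/2` of the increment of `gain` (`potential_le`). It remains to bound the expected sum over the
episodes of `(d + log T + H + gain) * potential`. A naive estimate of the product `gain * potential`
would involve the second moment of `gain`, whereas `γ` controls first moments only. The remedy is to
write `gain` as the sum of its increments and exchange the sums: every increment is multiplied by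
the potential of the later episodes. Given the past, these episodes are a run of another algorithm,
with an even larger covariance, so their expected potential is at most `3/2 γ`. This gives `3/2 γ²`
(`lintegral_sum_gain_mul_potential_le`), and Cauchy–Schwarz over the episodes produces `d̃_T √(V H
T)`.

The confidence balls come from self-normalized concentration: for each unit vector `w` of a finite
net of the sphere, an exponential supermartingale of the noise in direction `w` has expectation at
most `1`. Markov's inequality would give failure probabilities that do not vanish with `γ`. Using
`exp x - 1 - x` in place of `exp x` bounds the failure probability in episode `t` by `E[gain] / t²`.
The failures then cost at most `2 γ √V`, which the main term absorbs because `γ ≤ d̃_T`. Only an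
arbitrary initial ball costs the extra `√V`, for episode `0`.

Since the feature space may be infinite dimensional, all facts about `Σ⁻¹` and determinants are
obtained from rank one updates. -/

namespace LC3

/-! ### Positive definite operators, rank one updates and relative determinants -/

section PosDefOp

variable {E : Type*} [NormedAddCommGroup E] [InnerProductSpace ℝ E]

/-- Symmetric and coercive bounded operators. -/
structure PosDefOp (A : E →L[ℝ] E) : Prop where
  symm : ∀ x y, inner ℝ (A x) y = inner ℝ x (A y)
  coercive : ∃ c > 0, ∀ x, c * ‖x‖ ^ 2 ≤ inner ℝ (A x) x

/-- The quadratic form `⟨A⁻¹ x, x⟩`. -/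
noncomputable def invQuad (A : E →L[ℝ] E) (x : E) : ℝ := inner ℝ (Ring.inverse A x) x

/-- The rank one perturbation `A + φ φᵀ`. -/
noncomputable def rankOneUpdate (A : E →L[ℝ] E) (φ : E) : E →L[ℝ] E :=
  A + InnerProductSpace.rankOne ℝ φ φ

theorem rankOneUpdate_apply (A : E →L[ℝ] E) (φ x : E) :
    rankOneUpdate A φ x = A x + (inner ℝ φ x : ℝ) • φ := by
  simp [rankOneUpdate]

/-- The determinant of `1 + (⟨A⁻¹ gᵢ, gⱼ⟩)ᵢⱼ`, that is `det (A + ∑ gᵢ gᵢᵀ) / det A`. -/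
noncomputable def relDet {κ : Type*} [Fintype κ] [DecidableEq κ] (A : E →L[ℝ] E) (g : κ → E) : ℝ :=
  (1 + Matrix.of fun i j => (inner ℝ (Ring.inverse A (g i)) (g j) : ℝ)).det

theorem PosDefOp.inner_nonneg {A : E →L[ℝ] E} (hA : PosDefOp A) (x : E) : 0 ≤ inner ℝ (A x) x := by
  obtain ⟨c, hc, h⟩ := hA.coercive
  exact le_trans (by positivity) (h x)

theorem PosDefOp.add_sum {A : E →L[ℝ] E} (hA : PosDefOp A) {κ : Type*} [Fintype κ] (g : κ → E) :
    PosDefOp (A + ∑ i, InnerProductSpace.rankOne ℝ (g i) (g i)) := by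
  obtain ⟨c, hc, h⟩ := hA.coercive
  refine ⟨fun x y => ?_, c, hc, fun x => ?_⟩
  · simp only [add_apply, sum_apply,
      InnerProductSpace.rankOne_apply, inner_add_left, inner_add_right, hA.symm, sum_inner,
      inner_sum, inner_smul_left, inner_smul_right]
    congr 1
    refine Finset.sum_congr rfl fun i _ => ?_
    simp [real_inner_comm, mul_comm]
  · refine (h x).trans ?_
    simp only [add_apply, sum_apply,
      InnerProductSpace.rankOne_apply, inner_add_left, sum_inner, inner_smul_left]
    refine le_add_of_nonneg_right (Finset.sum_nonneg fun i _ => ?_)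
    simp [mul_self_nonneg]

theorem PosDefOp.rankOneUpdate {A : E →L[ℝ] E} (hA : PosDefOp A) (φ : E) :
    PosDefOp (rankOneUpdate A φ) := by
  simpa [LC3.rankOneUpdate] using hA.add_sum (fun _ : Unit => φ)

theorem posDefOp_smul_id {lam : ℝ} (hlam : 0 < lam) :
    PosDefOp (lam • ContinuousLinearMap.id ℝ E) := by
  refine ⟨fun x y => ?_, lam, hlam, fun x => ?_⟩
  · simp [inner_smul_left, inner_smul_right]
  · simp [inner_smul_left]

theorem posDefOp_cov {ι : Type*} [Fintype ι] {lam : ℝ} (hlam : 0 < lam) (f : ι → E) :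
    PosDefOp (cov lam f) := (posDefOp_smul_id hlam).add_sum f

variable [CompleteSpace E] {A : E →L[ℝ] E}

theorem PosDefOp.isUnit (hA : PosDefOp A) : IsUnit A := by
  obtain ⟨c, hc, h⟩ := hA.coercive
  refine ContinuousLinearMap.isUnit_of_forall_le_norm_inner_map A (c := ⟨c, hc.le⟩) hc fun x => ?_
  rw [mul_comm]
  exact (h x).trans (le_abs_self _)

theorem PosDefOp.apply_inverse (hA : PosDefOp A) (x : E) : A (Ring.inverse A x) = x := by
  have h := Ring.mul_inverse_cancel A hA.isUnit
  simpa using congrArg (fun B : E →L[ℝ] E => B x) h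

theorem PosDefOp.inverse_apply (hA : PosDefOp A) (x : E) : Ring.inverse A (A x) = x := by
  have h := Ring.inverse_mul_cancel A hA.isUnit
  simpa using congrArg (fun B : E →L[ℝ] E => B x) h

theorem PosDefOp.inverse_eq (hA : PosDefOp A) {x y : E} (h : A y = x) : Ring.inverse A x = y := by
  rw [← h, hA.inverse_apply]

theorem PosDefOp.inverse_symm (hA : PosDefOp A) (x y : E) :
    (inner ℝ (Ring.inverse A x) y : ℝ) = inner ℝ (Ring.inverse A y) x := by
  conv_lhs => rw [← hA.apply_inverse y, ← hA.symm, hA.apply_inverse, real_inner_comm]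

theorem PosDefOp.invQuad_nonneg (hA : PosDefOp A) (x : E) : 0 ≤ invQuad A x := by
  have h := hA.inner_nonneg (Ring.inverse A x)
  rwa [hA.apply_inverse, real_inner_comm] at h

theorem PosDefOp.inner_sq_le_inner_mul_inner (hA : PosDefOp A) (x y : E) :
    (inner ℝ (A x) y : ℝ) ^ 2 ≤ inner ℝ (A x) x * inner ℝ (A y) y := by
  have h : ∀ s : ℝ, 0 ≤ inner ℝ (A y) y * (s * s) + (2 * inner ℝ (A x) y) * s + inner ℝ (A x) x := by
    intro s
    have h0 := hA.inner_nonneg (x + s • y)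
    have h1 : inner ℝ (A y) x = (inner ℝ (A x) y : ℝ) := by rw [hA.symm, real_inner_comm]
    simp only [map_add, map_smul, inner_add_left, inner_add_right, inner_smul_left,
      inner_smul_right, h1] at h0
    simp only [conj_trivial] at h0
    linarith
  have := discrim_le_zero h
  rw [discrim] at this
  nlinarith

theorem PosDefOp.inner_sq_le (hA : PosDefOp A) (u x : E) :
    (inner ℝ u x : ℝ) ^ 2 ≤ inner ℝ (A u) u * invQuad A x := by
  have h := hA.inner_sq_le_inner_mul_inner u (Ring.inverse A x)
  rw [hA.symm, hA.apply_inverse, real_inner_comm _ x] at h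
  exact h

theorem PosDefOp.inner_inverse_sq_le (hA : PosDefOp A) (x y : E) :
    (inner ℝ (Ring.inverse A x) y : ℝ) ^ 2 ≤ invQuad A x * invQuad A y := by
  have h := hA.inner_sq_le (Ring.inverse A x) y
  rwa [hA.apply_inverse, real_inner_comm (Ring.inverse A x) x] at h

/-- Inversion reverses the order. Cauchy–Schwarz between `B⁻¹ x` and `x` gives `⟨B⁻¹ x, x⟩² ≤ ⟨A B⁻¹
x, B⁻¹ x⟩ ⟨A⁻¹ x, x⟩`, and by hypothesis the first factor is at most `⟨x, B⁻¹ x⟩`, which cancels. -/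
theorem PosDefOp.invQuad_anti (hA : PosDefOp A) {B : E →L[ℝ] E} (hB : PosDefOp B)
    (hAB : ∀ u, (inner ℝ (A u) u : ℝ) ≤ inner ℝ (B u) u) (x : E) : invQuad B x ≤ invQuad A x := by
  have h := hA.inner_sq_le (Ring.inverse B x) x
  have h2 := hAB (Ring.inverse B x)
  rw [hB.apply_inverse, real_inner_comm (Ring.inverse B x) x] at h2
  have h3 := hB.invQuad_nonneg x
  have h4 := hA.invQuad_nonneg x
  change invQuad B x ^ 2 ≤ _ at h
  change _ ≤ invQuad B x at h2
  rcases h3.eq_or_lt with h0 | h0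
  · rw [← h0]; exact h4
  · refine le_of_mul_le_mul_left ?_ h0
    nlinarith

theorem PosDefOp.sqrt_invQuad_add_le (hA : PosDefOp A) (x y : E) :
    √(invQuad A (x + y)) ≤ √(invQuad A x) + √(invQuad A y) := by
  have hx := hA.invQuad_nonneg x
  have hy := hA.invQuad_nonneg y
  refine Real.sqrt_le_iff.mpr ⟨by positivity, ?_⟩
  have h : invQuad A (x + y) = invQuad A x + 2 * inner ℝ (Ring.inverse A x) y + invQuad A y := by
    simp only [invQuad, map_add, inner_add_left, inner_add_right, hA.inverse_symm y x]
    ring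
  have h2 : (inner ℝ (Ring.inverse A x) y : ℝ) ≤ √(invQuad A x) * √(invQuad A y) := by
    rw [← Real.sqrt_mul hx]
    exact Real.le_sqrt_of_sq_le (hA.inner_inverse_sq_le x y)
  rw [h, add_sq, Real.sq_sqrt hx, Real.sq_sqrt hy]
  linarith

theorem invQuad_smul (c : ℝ) (x : E) : invQuad A (c • x) = c ^ 2 * invQuad A x := by
  simp [invQuad, inner_smul_left, inner_smul_right]
  ring

/-- Sherman–Morrison formula, checked by applying the updated operator to the right-hand side. -/
theorem PosDefOp.inverse_rankOneUpdate (hA : PosDefOp A) (φ x : E) :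
    Ring.inverse (LC3.rankOneUpdate A φ) x = Ring.inverse A x -
      (inner ℝ (Ring.inverse A φ) x / (1 + invQuad A φ) : ℝ) • Ring.inverse A φ := by
  have hq := hA.invQuad_nonneg φ
  refine (hA.rankOneUpdate φ).inverse_eq ?_
  rw [rankOneUpdate_apply, map_sub, map_smul, hA.apply_inverse, hA.apply_inverse, inner_sub_right,
    inner_smul_right, real_inner_comm (Ring.inverse A x) φ, hA.inverse_symm x φ,
    real_inner_comm (Ring.inverse A φ) φ]
  change x - _ • φ + (_ - _ * invQuad A φ) • φ = x
  rw [sub_add, ← sub_smul]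
  have : (inner ℝ (Ring.inverse A φ) x : ℝ) / (1 + invQuad A φ) -
    (inner ℝ (Ring.inverse A φ) x - inner ℝ (Ring.inverse A φ) x / (1 + invQuad A φ) * invQuad A φ)
      = 0 := by field_simp; ring
  rw [this, zero_smul, sub_zero]

theorem PosDefOp.inner_inverse_rankOneUpdate (hA : PosDefOp A) (φ x y : E) :
    (inner ℝ (Ring.inverse (LC3.rankOneUpdate A φ) x) y : ℝ) = inner ℝ (Ring.inverse A x) y -
      inner ℝ (Ring.inverse A φ) x * inner ℝ (Ring.inverse A φ) y / (1 + invQuad A φ) := by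
  rw [hA.inverse_rankOneUpdate, inner_sub_left, inner_smul_left]
  simp only [conj_trivial]
  ring

/-- With `q = invQuad A φ`, Sherman–Morrison subtracts `⟨A⁻¹ φ, x⟩² / (1 + q)`, which by
Cauchy–Schwarz is at most the fraction `q / (1 + q)` of `invQuad A x`. -/
theorem PosDefOp.invQuad_le_one_add_mul (hA : PosDefOp A) (φ x : E) :
    invQuad A x ≤ (1 + invQuad A φ) * invQuad (LC3.rankOneUpdate A φ) x := by
  have hq := hA.invQuad_nonneg φ
  have h := hA.inner_inverse_sq_le φ x
  rw [invQuad.eq_def (LC3.rankOneUpdate A φ), hA.inner_inverse_rankOneUpdate]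
  change invQuad A x ≤ (1 + invQuad A φ) * (invQuad A x - _)
  have : (1 + invQuad A φ) * (invQuad A x - inner ℝ (Ring.inverse A φ) x *
      inner ℝ (Ring.inverse A φ) x / (1 + invQuad A φ)) = (1 + invQuad A φ) * invQuad A x -
      (inner ℝ (Ring.inverse A φ) x) ^ 2 := by field_simp
  rw [this]
  linarith

/-- Continuity of `⟨A⁻¹ x, y⟩` in all its arguments. -/
theorem continuous_inner_inverse {X : Type*} [TopologicalSpace X] {A : X → E →L[ℝ] E}
    {x y : X → E} (hA : Continuous A) (hpos : ∀ a, PosDefOp (A a)) (hx : Continuous x)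
    (hy : Continuous y) :
    Continuous fun a => (inner ℝ (Ring.inverse (A a) (x a)) (y a) : ℝ) := by
  have h : Continuous fun a => Ring.inverse (A a) := by
    refine continuous_iff_continuousAt.mpr fun a => ?_
    obtain ⟨U, hU⟩ := (hpos a).isUnit
    have := NormedRing.inverse_continuousAt U
    rw [hU] at this
    exact ContinuousAt.comp (f := A) (g := Ring.inverse) this hA.continuousAt
  exact (h.clm_apply hx).inner hy

theorem relDet_comp_equiv {κ κ' : Type*} [Fintype κ] [DecidableEq κ] [Fintype κ'] [DecidableEq κ']
    (e : κ' ≃ κ) (g : κ → E) : relDet A (g ∘ e) = relDet A g := by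
  rw [relDet, relDet, ← Matrix.det_submatrix_equiv_self e]
  congr 1
  ext i j
  simp [Matrix.one_apply]

theorem relDet_of_isEmpty {κ : Type*} [Fintype κ] [DecidableEq κ] [IsEmpty κ] (g : κ → E) :
    relDet A g = 1 := by
  simp [relDet]

/-- Matrix determinant lemma: by Sherman–Morrison, the Schur complement of the corner `1 + invQuad A
φ` is the matrix that defines `relDet` of the updated operator. -/
theorem PosDefOp.relDet_sum_unit (hA : PosDefOp A) {κ : Type*} [Fintype κ] [DecidableEq κ] (φ : E)
    (g : κ → E) : relDet A (Sum.elim (fun _ : Unit => φ) g) =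
      (1 + invQuad A φ) * relDet (LC3.rankOneUpdate A φ) g := by
  have hq := hA.invQuad_nonneg φ
  have h1 : (1 + Matrix.of fun i j => (inner ℝ (Ring.inverse A
      (Sum.elim (fun _ : Unit => φ) g i)) (Sum.elim (fun _ : Unit => φ) g j) : ℝ)) =
      Matrix.fromBlocks (Matrix.of fun _ _ : Unit => 1 + invQuad A φ)
        (Matrix.of fun _ j => (inner ℝ (Ring.inverse A φ) (g j) : ℝ))
        (Matrix.of fun i _ => (inner ℝ (Ring.inverse A (g i)) φ : ℝ))
        (1 + Matrix.of fun i j => (inner ℝ (Ring.inverse A (g i)) (g j) : ℝ)) := by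
    ext i j
    rcases i with i | i <;> rcases j with j | j <;> simp [invQuad, Matrix.one_apply]
  have hne : (1 + invQuad A φ) ≠ 0 := by positivity
  let _ : Invertible (Matrix.of fun _ _ : Unit => 1 + invQuad A φ) :=
    ⟨Matrix.of fun _ _ => (1 + invQuad A φ)⁻¹, by ext; simp [Matrix.mul_apply, hne],
      by ext; simp [Matrix.mul_apply, hne]⟩
  rw [relDet, h1, Matrix.det_fromBlocks₁₁, relDet]
  congr 1
  · simp
  · congr 1
    ext i j
    have : ⅟(Matrix.of fun _ _ : Unit => 1 + invQuad A φ) =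
      Matrix.of fun _ _ => (1 + invQuad A φ)⁻¹ := rfl
    simp only [this, Matrix.sub_apply, Matrix.add_apply, Matrix.of_apply,
      hA.inner_inverse_rankOneUpdate, Matrix.mul_apply, Finset.univ_unique, Finset.sum_singleton,
      hA.inverse_symm (g i) φ]
    ring

theorem PosDefOp.relDet_cons (hA : PosDefOp A) {n : ℕ} (g : Fin (n + 1) → E) :
    relDet A g = (1 + invQuad A (g 0)) * relDet (LC3.rankOneUpdate A (g 0)) (fun i : Fin n => g i.succ) := by
  let e : Unit ⊕ Fin n ≃ Fin (n + 1) :=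
    (Equiv.sumComm _ _).trans ((Equiv.optionEquivSumPUnit _).symm.trans (finSuccEquiv n).symm)
  rw [← hA.relDet_sum_unit, ← relDet_comp_equiv e g]
  congr 1
  ext i
  rcases i with i | i <;> simp [e]

/-- This handles a whole episode whose features are all measured with the covariance at its start.
The determinant is a product over successive updates, and each factor `1 + invQuad A φ` makes up for
the decrease of the remaining quadratic forms caused by that update. -/
theorem PosDefOp.one_add_sum_invQuad_le_relDet (hA : PosDefOp A) {n : ℕ} (g : Fin n → E) :
    1 + ∑ i, invQuad A (g i) ≤ relDet A g := by
  induction n generalizing A with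
  | zero => simp [relDet_of_isEmpty]
  | succ n ih =>
    have hq := hA.invQuad_nonneg (g 0)
    have h := ih (hA.rankOneUpdate (g 0)) (fun i => g i.succ)
    rw [hA.relDet_cons, Fin.sum_univ_succ]
    refine le_trans ?_ (mul_le_mul_of_nonneg_left h (by positivity))
    rw [mul_add, mul_one, Finset.mul_sum, ← add_assoc]
    gcongr
    exact hA.invQuad_le_one_add_mul _ _

/-- Chain rule for determinant ratios, by absorbing the vectors `f i` one at a time. It makes the
information gain additive over episodes. -/
theorem PosDefOp.relDet_sum (hA : PosDefOp A) {ι κ : Type*} [Fintype ι] [DecidableEq ι] [Fintype κ]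
    [DecidableEq κ] (f : ι → E) (g : κ → E) : relDet A (Sum.elim f g) =
      relDet A f * relDet (A + ∑ i, InnerProductSpace.rankOne ℝ (f i) (f i)) g := by
  have key : ∀ (n : ℕ) (A : E →L[ℝ] E), PosDefOp A → ∀ f : Fin n → E, relDet A (Sum.elim f g) =
      relDet A f * relDet (A + ∑ i, InnerProductSpace.rankOne ℝ (f i) (f i)) g := by
    intro n
    induction n with
    | zero =>
      intro A hA f
      rw [relDet_of_isEmpty f, one_mul, ← relDet_comp_equiv (Equiv.emptySum (Fin 0) κ) g]
      simp only [Finset.univ_eq_empty, Finset.sum_empty, add_zero]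
      congr 1
      ext i
      rcases i with i | i
      · exact i.elim0
      · simp
    | succ n ih =>
      intro A hA f
      have h := ih _ (hA.rankOneUpdate (f 0)) (fun i => f i.succ)
      rw [hA.relDet_cons f, Fin.sum_univ_succ, ← add_assoc, mul_assoc]
      change _ = _ * (_ * relDet (LC3.rankOneUpdate A (f 0) + _) g)
      rw [← h, ← hA.relDet_sum_unit]
      let e : Unit ⊕ (Fin n ⊕ κ) ≃ Fin (n + 1) ⊕ κ :=
        (Equiv.sumAssoc _ _ _).symm.trans (Equiv.sumCongr ((Equiv.sumComm _ _).trans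
          ((Equiv.optionEquivSumPUnit _).symm.trans (finSuccEquiv n).symm)) (Equiv.refl κ))
      rw [← relDet_comp_equiv e (Sum.elim f g)]
      congr 1
      ext i
      rcases i with i | i | i <;> simp [e]
  let e := (Fintype.equivFin ι).symm
  have h := key _ A hA (f ∘ e)
  have h1 : Sum.elim f g ∘ (Equiv.sumCongr e (Equiv.refl κ)) = Sum.elim (f ∘ e) g := by
    ext i
    rcases i with i | i <;> simp
  have h2 : ∑ i, InnerProductSpace.rankOne ℝ ((f ∘ e) i) ((f ∘ e) i) =
      ∑ i, InnerProductSpace.rankOne ℝ (f i) (f i) :=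
    Equiv.sum_comp e (fun i => InnerProductSpace.rankOne ℝ (f i) (f i))
  rw [← relDet_comp_equiv (Equiv.sumCongr e (Equiv.refl κ)), h1, h, h2, relDet_comp_equiv]

theorem PosDefOp.one_le_relDet (hA : PosDefOp A) {κ : Type*} [Fintype κ] [DecidableEq κ]
    (g : κ → E) : 1 ≤ relDet A g := by
  rw [← relDet_comp_equiv (Fintype.equivFin κ).symm g]
  refine le_trans ?_ (hA.one_add_sum_invQuad_le_relDet _)
  exact le_add_of_nonneg_right (Finset.sum_nonneg fun i _ => hA.invQuad_nonneg _)

end PosDefOp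

/-! ### The feature covariance and its determinant ratio -/

section Cov

variable {E : Type*} [NormedAddCommGroup E] [InnerProductSpace ℝ E]
variable {ι κ : Type*} [Fintype ι] [Fintype κ] {lam : ℝ}

theorem cov_sumElim (f : ι → E) (g : κ → E) :
    cov lam (Sum.elim f g) = cov lam f + ∑ i, InnerProductSpace.rankOne ℝ (g i) (g i) := by
  simp [cov, add_assoc]

theorem cov_comp_equiv (e : κ ≃ ι) (f : ι → E) : cov lam (f ∘ e) = cov lam f := by
  rw [cov, cov]
  congr 1
  exact Equiv.sum_comp e (fun i => InnerProductSpace.rankOne ℝ (f i) (f i))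

theorem continuous_cov (lam : ℝ) : Continuous fun f : ι → E => cov lam f := by
  unfold cov
  refine continuous_const.add (continuous_finsetSum _ fun i _ => ?_)
  have h : Continuous fun x : E => InnerProductSpace.rankOne ℝ x x := by
    simp only [InnerProductSpace.rankOne_def]
    fun_prop
  exact h.comp (continuous_apply i)

theorem invQuad_cov_anti [CompleteSpace E] (hlam : 0 < lam) {f : ι → E} {g : κ → E} (e : κ ↪ ι)
    (hfg : ∀ k, f (e k) = g k) (x : E) : invQuad (cov lam f) x ≤ invQuad (cov lam g) x := by
  refine (posDefOp_cov hlam g).invQuad_anti (posDefOp_cov hlam f) (fun u => ?_) x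
  simp only [cov, add_apply, inner_add_left, sum_apply,
    sum_inner, InnerProductSpace.rankOne_apply, inner_smul_left, conj_trivial]
  gcongr
  simp only [← hfg]
  rw [← Finset.sum_map Finset.univ e (fun i => (inner ℝ (f i) u : ℝ) * inner ℝ (f i) u)]
  exact Finset.sum_le_sum_of_subset_of_nonneg (Finset.subset_univ _)
    fun i _ _ => mul_self_nonneg _

end Cov

section DetRatio

variable {E : Type*} [NormedAddCommGroup E] [InnerProductSpace ℝ E]
variable {ι κ : Type*} [Fintype ι] [DecidableEq ι] [Fintype κ] [DecidableEq κ] {lam : ℝ}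

theorem continuous_detRatio (lam : ℝ) : Continuous fun f : ι → E => detRatio lam f := by
  unfold detRatio
  refine Continuous.matrix_det ?_
  refine continuous_matrix fun i j => ?_
  simp only [Matrix.add_apply, Matrix.smul_apply, Matrix.gram_apply, smul_eq_mul]
  fun_prop

variable [CompleteSpace E]

theorem detRatio_eq_relDet (hlam : 0 < lam) (f : ι → E) :
    detRatio lam f = relDet (lam • ContinuousLinearMap.id ℝ E) f := by
  rw [detRatio, relDet]
  congr 2
  ext i j
  have h : Ring.inverse (lam • ContinuousLinearMap.id ℝ E) (f i) = lam⁻¹ • f i :=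
    (posDefOp_smul_id hlam).inverse_eq (by simp [smul_smul, hlam.ne'])
  simp [h, inner_smul_left, Matrix.gram_apply]

theorem detRatio_sumElim (hlam : 0 < lam) (f : ι → E) (g : κ → E) :
    detRatio lam (Sum.elim f g) = detRatio lam f * relDet (cov lam f) g := by
  rw [detRatio_eq_relDet hlam, detRatio_eq_relDet hlam, (posDefOp_smul_id hlam).relDet_sum, cov]

theorem detRatio_comp_equiv (hlam : 0 < lam) (e : κ ≃ ι) (f : ι → E) :
    detRatio lam (f ∘ e) = detRatio lam f := by
  rw [detRatio_eq_relDet hlam, detRatio_eq_relDet hlam, relDet_comp_equiv]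

theorem one_le_detRatio (hlam : 0 < lam) (f : ι → E) : 1 ≤ detRatio lam f := by
  rw [detRatio_eq_relDet hlam]
  exact (posDefOp_smul_id hlam).one_le_relDet f

end DetRatio

/-! ### Gaussian noise: shifts, likelihood ratios, exponential integrals -/

section Gaussian

/-- The law `N(0, σ² I)` of the noise of one step. -/
noncomputable abbrev stepNoise (d : ℕ) (σ : ℝ) : Measure (State d) :=
  multivariateGaussian 0 (σ ^ 2 • (1 : Matrix (Fin d) (Fin d) ℝ))

theorem charFun_stepNoise (d : ℕ) (σ : ℝ) (x : State d) :
    charFun (stepNoise d σ) x = Complex.exp (-(σ ^ 2 * ‖x‖ ^ 2 / 2 : ℝ)) := by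
  rw [charFun_multivariateGaussian (Matrix.PosSemidef.one.smul (sq_nonneg σ))]
  congr 1
  have : (x.ofLp ⬝ᵥ (σ ^ 2 • (1 : Matrix (Fin d) (Fin d) ℝ)).mulVec x.ofLp) = σ ^ 2 * ‖x‖ ^ 2 := by
    rw [Matrix.smul_mulVec, Matrix.one_mulVec, dotProduct_smul, EuclideanSpace.real_norm_sq_eq]
    simp [dotProduct, sq]
  rw [this]
  simp

theorem stepNoise_eq_map_pi (d : ℕ) (σ : ℝ) :
    stepNoise d σ = (Measure.pi fun _ : Fin d => gaussianReal 0 (σ ^ 2).toNNReal).map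
      (WithLp.toLp 2) := by
  have : IsProbabilityMeasure ((Measure.pi fun _ : Fin d =>
    gaussianReal 0 (σ ^ 2).toNNReal).map (WithLp.toLp 2)) :=
    Measure.isProbabilityMeasure_map (by fun_prop)
  refine Measure.ext_of_charFun ?_
  ext t
  rw [charFun_stepNoise, charFun_pi]
  simp_rw [charFun_gaussianReal]
  rw [← Complex.exp_sum]
  congr 1
  rw [EuclideanSpace.real_norm_sq_eq, Finset.mul_sum, Finset.sum_div]
  push_cast
  rw [← Finset.sum_neg_distrib]
  refine Finset.sum_congr rfl fun i _ => ?_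
  rw [Real.coe_toNNReal _ (sq_nonneg σ)]
  push_cast
  ring

theorem map_inner_stepNoise (d : ℕ) (σ : ℝ) (w : State d) :
    (stepNoise d σ).map (fun x => (inner ℝ w x : ℝ)) =
      gaussianReal 0 (σ ^ 2 * ‖w‖ ^ 2).toNNReal := by
  have hm : Measurable fun x : State d => (inner ℝ w x : ℝ) := by fun_prop
  have : IsProbabilityMeasure ((stepNoise d σ).map (fun x => (inner ℝ w x : ℝ))) :=
    Measure.isProbabilityMeasure_map hm.aemeasurable
  refine Measure.ext_of_charFun ?_
  ext t
  have h : charFun ((stepNoise d σ).map (fun x => (inner ℝ w x : ℝ))) t =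
      charFun (stepNoise d σ) (t • w) := by
    rw [charFun_apply, charFun_apply, integral_map hm.aemeasurable
      (Measurable.aestronglyMeasurable (by fun_prop))]
    congr 1
    ext x
    simp [inner_smul_right, real_inner_comm]
  rw [h, charFun_stepNoise, charFun_gaussianReal,
    Real.coe_toNNReal _ (mul_nonneg (sq_nonneg σ) (sq_nonneg _)), norm_smul, mul_pow,
    Real.norm_eq_abs, sq_abs]
  congr 1
  push_cast
  ring

theorem gaussianReal_eq_withDensity (m : ℝ) {v : ℝ≥0} (hv : v ≠ 0) :
    gaussianReal m v = (gaussianReal 0 v).withDensity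
      (fun x => ENNReal.ofReal (Real.exp (m * x / v - m ^ 2 / (2 * v)))) := by
  have hv' : (v : ℝ) ≠ 0 := by exact_mod_cast hv
  rw [gaussianReal_of_var_ne_zero m hv, gaussianReal_of_var_ne_zero 0 hv, ← withDensity_mul _
    (measurable_gaussianPDF _ _) (by fun_prop)]
  congr 1
  ext x
  simp only [Pi.mul_apply, gaussianPDF, gaussianPDFReal]
  rw [← ENNReal.ofReal_mul (by positivity), mul_assoc _ (Real.exp _), ← Real.exp_add]
  congr 3
  field_simp
  ring

theorem pi_withDensity {ι : Type*} [Fintype ι] {μ : ι → Measure ℝ} [∀ i, IsProbabilityMeasure (μ i)]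
    {f : ι → ℝ → ℝ≥0∞} (hf : ∀ i, Measurable (f i))
    [∀ i, IsProbabilityMeasure ((μ i).withDensity (f i))] :
    Measure.pi (fun i => (μ i).withDensity (f i)) =
      (Measure.pi μ).withDensity (fun x => ∏ i, f i (x i)) := by
  refine Measure.pi_eq fun s hs => ?_
  have hpi : MeasurableSet (Set.univ.pi s) := MeasurableSet.univ_pi hs
  rw [withDensity_apply _ hpi, ← lintegral_indicator hpi]
  have h1 : (Set.univ.pi s).indicator (fun x : ι → ℝ => ∏ i, f i (x i)) =
      fun x => ∏ i, (s i).indicator (f i) (x i) := by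
    ext x
    by_cases hx : x ∈ Set.univ.pi s
    · rw [Set.indicator_of_mem hx]
      exact Finset.prod_congr rfl fun i _ => (Set.indicator_of_mem (hx i (Set.mem_univ i)) _).symm
    · rw [Set.indicator_of_notMem hx]
      simp only [Set.mem_pi, Set.mem_univ, forall_true_left, not_forall] at hx
      obtain ⟨i, hi⟩ := hx
      exact (Finset.prod_eq_zero (Finset.mem_univ i) (Set.indicator_of_notMem hi _)).symm
  have hm : ∀ i, Measurable ((s i).indicator (f i)) := fun i => (hf i).indicator (hs i)
  rw [h1, lintegral_prod_eq_prod_lintegral_of_indepFun Finset.univ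
    (fun i (x : ι → ℝ) => (s i).indicator (f i) (x i))
    (iIndepFun_pi (X := fun i => (s i).indicator (f i)) fun i => (hm i).aemeasurable)
    (fun i => (hm i).comp (measurable_pi_apply i))]
  refine Finset.prod_congr rfl fun i _ => ?_
  rw [withDensity_apply _ (hs i), ← lintegral_indicator (hs i),
    ← (measurePreserving_eval μ i).lintegral_comp (hm i)]

/-- Cameron–Martin formula. The coordinates are independent, so the density is the product of the
one-dimensional likelihood ratios. -/
theorem map_add_stepNoise (d : ℕ) {σ : ℝ} (hσ : 0 < σ) (δ : State d) :
    (stepNoise d σ).map (· + δ) = (stepNoise d σ).withDensity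
      (fun x => ENNReal.ofReal
        (Real.exp (inner ℝ δ x / σ ^ 2 - ‖δ‖ ^ 2 / (2 * σ ^ 2)))) := by
  have hv : (σ ^ 2).toNNReal ≠ 0 := by simpa using hσ.ne'
  have hv' : ((σ ^ 2).toNNReal : ℝ) = σ ^ 2 := Real.coe_toNNReal _ (sq_nonneg σ)
  have hto : Measurable (WithLp.toLp 2 : (Fin d → ℝ) → State d) := by fun_prop
  have hsh : Measurable (fun x : Fin d → ℝ => fun i => x i + δ i) := by fun_prop
  have h1 : (stepNoise d σ).map (· + δ) =
      (Measure.pi fun i : Fin d => gaussianReal (δ i) (σ ^ 2).toNNReal).map (WithLp.toLp 2) := by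
    have h2 : (Measure.pi fun _ : Fin d => gaussianReal 0 (σ ^ 2).toNNReal).map
        (fun x i => x i + δ i) =
        Measure.pi fun i : Fin d => gaussianReal (δ i) (σ ^ 2).toNNReal := by
      have h3 : ∀ i : Fin d, (gaussianReal 0 (σ ^ 2).toNNReal).map (fun y => y + δ i) =
          gaussianReal (δ i) (σ ^ 2).toNNReal := fun i => by
        rw [gaussianReal_map_add_const, zero_add]
      have : ∀ i : Fin d, SigmaFinite ((gaussianReal 0 (σ ^ 2).toNNReal).map (fun y => y + δ i)) :=
        fun i => by rw [h3]; infer_instance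
      rw [Measure.pi_map_pi (f := fun i y => y + δ i) (fun i => by fun_prop)]
      congr 1
      ext1 i
      exact h3 i
    rw [← h2, stepNoise_eq_map_pi, Measure.map_map (by fun_prop) hto,
      Measure.map_map hto hsh]
    rfl
  have h4 : (Measure.pi fun i : Fin d => gaussianReal (δ i) (σ ^ 2).toNNReal) =
      (Measure.pi fun _ : Fin d => gaussianReal 0 (σ ^ 2).toNNReal).withDensity
        (fun x => ENNReal.ofReal (Real.exp
          (inner ℝ δ (WithLp.toLp 2 x) / σ ^ 2 - ‖δ‖ ^ 2 / (2 * σ ^ 2)))) := by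
    have h5 : ∀ i : Fin d, gaussianReal (δ i) (σ ^ 2).toNNReal = _ :=
      fun i => gaussianReal_eq_withDensity (δ i) hv
    have : ∀ i : Fin d, IsProbabilityMeasure ((gaussianReal 0 (σ ^ 2).toNNReal).withDensity
      (fun x => ENNReal.ofReal (Real.exp
        (δ i * x / (σ ^ 2).toNNReal - δ i ^ 2 / (2 * (σ ^ 2).toNNReal))))) :=
      fun i => by rw [← h5]; infer_instance
    rw [funext h5, pi_withDensity (fun i => by fun_prop)]
    congr 1
    ext x
    rw [← ENNReal.ofReal_prod_of_nonneg (fun i _ => (Real.exp_pos _).le), ← Real.exp_sum, hv',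
      Finset.sum_sub_distrib, ← Finset.sum_div, ← Finset.sum_div, EuclideanSpace.real_norm_sq_eq]
    simp [PiLp.inner_apply, mul_comm]
  rw [h1, h4, stepNoise_eq_map_pi]
  ext s hs
  rw [Measure.map_apply hto hs, withDensity_apply _ (hto hs), withDensity_apply _ hs,
    setLIntegral_map hs (by fun_prop) hto]

/-- Only `r < 1` matters, where the first two terms of the series of `-log (1 - (1 - r))` suffice.
-/
theorem max_one_sub_sq_le {r : ℝ} (hr : 0 < r) :
    (max (1 - r) 0) ^ 2 ≤ 2 * (r - 1 - Real.log r) := by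
  have h0 := Real.log_le_sub_one_of_pos hr
  rcases le_or_gt 1 r with h | h
  · rw [max_eq_right (by linarith)]
    nlinarith
  · rw [max_eq_left (by linarith)]
    have h1 := Real.hasSum_pow_div_log_of_abs_lt_one (x := 1 - r) (by rw [abs_lt]; constructor <;> linarith)
    have h2 := sum_le_hasSum (Finset.range 2) (fun n _ => by
      have : 0 ≤ 1 - r := by linarith
      positivity) h1
    simp [Finset.sum_range_succ] at h2
    linarith

/-- The subtraction is truncated, so only the positive part of `1 - ρ` counts. Its square is at most
`2 (ρ - 1 - log ρ)`, whose expectation is twice the Kullback–Leibler divergence, that is `‖δ‖² /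
σ²`. The untruncated square would have an expectation exponential in `‖δ‖²`. -/
theorem lintegral_one_sub_density_sq_le (d : ℕ) {σ : ℝ} (hσ : 0 < σ) (δ : State d) :
    ∫⁻ x, (1 - ENNReal.ofReal (Real.exp (inner ℝ δ x / σ ^ 2 - ‖δ‖ ^ 2 / (2 * σ ^ 2)))) ^ 2
      ∂stepNoise d σ ≤ ENNReal.ofReal (min 1 (‖δ‖ ^ 2 / σ ^ 2)) := by
  rw [ENNReal.ofReal_min, ENNReal.ofReal_one]
  refine le_min ?_ ?_
  · refine (lintegral_mono (g := fun _ => 1) fun x => ?_).trans_eq (by simp)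
    exact pow_le_one₀ (by positivity) tsub_le_self
  · set ρ : ℝ → ℝ := fun z => Real.exp (z / σ ^ 2 - ‖δ‖ ^ 2 / (2 * σ ^ 2)) with hρ
    set v : ℝ≥0 := (σ ^ 2 * ‖δ‖ ^ 2).toNNReal with hv
    have hv' : (v : ℝ) = σ ^ 2 * ‖δ‖ ^ 2 := Real.coe_toNNReal _ (by positivity)
    have hm : Measurable fun x : State d => (inner ℝ δ x : ℝ) := by fun_prop
    have hρe : ∀ z, ρ z = Real.exp (-(‖δ‖ ^ 2 / (2 * σ ^ 2))) * Real.exp (1 / σ ^ 2 * z) := by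
      intro z
      rw [← Real.exp_add]
      change Real.exp _ = _
      congr 1
      field_simp
      ring
    have hi1 : Integrable ρ (gaussianReal 0 v) := by
      rw [funext hρe]
      exact (integrable_exp_mul_gaussianReal _).const_mul _
    have hi2 : Integrable (fun z : ℝ => z / σ ^ 2) (gaussianReal 0 v) :=
      ((memLp_id_gaussianReal 1).integrable (by simp)).div_const _
    have hint1 : ∫ z, ρ z ∂gaussianReal 0 v = 1 := by
      rw [funext hρe, integral_const_mul]
      have h := congrFun (mgf_fun_id_gaussianReal (μ := 0) (v := v)) (1 / σ ^ 2)
      rw [mgf] at h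
      rw [h, ← Real.exp_add, hv', Real.exp_eq_one_iff]
      field_simp
      ring
    have hint2 : ∫ z, z / σ ^ 2 ∂gaussianReal 0 v = 0 := by
      rw [integral_div, integral_id_gaussianReal, zero_div]
    have hi3 : Integrable (fun z => 2 * (ρ z - 1 - (z / σ ^ 2 - ‖δ‖ ^ 2 / (2 * σ ^ 2))))
        (gaussianReal 0 v) :=
      ((hi1.sub (integrable_const _)).sub (hi2.sub (integrable_const _))).const_mul _
    have hpt : ∀ z, (max (1 - ρ z) 0) ^ 2 ≤
        2 * (ρ z - 1 - (z / σ ^ 2 - ‖δ‖ ^ 2 / (2 * σ ^ 2))) := by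
      intro z
      have h := max_one_sub_sq_le (Real.exp_pos (z / σ ^ 2 - ‖δ‖ ^ 2 / (2 * σ ^ 2)))
      rwa [Real.log_exp] at h
    calc ∫⁻ x, (1 - ENNReal.ofReal (ρ (inner ℝ δ x))) ^ 2 ∂stepNoise d σ
        = ∫⁻ z, (1 - ENNReal.ofReal (ρ z)) ^ 2 ∂gaussianReal 0 v := by
          rw [hv, ← map_inner_stepNoise, lintegral_map (by fun_prop) hm]
      _ ≤ ∫⁻ z, ENNReal.ofReal (2 * (ρ z - 1 - (z / σ ^ 2 - ‖δ‖ ^ 2 / (2 * σ ^ 2))))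
            ∂gaussianReal 0 v := by
          refine lintegral_mono fun z => ?_
          refine le_trans (le_of_eq ?_) (ENNReal.ofReal_le_ofReal (hpt z))
          rw [ENNReal.ofReal_pow (le_max_right _ _), ENNReal.ofReal_max, ENNReal.ofReal_zero,
            max_eq_left (by simp), ENNReal.ofReal_sub _ (Real.exp_pos _).le, ENNReal.ofReal_one]
      _ = ENNReal.ofReal (∫ z, 2 * (ρ z - 1 - (z / σ ^ 2 - ‖δ‖ ^ 2 / (2 * σ ^ 2)))
            ∂gaussianReal 0 v) :=
          (ofReal_integral_eq_lintegral_ofReal hi3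
            (Filter.Eventually.of_forall fun z => (sq_nonneg _).trans (hpt z))).symm
      _ = ENNReal.ofReal (‖δ‖ ^ 2 / σ ^ 2) := by
          have e1 : ∫ z, (ρ z - 1 - (z / σ ^ 2 - ‖δ‖ ^ 2 / (2 * σ ^ 2))) ∂gaussianReal 0 v =
              ∫ z, (ρ z - 1) ∂gaussianReal 0 v -
                ∫ z, (z / σ ^ 2 - ‖δ‖ ^ 2 / (2 * σ ^ 2)) ∂gaussianReal 0 v :=
            integral_sub (hi1.sub (integrable_const _)) (hi2.sub (integrable_const _))
          rw [integral_const_mul, e1, integral_sub hi1 (integrable_const _),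
            integral_sub hi2 (integrable_const _), hint1, hint2]
          simp only [integral_const, probReal_univ, smul_eq_mul, one_mul]
          congr 1
          field_simp
          ring

theorem lintegral_mul_le_sqrt_mul_sqrt {α : Type*} [MeasurableSpace α] {μ : Measure α}
    {f g : α → ℝ≥0∞} (hf : AEMeasurable f μ) (hg : AEMeasurable g μ) :
    ∫⁻ a, f a * g a ∂μ ≤
      (∫⁻ a, f a ^ 2 ∂μ) ^ (1 / 2 : ℝ) * (∫⁻ a, g a ^ 2 ∂μ) ^ (1 / 2 : ℝ) := by
  simpa using ENNReal.lintegral_mul_le_Lp_mul_Lq μ Real.HolderConjugate.two_two hf hg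

/-- Comparison of the expectations of a non-negative function under two Gaussians with the same
covariance. -/
theorem lintegral_stepNoise_le (d : ℕ) {σ : ℝ} (hσ : 0 < σ) (a b : State d) {m : State d → ℝ≥0∞}
    (hm : Measurable m) :
    ∫⁻ x, m (a + x) ∂stepNoise d σ ≤ ∫⁻ x, m (b + x) ∂stepNoise d σ +
      (∫⁻ x, m (a + x) ^ 2 ∂stepNoise d σ) ^ (1 / 2 : ℝ) *
        (ENNReal.ofReal (min 1 (‖a - b‖ ^ 2 / σ ^ 2))) ^ (1 / 2 : ℝ) := by
  -- Density of the noise shifted by `b - a`: it turns the integral of `m (b + x)` into that of `ρ x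
  -- * m (a + x)`.
  set ρ : State d → ℝ≥0∞ := fun x => ENNReal.ofReal
    (Real.exp (inner ℝ (b - a) x / σ ^ 2 - ‖b - a‖ ^ 2 / (2 * σ ^ 2))) with hρ
  have hρm : Measurable ρ := by fun_prop
  have hma : Measurable fun x => m (a + x) := hm.comp (measurable_const_add a)
  have h1 : ∫⁻ x, m (b + x) ∂stepNoise d σ = ∫⁻ x, ρ x * m (a + x) ∂stepNoise d σ := by
    have h := lintegral_map (μ := stepNoise d σ) hma (measurable_add_const (b - a))
    rw [map_add_stepNoise d hσ, lintegral_withDensity_eq_lintegral_mul _ hρm hma] at h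
    simp only [Pi.mul_apply] at h
    rw [h]
    refine lintegral_congr fun x => ?_
    congr 1
    abel
  -- With truncated subtraction `1 ≤ ρ + (1 - ρ)`. Cauchy–Schwarz then needs the second moment at
  -- the mean `a` only.
  calc ∫⁻ x, m (a + x) ∂stepNoise d σ
      ≤ ∫⁻ x, (ρ x * m (a + x) + m (a + x) * (1 - ρ x)) ∂stepNoise d σ := by
        refine lintegral_mono fun x => ?_
        rw [mul_comm (ρ x), ← mul_add]
        exact le_mul_of_one_le_right' (by rw [add_comm]; exact le_tsub_add)
    _ = ∫⁻ x, m (b + x) ∂stepNoise d σ + ∫⁻ x, m (a + x) * (1 - ρ x) ∂stepNoise d σ := by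
        rw [h1]
        exact lintegral_add_left (hρm.mul hma) _
    _ ≤ _ := by
        gcongr
        refine (lintegral_mul_le_sqrt_mul_sqrt hma.aemeasurable
          (hρm.const_sub 1).aemeasurable).trans ?_
        gcongr
        rw [norm_sub_rev]
        exact lintegral_one_sub_density_sq_le d hσ (b - a)

/-- Completing the square: up to a constant, the integrand times the density of `N(0, v)` is the
density of `N(s, v (1 + q))`. -/
theorem lintegral_exp_quadratic_gaussianReal {v : ℝ≥0} (hv : v ≠ 0) {q : ℝ} (hq : 0 ≤ q) (s : ℝ) :
    ∫⁻ η, ENNReal.ofReal (Real.exp ((2 * η * s + η ^ 2 * q) / (2 * v * (1 + q))))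
      ∂gaussianReal 0 v =
      ENNReal.ofReal (√(1 + q) * Real.exp (s ^ 2 / (2 * v * (1 + q)))) := by
  have hv' : (0 : ℝ) < v := by positivity
  have hq' : 0 < 1 + q := by positivity
  set w : ℝ≥0 := v * (1 + q).toNNReal with hw
  have hw' : (w : ℝ) = v * (1 + q) := by simp [hw, Real.coe_toNNReal _ hq'.le]
  have hw0 : w ≠ 0 := by
    have : (w : ℝ) ≠ 0 := by rw [hw']; positivity
    exact_mod_cast this
  rw [gaussianReal_of_var_ne_zero 0 hv, lintegral_withDensity_eq_lintegral_mul _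
    (measurable_gaussianPDF _ _) (by fun_prop)]
  have h : ∀ η : ℝ, (gaussianPDF 0 v * fun η => ENNReal.ofReal
      (Real.exp ((2 * η * s + η ^ 2 * q) / (2 * v * (1 + q))))) η =
      ENNReal.ofReal (√(1 + q) * Real.exp (s ^ 2 / (2 * v * (1 + q)))) * gaussianPDF s w η := by
    intro η
    simp only [Pi.mul_apply, gaussianPDF, gaussianPDFReal]
    rw [← ENNReal.ofReal_mul (by positivity), ← ENNReal.ofReal_mul (by positivity), hw']
    congr 1
    have e1 : √(2 * Real.pi * (v * (1 + q))) = √(2 * Real.pi * v) * √(1 + q) := by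
      rw [← mul_assoc, Real.sqrt_mul (by positivity)]
    have e2 : Real.exp (-(η - 0) ^ 2 / (2 * v)) *
        Real.exp ((2 * η * s + η ^ 2 * q) / (2 * v * (1 + q))) =
        Real.exp (s ^ 2 / (2 * v * (1 + q))) * Real.exp (-(η - s) ^ 2 / (2 * (v * (1 + q)))) := by
      rw [← Real.exp_add, ← Real.exp_add]
      congr 1
      field_simp
      ring
    have e3 : √(1 + q) ≠ 0 := by positivity
    rw [mul_assoc, e2, e1]
    field_simp
  rw [lintegral_congr h, lintegral_const_mul _ (measurable_gaussianPDF _ _),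
    lintegral_gaussianPDF_eq_one _ hw0, mul_one]

end Gaussian

/-! ### Trajectories and the simulation lemma -/

section Path

variable {d : ℕ}

/-- The states visited from `x` under the dynamics `y ↦ mean h y + ε h`. -/
noncomputable def path {n : ℕ} (mean : Fin n → State d → State d) (x : State d)
    (ε : Fin n → State d) : Fin (n + 1) → State d :=
  Fin.induction (motive := fun _ => State d) x (fun h y => mean h y + ε h)

@[simp]
theorem path_zero {n : ℕ} (mean : Fin n → State d → State d) (x : State d) (ε : Fin n → State d) :
    path mean x ε 0 = x := rfl

theorem path_succ {n : ℕ} (mean : Fin n → State d → State d) (x : State d) (ε : Fin n → State d)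
    (h : Fin n) : path mean x ε h.succ = mean h (path mean x ε h.castSucc) + ε h := by
  simp [path, Fin.induction_succ]

/-- A path is defined by adding steps at its end, while the inductions below remove its first step.
-/
theorem path_succ_eq_tail {n : ℕ} (mean : Fin (n + 1) → State d → State d) (x : State d)
    (ε : Fin (n + 1) → State d) (i : Fin (n + 1)) : path mean x ε i.succ =
      path (fun h : Fin n => mean h.succ) (mean 0 x + ε 0) (fun h => ε h.succ) i := by
  induction i using Fin.induction with
  | zero => rw [path_succ]; rfl
  | succ i ih => rw [path_succ, path_succ, ← ih]; rfl

theorem measurable_path {n : ℕ} {mean : Fin n → State d → State d}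
    (hmean : ∀ h, Measurable (mean h)) (i : Fin (n + 1)) :
    Measurable fun p : State d × (Fin n → State d) => path mean p.1 p.2 i := by
  induction i using Fin.induction with
  | zero => exact measurable_fst
  | succ i ih =>
    simp only [path_succ]
    exact ((hmean i).comp ih).add ((measurable_pi_apply i).comp measurable_snd)

theorem lintegral_pi_succ {X : Type*} [MeasurableSpace X] {n : ℕ} (μ : Measure X) [SigmaFinite μ]
    {F : (Fin (n + 1) → X) → ℝ≥0∞} (hF : Measurable F) :
    ∫⁻ ε, F ε ∂Measure.pi (fun _ => μ) =
      ∫⁻ e, ∫⁻ ε, F (Fin.cons e ε) ∂Measure.pi (fun _ => μ) ∂μ := by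
  have h := (measurePreserving_piFinSuccAbove (fun _ : Fin (n + 1) => μ) 0).symm
  rw [← h.lintegral_comp hF]
  refine (lintegral_prod (μ := μ) (ν := Measure.pi fun _ => μ)
    (fun p => F ((MeasurableEquiv.piFinSuccAbove (fun _ => X) 0).symm p))
    (hF.comp h.measurable).aemeasurable).trans ?_
  refine lintegral_congr fun e => lintegral_congr fun ε => ?_
  change F ((0 : Fin (n + 1)).insertNth e ε) = _
  rw [Fin.insertNth_zero']

theorem sqrt_mul_sqrt_add_le (a b c e : ℝ≥0∞) :
    a ^ (1 / 2 : ℝ) * b ^ (1 / 2 : ℝ) + c ^ (1 / 2 : ℝ) * e ^ (1 / 2 : ℝ) ≤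
      (a + c) ^ (1 / 2 : ℝ) * (b + e) ^ (1 / 2 : ℝ) := by
  have h := ENNReal.inner_le_Lp_mul_Lq Finset.univ ![a ^ (1 / 2 : ℝ), c ^ (1 / 2 : ℝ)]
    ![b ^ (1 / 2 : ℝ), e ^ (1 / 2 : ℝ)] Real.HolderConjugate.two_two
  have hs : ∀ x : ℝ≥0∞, (x ^ (1 / 2 : ℝ)) ^ (2 : ℝ) = x := fun x => by
    rw [← ENNReal.rpow_mul]; simp
  simpa only [Fin.sum_univ_two, Matrix.cons_val_zero, Matrix.cons_val_one, hs] using h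

theorem lintegral_sqrt_mul_sqrt_le {α : Type*} [MeasurableSpace α] {μ : Measure α}
    {f g : α → ℝ≥0∞} (hf : AEMeasurable f μ) (hg : AEMeasurable g μ) :
    ∫⁻ a, f a ^ (1 / 2 : ℝ) * g a ^ (1 / 2 : ℝ) ∂μ ≤
      (∫⁻ a, f a ∂μ) ^ (1 / 2 : ℝ) * (∫⁻ a, g a ∂μ) ^ (1 / 2 : ℝ) :=
  ENNReal.lintegral_mul_norm_pow_le hf hg (by norm_num) (by norm_num) (by norm_num)

theorem sq_lintegral_le {α : Type*} [MeasurableSpace α] {μ : Measure α} [IsProbabilityMeasure μ]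
    {f : α → ℝ≥0∞} (hf : AEMeasurable f μ) : (∫⁻ a, f a ∂μ) ^ 2 ≤ ∫⁻ a, f a ^ 2 ∂μ := by
  have h := lintegral_mul_le_sqrt_mul_sqrt hf (aemeasurable_const (b := (1 : ℝ≥0∞)))
  simp only [mul_one, one_pow, lintegral_const, measure_univ, ENNReal.one_rpow] at h
  have h2 := pow_le_pow_left₀ (zero_le) h 2
  rwa [← ENNReal.rpow_natCast (_ ^ (1 / 2 : ℝ)), ← ENNReal.rpow_mul,
    show (1 / 2 : ℝ) * ((2 : ℕ) : ℝ) = 1 by norm_num, ENNReal.rpow_one] at h2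

/-- Simulation lemma: comparison of the expected cumulative costs under two dynamics. -/
theorem lintegral_cost_path_le {σ : ℝ} (hσ : 0 < σ) {n : ℕ} {mean mean' : Fin n → State d → State d}
    (hmean : ∀ h, Measurable (mean h)) (hmean' : ∀ h, Measurable (mean' h))
    {c : Fin n → State d → ℝ≥0∞} (hc : ∀ h, Measurable (c h)) (a : ℝ≥0∞) (x : State d) :
    ∫⁻ ε, (a + ∑ h, c h (path mean x ε h.castSucc)) ∂Measure.pi (fun _ => stepNoise d σ) ≤
      ∫⁻ ε, (a + ∑ h, c h (path mean' x ε h.castSucc)) ∂Measure.pi (fun _ => stepNoise d σ) +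
      (n * ∫⁻ ε, (a + ∑ h, c h (path mean x ε h.castSucc)) ^ 2
        ∂Measure.pi (fun _ => stepNoise d σ)) ^ (1 / 2 : ℝ) *
      (∫⁻ ε, ∑ h, ENNReal.ofReal (min 1 (‖mean h (path mean x ε h.castSucc) -
        mean' h (path mean x ε h.castSucc)‖ ^ 2 / σ ^ 2))
        ∂Measure.pi (fun _ => stepNoise d σ)) ^ (1 / 2 : ℝ) := by
  -- `a` carries the cost already paid, so that the second moment in the induction hypothesis is
  -- that of the total cost.
  induction n generalizing a x with
  | zero => simp
  | succ n ih =>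
    have hcost : ∀ {n : ℕ} {mean : Fin n → State d → State d}, (∀ h, Measurable (mean h)) →
        ∀ {c : Fin n → State d → ℝ≥0∞}, (∀ h, Measurable (c h)) → ∀ a : ℝ≥0∞,
        Measurable fun p : State d × (Fin n → State d) =>
          a + ∑ h, c h (path mean p.1 p.2 h.castSucc) := fun hmean c hc a =>
      measurable_const.add (Finset.measurable_sum _ fun h _ =>
        (hc h).comp (measurable_path hmean h.castSucc))
    have hrw : ∀ {mean : Fin (n + 1) → State d → State d} (a : ℝ≥0∞)
        {c : Fin (n + 1) → State d → ℝ≥0∞} (e : State d) (ε : Fin n → State d),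
        a + ∑ h, c h (path mean x (Fin.cons e ε : Fin (n + 1) → State d) h.castSucc) =
        (a + c 0 x) + ∑ h : Fin n, c h.succ
          (path (fun h : Fin n => mean h.succ) (mean 0 x + e) ε h.castSucc) := by
      intro mean a c e ε
      rw [Fin.sum_univ_succ, add_assoc]
      simp only [← Fin.succ_castSucc, path_succ_eq_tail]
      rfl
    set b := mean 0 x with hb
    set b' := mean' 0 x with hb'
    set tm : Fin n → State d → State d := fun h => mean h.succ with htm
    set tm' : Fin n → State d → State d := fun h => mean' h.succ with htm'
    set tc : Fin n → State d → ℝ≥0∞ := fun h => c h.succ with htc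
    have htmm : ∀ h, Measurable (tm h) := fun h => hmean _
    have htmm' : ∀ h, Measurable (tm' h) := fun h => hmean' _
    have htcm : ∀ h, Measurable (tc h) := fun h => hc _
    let δ : Fin (n + 1) → State d → ℝ≥0∞ := fun h y =>
      ENNReal.ofReal (min 1 (‖mean h y - mean' h y‖ ^ 2 / σ ^ 2))
    have hδ : ∀ h, Measurable (δ h) := fun h =>
      (measurable_const.min ((((hmean h).sub (hmean' h)).norm.pow_const 2).div_const _)).ennreal_ofReal
    -- For the state `y` after the first step: `v` and `w` are the expected total costs when
    -- continuing with `mean` and with `mean'`, `S` is the second moment going with `v`, and `D` is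
    -- the remaining discrepancy of the two models.
    let v : State d → ℝ≥0∞ := fun y => ∫⁻ ε, (a + c 0 x + ∑ h, tc h (path tm y ε h.castSucc))
      ∂Measure.pi (fun _ => stepNoise d σ)
    let w : State d → ℝ≥0∞ := fun y => ∫⁻ ε, (a + c 0 x + ∑ h, tc h (path tm' y ε h.castSucc))
      ∂Measure.pi (fun _ => stepNoise d σ)
    let S : State d → ℝ≥0∞ := fun y =>
      ∫⁻ ε, (a + c 0 x + ∑ h, tc h (path tm y ε h.castSucc)) ^ 2
      ∂Measure.pi (fun _ => stepNoise d σ)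
    let D : State d → ℝ≥0∞ := fun y => ∫⁻ ε, (∑ h : Fin n, δ h.succ (path tm y ε h.castSucc))
      ∂Measure.pi (fun _ => stepNoise d σ)
    have hv : Measurable v := (hcost htmm htcm _).lintegral_prod_right'
    have hw : Measurable w := (hcost htmm' htcm _).lintegral_prod_right'
    have hS : Measurable S := ((hcost htmm htcm _).pow_const 2).lintegral_prod_right'
    have hD : Measurable D := by
      have h := hcost htmm (fun h : Fin n => hδ h.succ) 0
      simp only [zero_add] at h
      exact h.lintegral_prod_right'
    have hx : Measurable fun ε : Fin (n + 1) → State d => (x, ε) := measurable_prodMk_left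
    have e1 : ∫⁻ ε, (a + ∑ h, c h (path mean x ε h.castSucc))
        ∂Measure.pi (fun _ => stepNoise d σ) = ∫⁻ e, v (b + e) ∂stepNoise d σ := by
      refine (lintegral_pi_succ _ ((hcost hmean hc a).comp hx)).trans ?_
      simp only [Function.comp_def, hrw]
      rfl
    have e2 : ∫⁻ ε, (a + ∑ h, c h (path mean' x ε h.castSucc))
        ∂Measure.pi (fun _ => stepNoise d σ) = ∫⁻ e, w (b' + e) ∂stepNoise d σ := by
      refine (lintegral_pi_succ _ ((hcost hmean' hc a).comp hx)).trans ?_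
      simp only [Function.comp_def, hrw]
      rfl
    have e3 : ∫⁻ ε, (a + ∑ h, c h (path mean x ε h.castSucc)) ^ 2
        ∂Measure.pi (fun _ => stepNoise d σ) = ∫⁻ e, S (b + e) ∂stepNoise d σ := by
      refine (lintegral_pi_succ _ (((hcost hmean hc a).pow_const 2).comp hx)).trans ?_
      simp only [Function.comp_def, hrw]
      rfl
    have e4 : ∫⁻ ε, ∑ h, ENNReal.ofReal (min 1 (‖mean h (path mean x ε h.castSucc) -
        mean' h (path mean x ε h.castSucc)‖ ^ 2 / σ ^ 2))
        ∂Measure.pi (fun _ => stepNoise d σ) = δ 0 x + ∫⁻ e, D (b + e) ∂stepNoise d σ := by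
      change ∫⁻ ε, ∑ h, δ h (path mean x ε h.castSucc) ∂Measure.pi (fun _ => stepNoise d σ) = _
      have h := hcost hmean hδ 0
      have h0 := fun (e : State d) (ε : Fin n → State d) => hrw (mean := mean) 0 (c := δ) e ε
      simp only [zero_add] at h h0
      refine (lintegral_pi_succ _ (h.comp hx)).trans ?_
      simp only [Function.comp_def, h0]
      have h1 : ∀ e : State d, ∫⁻ ε, (δ 0 x + ∑ h : Fin n, δ h.succ (path tm (b + e) ε h.castSucc))
          ∂Measure.pi (fun _ => stepNoise d σ) = δ 0 x + D (b + e) := fun e => by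
        rw [lintegral_add_left measurable_const]
        simp [D]
      refine (lintegral_congr h1).trans ?_
      rw [lintegral_add_left measurable_const]
      simp
    have hih : ∀ y, v y ≤ w y + (n * S y) ^ (1 / 2 : ℝ) * D y ^ (1 / 2 : ℝ) := fun y =>
      ih htmm htmm' htcm (a + c 0 x) y
    have hvS : ∀ y, v y ^ 2 ≤ S y := fun y =>
      sq_lintegral_le ((hcost htmm htcm _).comp measurable_prodMk_left).aemeasurable
    have hbm : Measurable fun e => b + e := measurable_const_add b
    rw [e1, e2, e3, e4]
    -- The change of mean from `b` to `b'` is applied to `min v w`. It is at most `w`, as the target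
    -- requires, and its square is at most `v² ≤ S`, so no second moment under the second model
    -- appears.
    calc ∫⁻ e, v (b + e) ∂stepNoise d σ
        ≤ ∫⁻ e, (min (v (b + e)) (w (b + e)) +
            (n * S (b + e)) ^ (1 / 2 : ℝ) * D (b + e) ^ (1 / 2 : ℝ)) ∂stepNoise d σ := by
          refine lintegral_mono fun e => ?_
          rw [min_add]
          exact le_min le_self_add (hih _)
      _ = ∫⁻ e, min (v (b + e)) (w (b + e)) ∂stepNoise d σ +
            ∫⁻ e, (n * S (b + e)) ^ (1 / 2 : ℝ) * D (b + e) ^ (1 / 2 : ℝ) ∂stepNoise d σ :=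
          lintegral_add_left ((hv.min hw).comp hbm) _
      _ ≤ (∫⁻ e, w (b' + e) ∂stepNoise d σ +
            (∫⁻ e, S (b + e) ∂stepNoise d σ) ^ (1 / 2 : ℝ) * δ 0 x ^ (1 / 2 : ℝ)) +
            (n * ∫⁻ e, S (b + e) ∂stepNoise d σ) ^ (1 / 2 : ℝ) *
              (∫⁻ e, D (b + e) ∂stepNoise d σ) ^ (1 / 2 : ℝ) := by
          refine add_le_add ?_ ?_
          · refine (lintegral_stepNoise_le d hσ b b' (hv.min hw)).trans ?_
            refine add_le_add (lintegral_mono fun e => min_le_right _ _) ?_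
            gcongr with e
            exact (pow_le_pow_left₀ (zero_le) (min_le_left _ _) 2).trans (hvS _)
          · refine (lintegral_sqrt_mul_sqrt_le ((hS.comp hbm).const_mul _).aemeasurable
              (hD.comp hbm).aemeasurable).trans_eq ?_
            have h := lintegral_const_mul (μ := stepNoise d σ) (n : ℝ≥0∞) (hS.comp hbm)
            simp only [Function.comp_def] at h ⊢
            rw [h]
      _ ≤ _ := by
          rw [add_assoc]
          gcongr
          -- Cauchy–Schwarz in the plane merges the first step, with weight `S`, and the `n` later
          -- ones, with weight `n S`, into the factor `n + 1`.
          refine (sqrt_mul_sqrt_add_le _ _ _ _).trans_eq ?_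
          rw [Nat.cast_succ, add_mul, one_mul, add_comm (∫⁻ e, S (b + e) ∂stepNoise d σ)]

end Path

/-! ### The exponential supermartingale over one episode -/

section ExpMartingale

variable {d : ℕ} {E : Type*} [NormedAddCommGroup E] [InnerProductSpace ℝ E] [CompleteSpace E]

theorem continuous_add_sum_rankOne {κ : Type*} [Fintype κ] (A : E →L[ℝ] E) :
    Continuous fun g : κ → E => A + ∑ i, InnerProductSpace.rankOne ℝ (g i) (g i) := by
  refine continuous_const.add (continuous_finsetSum _ fun i _ => ?_)
  have h : Continuous fun x : E => InnerProductSpace.rankOne ℝ x x := by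
    simp only [InnerProductSpace.rankOne_def]
    fun_prop
  exact h.comp (continuous_apply i)

theorem PosDefOp.continuous_relDet {κ : Type*} [Fintype κ] [DecidableEq κ] (A : E →L[ℝ] E) :
    Continuous fun g : κ → E => relDet A g := by
  unfold relDet
  refine Continuous.matrix_det ?_
  refine continuous_matrix fun i j => ?_
  simp only [Matrix.add_apply, Matrix.of_apply]
  fun_prop

/-- The part that depends on the fresh noise `η` is the exponent integrated in
`lintegral_exp_quadratic_gaussianReal`; the negative middle term is what that integral gives back.
-/
theorem PosDefOp.invQuad_rankOneUpdate_add_smul {A : E →L[ℝ] E} (hA : PosDefOp A) (φ S : E)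
    (η : ℝ) : invQuad (LC3.rankOneUpdate A φ) (S + η • φ) = invQuad A S -
      (inner ℝ (Ring.inverse A φ) S : ℝ) ^ 2 / (1 + invQuad A φ) +
      (2 * η * inner ℝ (Ring.inverse A φ) S + η ^ 2 * invQuad A φ) / (1 + invQuad A φ) := by
  have hq := hA.invQuad_nonneg φ
  rw [invQuad, hA.inner_inverse_rankOneUpdate]
  simp only [map_add, map_smul, inner_add_left, inner_add_right, inner_smul_left,
    inner_smul_right, conj_trivial, hA.inverse_symm S φ]
  simp only [invQuad] at hq ⊢
  have hne : (1 + inner ℝ (Ring.inverse A φ) φ : ℝ) ≠ 0 := by positivity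
  field_simp
  ring

variable [MeasurableSpace E] [BorelSpace E] [SecondCountableTopology E]

theorem measurable_invQuad_add_sum {κ : Type*} [Fintype κ] {A : E →L[ℝ] E} (hA : PosDefOp A) :
    Measurable fun p : (κ → E) × E =>
      invQuad (A + ∑ i, InnerProductSpace.rankOne ℝ (p.1 i) (p.1 i)) p.2 := by
  have h : Continuous fun p : (κ → E) × E =>
      invQuad (A + ∑ i, InnerProductSpace.rankOne ℝ (p.1 i) (p.1 i)) p.2 :=
    continuous_inner_inverse ((continuous_add_sum_rankOne A).comp continuous_fst)
      (fun p => hA.add_sum p.1) continuous_snd continuous_snd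
  exact h.measurable

theorem measurable_exp_invQuad {X κ : Type*} [MeasurableSpace X] [Fintype κ] [DecidableEq κ]
    {A : E →L[ℝ] E} (hA : PosDefOp A) (r : ℝ) {g : X → κ → E} {S : X → E}
    (hg : Measurable g) (hS : Measurable S) :
    Measurable fun a => ENNReal.ofReal (Real.exp (invQuad
      (A + ∑ i, InnerProductSpace.rankOne ℝ (g a i) (g a i)) (S a) / r) / √(relDet A (g a))) := by
  have h1 : Measurable fun a => invQuad
      (A + ∑ i, InnerProductSpace.rankOne ℝ (g a i) (g a i)) (S a) := by
    have h3 : Measurable fun a => (g a, S a) := hg.prodMk hS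
    have h4 := (measurable_invQuad_add_sum (κ := κ) hA).comp h3
    exact h4
  have h2 : Measurable fun a => relDet A (g a) :=
    (PosDefOp.continuous_relDet A).measurable.comp hg
  exact ((h1.div_const r).exp.div h2.sqrt).ennreal_ofReal

/-- The exponential supermartingale of the self-normalized process, over one episode. -/
theorem lintegral_exp_invQuad_le {σ : ℝ} (hσ : 0 < σ) {w : State d} (hw : ‖w‖ = 1) {n : ℕ}
    {mean : Fin n → State d → State d} (hmean : ∀ h, Measurable (mean h))
    {feat : Fin n → State d → E} (hfeat : ∀ h, Measurable (feat h)) {A : E →L[ℝ] E}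
    (hA : PosDefOp A) (S : E) (x : State d) :
    ∫⁻ ε, ENNReal.ofReal (Real.exp (invQuad
      (A + ∑ h, InnerProductSpace.rankOne ℝ (feat h (path mean x ε h.castSucc))
        (feat h (path mean x ε h.castSucc)))
      (S + ∑ h, (inner ℝ w (ε h) : ℝ) • feat h (path mean x ε h.castSucc)) / (2 * σ ^ 2)) /
      √(relDet A fun h => feat h (path mean x ε h.castSucc)))
      ∂Measure.pi (fun _ => stepNoise d σ) ≤
    ENNReal.ofReal (Real.exp (invQuad A S / (2 * σ ^ 2))) := by
  induction n generalizing A S x with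
  | zero => simp [relDet_of_isEmpty]
  | succ n ih =>
    set φ := feat 0 x with hφ
    have hq := hA.invQuad_nonneg φ
    have hfm : ∀ h : Fin (n + 1), Measurable fun ε : Fin (n + 1) → State d =>
        feat h (path mean x ε h.castSucc) := fun h =>
      (hfeat h).comp ((measurable_path hmean h.castSucc).comp measurable_prodMk_left)
    have hSm : Measurable fun ε : Fin (n + 1) → State d =>
        S + ∑ h, (inner ℝ w (ε h) : ℝ) • feat h (path mean x ε h.castSucc) := by
      refine measurable_const.add (Finset.measurable_sum _ fun h _ => Measurable.smul ?_ (hfm h))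
      exact measurable_const.inner (measurable_pi_apply h)
    rw [lintegral_pi_succ _ (measurable_exp_invQuad hA _ (measurable_pi_lambda _ hfm) hSm)]
    have hstep : ∀ e : State d, ∫⁻ ε, ENNReal.ofReal (Real.exp (invQuad
        (A + ∑ h, InnerProductSpace.rankOne ℝ
          (feat h (path mean x (Fin.cons e ε : Fin (n + 1) → State d) h.castSucc))
          (feat h (path mean x (Fin.cons e ε : Fin (n + 1) → State d) h.castSucc)))
        (S + ∑ h, (inner ℝ w ((Fin.cons e ε : Fin (n + 1) → State d) h) : ℝ) •
          feat h (path mean x (Fin.cons e ε : Fin (n + 1) → State d) h.castSucc)) / (2 * σ ^ 2)) /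
        √(relDet A fun h => feat h (path mean x (Fin.cons e ε : Fin (n + 1) → State d) h.castSucc)))
        ∂Measure.pi (fun _ => stepNoise d σ) ≤
        ENNReal.ofReal ((√(1 + invQuad A φ))⁻¹) * ENNReal.ofReal (Real.exp (invQuad
          (LC3.rankOneUpdate A φ) (S + (inner ℝ w e : ℝ) • φ) / (2 * σ ^ 2))) := by
      intro e
      refine le_trans (le_of_eq ?_) (mul_le_mul_right (ih (fun h => hmean h.succ)
        (fun h => hfeat h.succ) (hA.rankOneUpdate φ) (S + (inner ℝ w e : ℝ) • φ)
        (mean 0 x + e)) _)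
      rw [← lintegral_const_mul' _ _ ENNReal.ofReal_ne_top]
      refine lintegral_congr fun ε => ?_
      rw [← ENNReal.ofReal_mul (by positivity), hA.relDet_cons, Fin.sum_univ_succ,
        Fin.sum_univ_succ, ← add_assoc, ← add_assoc]
      simp only [← Fin.succ_castSucc, path_succ_eq_tail, Fin.castSucc_zero, path_zero,
        Fin.cons_zero, Fin.cons_succ]
      rw [← hφ, Real.sqrt_mul (by positivity), rankOneUpdate]
      congr 1
      field_simp
    refine (lintegral_mono hstep).trans ?_
    set s : ℝ := inner ℝ (Ring.inverse A φ) S with hs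
    have hv : (σ ^ 2).toNNReal ≠ 0 := by simpa using hσ.ne'
    have hv' : ((σ ^ 2).toNNReal : ℝ) = σ ^ 2 := Real.coe_toNNReal _ (sq_nonneg σ)
    have hrw : ∀ e : State d, ENNReal.ofReal ((√(1 + invQuad A φ))⁻¹) *
        ENNReal.ofReal (Real.exp (invQuad
          (LC3.rankOneUpdate A φ) (S + (inner ℝ w e : ℝ) • φ) / (2 * σ ^ 2))) =
        ENNReal.ofReal ((√(1 + invQuad A φ))⁻¹ * Real.exp (invQuad A S / (2 * σ ^ 2)) *
          Real.exp (- (s ^ 2 / (2 * σ ^ 2 * (1 + invQuad A φ))))) *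
        ENNReal.ofReal (Real.exp ((2 * (inner ℝ w e : ℝ) * s + (inner ℝ w e : ℝ) ^ 2 *
          invQuad A φ) / (2 * (σ ^ 2).toNNReal * (1 + invQuad A φ)))) := by
      intro e
      rw [← ENNReal.ofReal_mul (by positivity), ← ENNReal.ofReal_mul (by positivity),
        mul_assoc, mul_assoc, ← Real.exp_add, ← Real.exp_add, hv',
        hA.invQuad_rankOneUpdate_add_smul]
      congr 3
      field_simp
      ring
    rw [lintegral_congr hrw, lintegral_const_mul' _ _ ENNReal.ofReal_ne_top]
    have hmap : ∫⁻ e, ENNReal.ofReal (Real.exp ((2 * (inner ℝ w e : ℝ) * s + (inner ℝ w e : ℝ) ^ 2 *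
          invQuad A φ) / (2 * (σ ^ 2).toNNReal * (1 + invQuad A φ)))) ∂stepNoise d σ =
        ∫⁻ η, ENNReal.ofReal (Real.exp ((2 * η * s + η ^ 2 *
          invQuad A φ) / (2 * (σ ^ 2).toNNReal * (1 + invQuad A φ))))
          ∂gaussianReal 0 (σ ^ 2).toNNReal := by
      have h := map_inner_stepNoise d σ w
      rw [hw, one_pow, mul_one] at h
      rw [← h, lintegral_map (by fun_prop) (by fun_prop)]
    -- The Gaussian integral cancels both the factor `1 / √(1 + q)` from the determinant and the
    -- loss `s² / (1 + q)` from the update, so this step is an equality.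
    rw [hmap, lintegral_exp_quadratic_gaussianReal hv hq, ← ENNReal.ofReal_mul (by positivity), hv']
    refine ENNReal.ofReal_le_ofReal (le_of_eq ?_)
    rw [Real.exp_neg]
    have : √(1 + invQuad A φ) ≠ 0 := by positivity
    field_simp

end ExpMartingale

/-! ### Conditioning on the first episodes -/

section Noise

instance isProbabilityMeasure_episodeNoise (d H : ℕ) (σ : ℝ) :
    IsProbabilityMeasure (episodeNoise d H σ) := by
  unfold episodeNoise; infer_instance

instance isProbabilityMeasure_noise (d H : ℕ) (σ : ℝ) : IsProbabilityMeasure (noise d H σ) := by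
  unfold noise; infer_instance

/-- The sequence which agrees with `ε` before `s` and continues with `ε'`. -/
def splice {X : Type*} (s : ℕ) (ε ε' : ℕ → X) : ℕ → X := fun i => if i < s then ε i else ε' (i - s)

theorem splice_of_lt {X : Type*} {s i : ℕ} (h : i < s) (ε ε' : ℕ → X) : splice s ε ε' i = ε i :=
  if_pos h

@[simp]
theorem splice_add {X : Type*} (s i : ℕ) (ε ε' : ℕ → X) : splice s ε ε' (s + i) = ε' i := by
  simp [splice]

@[simp]
theorem splice_self {X : Type*} (s : ℕ) (ε ε' : ℕ → X) : splice s ε ε' s = ε' 0 :=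
  splice_add s 0 ε ε'

theorem measurable_splice {X : Type*} [MeasurableSpace X] (s : ℕ) :
    Measurable fun p : (ℕ → X) × (ℕ → X) => splice s p.1 p.2 := by
  refine measurable_pi_lambda _ fun i => ?_
  by_cases h : i < s
  · simp only [splice, h, if_true]; fun_prop
  · simp only [splice, h, if_false]; fun_prop

/-- The first `s` terms are independent of the others, and the shifted sequence has the law of the
whole one. Integrating over the second sequence thus plays the role of the conditional expectation
given the first `s` episodes. -/
theorem map_splice {X : Type*} [MeasurableSpace X] (μ : Measure X) [IsProbabilityMeasure μ]
    (s : ℕ) : ((Measure.infinitePi fun _ : ℕ => μ).prod (Measure.infinitePi fun _ : ℕ => μ)).map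
      (fun p => splice s p.1 p.2) = Measure.infinitePi fun _ : ℕ => μ := by
  refine Measure.eq_infinitePi _ fun S t ht => ?_
  have hbox : ∀ (S : Finset ℕ) (t : ℕ → Set X), (∀ i, MeasurableSet (t i)) →
      MeasurableSet (Set.pi S t) := fun S t ht =>
    MeasurableSet.pi S.countable_toSet fun i _ => ht i
  have hpre : (fun p : (ℕ → X) × (ℕ → X) => splice s p.1 p.2) ⁻¹' (Set.pi S t) =
      (Set.pi (S.filter (· < s)) t) ×ˢ
        (Set.pi ((S.filter (¬ · < s)).image (· - s)) fun i => t (s + i)) := by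
    ext ⟨a, b⟩
    simp only [Set.mem_preimage, Set.mem_pi, Finset.mem_coe, Set.mem_prod, Finset.mem_filter,
      Finset.mem_image, splice]
    constructor
    · refine fun h => ⟨fun i hi => ?_, ?_⟩
      · simpa [hi.2] using h i hi.1
      · rintro _ ⟨i, ⟨hi, his⟩, rfl⟩
        have := h i hi
        rw [if_neg his] at this
        rwa [Nat.add_sub_cancel' (not_lt.mp his)]
    · rintro ⟨h1, h2⟩ i hi
      split_ifs with his
      · exact h1 i ⟨hi, his⟩
      · have := h2 (i - s) ⟨i, ⟨hi, his⟩, rfl⟩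
        rwa [Nat.add_sub_cancel' (not_lt.mp his)] at this
  rw [Measure.map_apply (measurable_splice s) (hbox S t ht), hpre, Measure.prod_prod,
    Measure.infinitePi_pi _ (fun i _ => ht i), Measure.infinitePi_pi _ (fun i _ => ht _),
    Finset.prod_image, ← Finset.prod_filter_mul_prod_filter_not S (· < s)]
  · congr 1
    refine Finset.prod_congr rfl fun i hi => ?_
    rw [Nat.add_sub_cancel' (not_lt.mp (Finset.mem_filter.mp hi).2)]
  · intro i hi j hj hij
    have h1 := not_lt.mp (Finset.mem_filter.mp hi).2
    have h2 := not_lt.mp (Finset.mem_filter.mp hj).2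
    simp only at hij
    omega

theorem lintegral_noise_splice {d H : ℕ} {σ : ℝ} (s : ℕ) {F : (ℕ → Fin H → State d) → ℝ≥0∞}
    (hF : Measurable F) : ∫⁻ ε, F ε ∂noise d H σ =
      ∫⁻ ε, ∫⁻ ε', F (splice s ε ε') ∂noise d H σ ∂noise d H σ := by
  conv_lhs => rw [noise, ← map_splice (episodeNoise d H σ) s]
  rw [lintegral_map hF (measurable_splice s)]
  exact lintegral_prod _ (hF.comp (measurable_splice s)).aemeasurable

theorem lintegral_noise_zero {d H : ℕ} {σ : ℝ} {F : (Fin H → State d) → ℝ≥0∞}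
    (hF : Measurable F) : ∫⁻ ε, F (ε 0) ∂noise d H σ = ∫⁻ e, F e ∂episodeNoise d H σ :=
  (measurePreserving_eval_infinitePi (fun _ : ℕ => episodeNoise d H σ) 0).lintegral_comp hF

end Noise

/-! ### Histories, restarted algorithms and measurability -/

namespace KNR

variable {d H : ℕ} {U : Type u} {E : Type v} [NormedAddCommGroup E] [InnerProductSpace ℝ E]
variable (M : KNR d H U E)

theorem traj_eq_path (W : E →L[ℝ] State d) (π : State d → Fin H → U) (ε : Fin H → State d) :
    M.traj W π ε = path (fun h x => W (M.φ x (π x h))) M.x₀ ε := rfl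

theorem history_apply (A : Algorithm d H U) (ε : ℕ → Fin H → State d) {t : ℕ} (i : Fin t) :
    M.history A ε t i = M.traj M.Wstar (A i (M.history A ε i)) (ε i) := by
  induction t with
  | zero => exact i.elim0
  | succ t ih =>
    induction i using Fin.lastCases with
    | last => simp [history]
    | cast i => simpa [history] using ih i

theorem history_congr (A : Algorithm d H U) {ε ε' : ℕ → Fin H → State d} {t : ℕ}
    (h : ∀ i < t, ε i = ε' i) : M.history A ε t = M.history A ε' t := by
  induction t with
  | zero => rfl
  | succ t ih =>
    rw [history, history, ih fun i hi => h i (by omega), h t (by omega)]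

theorem history_splice_self (A : Algorithm d H U) (s : ℕ) (ε ε' : ℕ → Fin H → State d) :
    M.history A (splice s ε ε') s = M.history A ε s :=
  M.history_congr A fun _ hi => splice_of_lt hi ε ε'

/-- The features visited in episode `t` after the history `hist`, as a function of the noise. -/
noncomputable def episodeFeatures (A : Algorithm d H U) {t : ℕ} (hist : History d H t)
    (e : Fin H → State d) (h : Fin H) : E :=
  M.φ (M.traj M.Wstar (A t hist) e h.castSucc) (A t hist (M.traj M.Wstar (A t hist) e h.castSucc) h)

theorem features_history (A : Algorithm d H U) (ε : ℕ → Fin H → State d) {t : ℕ}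
    (i : Fin t × Fin H) : M.features A (M.history A ε t) i =
      M.episodeFeatures A (M.history A ε i.1) (ε i.1) i.2 := by
  have h : (fun r => M.history A ε t (Fin.castLE i.1.isLt.le r)) = M.history A ε i.1 := by
    ext1 r
    rw [history_apply, history_apply]
    rfl
  rw [features, Algorithm.pastPolicy, h, history_apply, episodeFeatures]

theorem nextStates_history_sub (A : Algorithm d H U) (ε : ℕ → Fin H → State d) {t : ℕ}
    (i : Fin t × Fin H) : nextStates (M.history A ε t) i -
      M.Wstar (M.features A (M.history A ε t) i) = ε i.1 i.2 := by
  rw [features_history, nextStates, history_apply, traj_eq_path, path_succ, ← traj_eq_path,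
    episodeFeatures]
  abel

/-- Splitting off the last episode. -/
def episodeEquiv (t H : ℕ) : (Fin t × Fin H) ⊕ Fin H ≃ Fin (t + 1) × Fin H where
  toFun := Sum.elim (fun i => (i.1.castSucc, i.2)) (fun h => (Fin.last t, h))
  invFun p := Fin.lastCases (motive := fun _ => (Fin t × Fin H) ⊕ Fin H) (Sum.inr p.2)
    (fun i => Sum.inl (i, p.2)) p.1
  left_inv := by rintro (⟨i, h⟩ | h) <;> simp
  right_inv := by
    rintro ⟨i, h⟩
    induction i using Fin.lastCases <;> simp

theorem features_history_comp_episodeEquiv (A : Algorithm d H U) (ε : ℕ → Fin H → State d) (t : ℕ) :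
    M.features A (M.history A ε (t + 1)) ∘ episodeEquiv t H =
      Sum.elim (M.features A (M.history A ε t))
        (M.episodeFeatures A (M.history A ε t) (ε t)) := by
  ext i
  rcases i with i | h
  · simp [episodeEquiv, features_history]
  · simp [episodeEquiv, features_history]

theorem cov_features_history_succ (lam : ℝ) (A : Algorithm d H U) (ε : ℕ → Fin H → State d)
    (t : ℕ) : cov lam (M.features A (M.history A ε (t + 1))) =
      cov lam (M.features A (M.history A ε t)) + ∑ h, InnerProductSpace.rankOne ℝ
        (M.episodeFeatures A (M.history A ε t) (ε t) h)
        (M.episodeFeatures A (M.history A ε t) (ε t) h) := by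
  rw [← cov_comp_equiv (episodeEquiv t H), features_history_comp_episodeEquiv, cov_sumElim]

/-- The algorithm `A` run after the history `h₀` of the first `s` episodes. -/
def _root_.LC3.Algorithm.restart (A : Algorithm d H U) {s : ℕ} (h₀ : History d H s) :
    Algorithm d H U := fun t hist => A (s + t) (Fin.append h₀ hist)

theorem history_splice_add (A : Algorithm d H U) (s : ℕ) (ε ε' : ℕ → Fin H → State d) (t : ℕ) :
    M.history A (splice s ε ε') (s + t) = Fin.append (M.history A ε s)
      (M.history (A.restart (M.history A ε s)) ε' t) := by
  induction t with
  | zero =>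
    rw [Fin.append_right_nil _ _ rfl]
    exact M.history_splice_self A s ε ε'
  | succ t ih =>
    change M.history A (splice s ε ε') (s + t + 1) = _
    rw [history, ih, history, Fin.append_snoc, splice_add]
    rfl

theorem episodeFeatures_restart (A : Algorithm d H U) (s : ℕ) (ε ε' : ℕ → Fin H → State d) (t : ℕ) :
    M.episodeFeatures A (M.history A (splice s ε ε') (s + t)) (splice s ε ε' (s + t)) =
      M.episodeFeatures (A.restart (M.history A ε s))
        (M.history (A.restart (M.history A ε s)) ε' t) (ε' t) := by
  rw [splice_add, history_splice_add]
  rfl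

section Measurability

variable [MeasurableSpace E] {M} {A : Algorithm d H U}

/-- The supremum defining `infoGain` therefore covers the continuation of a run after any fixed
past. -/
theorem Admissible.restart (hA : M.Admissible A) {s : ℕ} (h₀ : History d H s) :
    M.Admissible (A.restart h₀) := by
  refine fun t => ⟨fun hist => (hA _).1 _, fun h => ?_⟩
  have happ : Measurable fun hist : History d H t => Fin.append h₀ hist := by
    refine measurable_pi_lambda _ fun i => ?_
    induction i using Fin.addCases with
    | left i => simp only [Fin.append_left]; exact measurable_const
    | right i => simp only [Fin.append_right]; exact measurable_pi_apply i
  exact ((hA (s + t)).2 h).comp ((happ.comp measurable_fst).prodMk measurable_snd)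

variable [BorelSpace E] [SecondCountableTopology E]

theorem Admissible.measurable_traj (hA : M.Admissible A) (t : ℕ) (i : Fin (H + 1)) :
    Measurable fun p : History d H t × (Fin H → State d) => M.traj M.Wstar (A t p.1) p.2 i := by
  simp only [traj_eq_path]
  induction i using Fin.induction with
  | zero => exact measurable_const
  | succ i ih =>
    simp only [path_succ]
    refine Measurable.add ?_ ((measurable_pi_apply i).comp measurable_snd)
    exact M.Wstar.continuous.measurable.comp (((hA t).2 i).comp (measurable_fst.prodMk ih))

theorem Admissible.measurable_episodeFeatures (hA : M.Admissible A) (t : ℕ) (h : Fin H) :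
    Measurable fun p : History d H t × (Fin H → State d) => M.episodeFeatures A p.1 p.2 h :=
  ((hA t).2 h).comp (measurable_fst.prodMk (hA.measurable_traj t h.castSucc))

theorem Admissible.measurable_history (hA : M.Admissible A) (t : ℕ) :
    Measurable fun ε => M.history A ε t := by
  induction t with
  | zero => exact measurable_const
  | succ t ih =>
    refine measurable_pi_lambda _ fun i => ?_
    induction i using Fin.lastCases with
    | last =>
      simp only [history, Fin.snoc_last]
      exact measurable_pi_lambda _ fun j =>
        (hA.measurable_traj t j).comp (ih.prodMk (measurable_pi_apply t))
    | cast i =>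
      simp only [history, Fin.snoc_castSucc]
      exact (measurable_pi_apply i).comp ih

theorem Admissible.measurable_features_history (hA : M.Admissible A) (t : ℕ) :
    Measurable fun ε => M.features A (M.history A ε t) := by
  refine measurable_pi_lambda _ fun i => ?_
  simp only [features_history]
  exact (hA.measurable_episodeFeatures i.1 i.2).comp
    ((hA.measurable_history i.1).prodMk (measurable_pi_apply (i.1 : ℕ)))

theorem Admissible.measurable_episodeFeatures_history (hA : M.Admissible A) (t : ℕ) (h : Fin H) :
    Measurable fun ε : ℕ → Fin H → State d => M.episodeFeatures A (M.history A ε t) (ε t) h :=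
  (hA.measurable_episodeFeatures t h).comp
    ((hA.measurable_history t).prodMk (measurable_pi_apply t))

end Measurability

end KNR

/-! ### Regularized least squares -/

section Regression

variable {d : ℕ} {E : Type*} [NormedAddCommGroup E] [InnerProductSpace ℝ E] [CompleteSpace E]
variable {ι : Type*} [Fintype ι]

open ContinuousLinearMap (adjoint)

/-- The minimizer of the regularized least squares objective. -/
noncomputable def ridgeMin (lam : ℝ) (f : ι → E) (y : ι → State d) : E →L[ℝ] State d :=
  (∑ i, InnerProductSpace.rankOne ℝ (y i) (f i)) ∘L Ring.inverse (cov lam f)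

theorem cov_apply (lam : ℝ) (f : ι → E) (x : E) :
    cov lam f x = lam • x + ∑ i, (inner ℝ (f i) x : ℝ) • f i := by
  simp [cov]

theorem adjoint_ridgeMin {lam : ℝ} (hlam : 0 < lam) (f : ι → E) (y : ι → State d) (v : State d) :
    adjoint (ridgeMin lam f y) v = Ring.inverse (cov lam f) (∑ i, (inner ℝ v (y i) : ℝ) • f i) := by
  refine ext_inner_right ℝ fun z => ?_
  rw [ContinuousLinearMap.adjoint_inner_left, (posDefOp_cov hlam f).inverse_symm]
  simp [ridgeMin, inner_sum, inner_smul_right, real_inner_comm, mul_comm]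

/-- For `W` the true model this splits the estimation error in direction `v` into the regularization
bias and the noise weighted with the features. -/
theorem adjoint_sub_ridgeMin {lam : ℝ} (hlam : 0 < lam) (f : ι → E) (y : ι → State d)
    (W : E →L[ℝ] State d) (v : State d) : adjoint (W - ridgeMin lam f y) v =
      Ring.inverse (cov lam f) (lam • adjoint W v - ∑ i, (inner ℝ v (y i - W (f i)) : ℝ) • f i) := by
  have h : adjoint W v = Ring.inverse (cov lam f) (cov lam f (adjoint W v)) :=
    ((posDefOp_cov hlam f).inverse_apply _).symm
  rw [map_sub, sub_apply, adjoint_ridgeMin hlam, h, ← map_sub, ← h, cov_apply]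
  congr 1
  simp only [inner_sub_right, sub_smul, Finset.sum_sub_distrib,
    ContinuousLinearMap.adjoint_inner_right, real_inner_comm v]
  abel

theorem sum_inner_single_sq (x : State d) :
    ‖x‖ ^ 2 = ∑ j, (inner ℝ (EuclideanSpace.single j (1 : ℝ)) x : ℝ) ^ 2 := by
  simp [EuclideanSpace.real_norm_sq_eq, EuclideanSpace.inner_single_left]

theorem ridgeObjective_eq (lam : ℝ) (f : ι → E) (y : ι → State d) (W : E →L[ℝ] State d) :
    ridgeObjective lam f y W = ∑ j : Fin d,
      ((inner ℝ (cov lam f (adjoint W (EuclideanSpace.single j 1)))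
          (adjoint W (EuclideanSpace.single j 1)) : ℝ) -
        2 * inner ℝ (adjoint W (EuclideanSpace.single j 1))
          (∑ i, (inner ℝ (EuclideanSpace.single j (1 : ℝ)) (y i) : ℝ) • f i) +
        ∑ i, (inner ℝ (EuclideanSpace.single j (1 : ℝ)) (y i) : ℝ) ^ 2) := by
  simp only [ridgeObjective, frobSq, sum_inner_single_sq (W _ - y _), inner_sub_right]
  rw [Finset.sum_comm, Finset.mul_sum, ← Finset.sum_add_distrib]
  refine Finset.sum_congr rfl fun j _ => ?_
  set r := adjoint W (EuclideanSpace.single j 1) with hr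
  have h : ∀ i, (inner ℝ (EuclideanSpace.single j (1 : ℝ)) (W (f i)) : ℝ) = inner ℝ (f i) r :=
    fun i => by rw [hr, ContinuousLinearMap.adjoint_inner_right, real_inner_comm]
  simp only [h, cov_apply, inner_add_left, inner_smul_left, sum_inner, inner_sum, inner_smul_right,
    conj_trivial, real_inner_self_eq_norm_sq, Finset.mul_sum, sub_sq, Finset.sum_add_distrib,
    Finset.sum_sub_distrib]
  have h2 : ∀ i, (inner ℝ r (f i) : ℝ) = inner ℝ (f i) r := fun i => real_inner_comm _ _
  simp only [h2, sq]
  have h3 : ∀ i, 2 * (inner ℝ (f i) r : ℝ) * inner ℝ (EuclideanSpace.single j (1 : ℝ)) (y i) =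
    2 * (inner ℝ (EuclideanSpace.single j (1 : ℝ)) (y i) * inner ℝ (f i) r) := fun i => by ring
  simp only [h3]
  ring

/-- Completing the square in each row of `W`; existence and uniqueness of the minimizer both follow.
-/
theorem ridgeObjective_eq_add {lam : ℝ} (hlam : 0 < lam) (f : ι → E) (y : ι → State d)
    (W : E →L[ℝ] State d) : ridgeObjective lam f y W = ridgeObjective lam f y (ridgeMin lam f y) +
      ∑ j : Fin d, (inner ℝ (cov lam f (adjoint (W - ridgeMin lam f y)
        (EuclideanSpace.single j 1))) (adjoint (W - ridgeMin lam f y)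
        (EuclideanSpace.single j 1)) : ℝ) := by
  have hA := posDefOp_cov hlam f
  rw [ridgeObjective_eq, ridgeObjective_eq, ← Finset.sum_add_distrib]
  refine Finset.sum_congr rfl fun j _ => ?_
  rw [map_sub, sub_apply, adjoint_ridgeMin hlam]
  set s := ∑ i, (inner ℝ (EuclideanSpace.single j (1 : ℝ)) (y i) : ℝ) • f i
  set r := adjoint W (EuclideanSpace.single j 1)
  simp only [map_sub, inner_sub_left, inner_sub_right, hA.apply_inverse]
  have h1 : (inner ℝ s (Ring.inverse (cov lam f) s) : ℝ) = inner ℝ (Ring.inverse (cov lam f) s) s :=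
    real_inner_comm _ _
  have h2 : (inner ℝ s r : ℝ) = inner ℝ r s := real_inner_comm _ _
  rw [hA.symm r (Ring.inverse (cov lam f) s), hA.apply_inverse, h1, h2]
  ring

theorem ridgeMin_le {lam : ℝ} (hlam : 0 < lam) (f : ι → E) (y : ι → State d)
    (W : E →L[ℝ] State d) :
    ridgeObjective lam f y (ridgeMin lam f y) ≤ ridgeObjective lam f y W := by
  rw [ridgeObjective_eq_add hlam f y W]
  exact le_add_of_nonneg_right (Finset.sum_nonneg fun j _ => (posDefOp_cov hlam f).inner_nonneg _)

theorem eq_ridgeMin {lam : ℝ} (hlam : 0 < lam) (f : ι → E) (y : ι → State d)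
    {W : E →L[ℝ] State d} (hW : ∀ W', ridgeObjective lam f y W ≤ ridgeObjective lam f y W') :
    W = ridgeMin lam f y := by
  have hA := posDefOp_cov hlam f
  have h := hW (ridgeMin lam f y)
  rw [ridgeObjective_eq_add hlam f y W] at h
  have h0 := (Finset.sum_eq_zero_iff_of_nonneg fun j _ => hA.inner_nonneg _).mp
    (le_antisymm (by linarith) (Finset.sum_nonneg fun (j : Fin d) (_ : j ∈ Finset.univ) =>
      hA.inner_nonneg (adjoint (W - ridgeMin lam f y) (EuclideanSpace.single j 1))))
  obtain ⟨c, hc, hcoer⟩ := hA.coercive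
  rw [← sub_eq_zero]
  ext z j
  have hj : adjoint (W - ridgeMin lam f y) (EuclideanSpace.single j 1) = 0 := by
    have h1 := hcoer (adjoint (W - ridgeMin lam f y) (EuclideanSpace.single j 1))
    rw [h0 j (Finset.mem_univ j)] at h1
    have h2 : ‖adjoint (W - ridgeMin lam f y) (EuclideanSpace.single j 1)‖ ^ 2 = 0 :=
      le_antisymm (nonpos_of_mul_nonpos_right h1 hc) (sq_nonneg _)
    simpa using h2
  have h3 := ContinuousLinearMap.adjoint_inner_left (W - ridgeMin lam f y) z
    (EuclideanSpace.single j 1)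
  rw [hj, inner_zero_left, EuclideanSpace.inner_single_left] at h3
  simpa using h3.symm

end Regression

/-! ### Weighted spectral norms and a net of the sphere -/

section WeightedNorm

variable {d : ℕ} {E : Type*} [NormedAddCommGroup E] [InnerProductSpace ℝ E] [CompleteSpace E]
  {A : E →L[ℝ] E}

open ContinuousLinearMap (adjoint)

theorem weightedSpecNormSq_nonneg (D : E →L[ℝ] State d) (A : E →L[ℝ] E) :
    0 ≤ weightedSpecNormSq D A := norm_nonneg _

theorem inner_adjoint_le_weightedSpecNormSq (D : E →L[ℝ] State d) (A : E →L[ℝ] E) (v : State d) :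
    (inner ℝ (A (adjoint D v)) (adjoint D v) : ℝ) ≤ weightedSpecNormSq D A * ‖v‖ ^ 2 := by
  rw [ContinuousLinearMap.adjoint_inner_right]
  refine (real_inner_le_norm _ _).trans ?_
  have h := (D ∘L A ∘L adjoint D).le_opNorm v
  rw [weightedSpecNormSq, sq, ← mul_assoc]
  gcongr
  exact h

/-- Writing `‖D x‖² = ⟨Dᵀ D x, x⟩`, Cauchy–Schwarz for `A` and `A⁻¹` replaces the factorization of
`D x` through the square root of `A`. -/
theorem PosDefOp.norm_apply_sq_le (hA : PosDefOp A) (D : E →L[ℝ] State d) (x : E) :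
    ‖D x‖ ^ 2 ≤ weightedSpecNormSq D A * invQuad A x := by
  have h := hA.inner_sq_le (adjoint D (D x)) x
  rw [ContinuousLinearMap.adjoint_inner_left, real_inner_self_eq_norm_sq] at h
  have h2 := inner_adjoint_le_weightedSpecNormSq D A (D x)
  have h3 := hA.invQuad_nonneg x
  rcases (sq_nonneg ‖D x‖).eq_or_lt with h0 | h0
  · rw [← h0]
    exact mul_nonneg (weightedSpecNormSq_nonneg D A) h3
  · refine le_of_mul_le_mul_left ?_ h0
    nlinarith

theorem PosDefOp.weightedSpecNormSq_le (hA : PosDefOp A) (D : E →L[ℝ] State d) {c : ℝ}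
    (hc : ∀ v, ‖v‖ = 1 → (inner ℝ (A (adjoint D v)) (adjoint D v) : ℝ) ≤ c) (hc0 : 0 ≤ c) :
    weightedSpecNormSq D A ≤ c := by
  set B := D ∘L A ∘L adjoint D with hB
  have hBin : ∀ v w : State d, (inner ℝ (B v) w : ℝ) = inner ℝ (A (adjoint D v)) (adjoint D w) :=
    fun v w => by rw [ContinuousLinearMap.adjoint_inner_right]; rfl
  have hc' : ∀ v, (inner ℝ (B v) v : ℝ) ≤ c * ‖v‖ ^ 2 := by
    intro v
    by_cases hv : v = 0
    · simp [hv]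
    · have h := hc (‖v‖⁻¹ • v) (norm_smul_inv_norm hv)
      have hv' : ‖v‖ ≠ 0 := norm_ne_zero_iff.mpr hv
      rw [← hBin, map_smul, inner_smul_left, inner_smul_right, conj_trivial] at h
      have := mul_le_mul_of_nonneg_right h (sq_nonneg ‖v‖)
      field_simp at this
      linarith
  have hcs : ∀ v w, (inner ℝ (B v) w : ℝ) ^ 2 ≤ inner ℝ (B v) v * inner ℝ (B w) w := fun v w => by
    simp only [hBin]
    exact hA.inner_sq_le_inner_mul_inner _ _
  refine ContinuousLinearMap.opNorm_le_bound _ hc0 fun v => ?_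
  have h1 := hcs v (B v)
  rw [real_inner_self_eq_norm_sq] at h1
  have h3 : ‖B v‖ ^ 2 * ‖B v‖ ^ 2 ≤ (c * ‖v‖) ^ 2 * ‖B v‖ ^ 2 := by
    calc ‖B v‖ ^ 2 * ‖B v‖ ^ 2 = (‖B v‖ ^ 2) ^ 2 := by ring
      _ ≤ _ := h1
      _ ≤ (c * ‖v‖ ^ 2) * (c * ‖B v‖ ^ 2) := by
          gcongr
          · rw [hBin]; exact hA.inner_nonneg _
          · exact hc' v
          · exact hc' _
      _ = _ := by ring
  rcases (norm_nonneg (B v)).eq_or_lt with h0 | h0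
  · change ‖B v‖ ≤ _
    rw [← h0]
    positivity
  · exact (abs_le_of_sq_le_sq' (le_of_mul_le_mul_right h3 (by positivity)) (by positivity)).2

theorem PosDefOp.sqrt_inner_add_le (hA : PosDefOp A) (x y : E) :
    √(inner ℝ (A (x + y)) (x + y)) ≤ √(inner ℝ (A x) x) + √(inner ℝ (A y) y) := by
  have h : ∀ z, (inner ℝ (A z) z : ℝ) = invQuad A (A z) := fun z => by
    rw [invQuad, hA.inverse_apply, real_inner_comm]
  rw [h, h, h, map_add]
  exact hA.sqrt_invQuad_add_le _ _

/-- Replacing a unit vector by a net point at distance at most `1/2` costs half of the norm itself,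
hence `√B ≤ m + √B / 2`, that is `√B ≤ 2 m`. -/
theorem PosDefOp.weightedSpecNormSq_le_of_net (hA : PosDefOp A) (D : E →L[ℝ] State d)
    {N : Finset (State d)} (hN : ∀ v : State d, ‖v‖ = 1 → ∃ w ∈ N, ‖v - w‖ ≤ 1 / 2) {m : ℝ}
    (hm0 : 0 ≤ m) (hm : ∀ w ∈ N, √(inner ℝ (A (adjoint D w)) (adjoint D w)) ≤ m) :
    weightedSpecNormSq D A ≤ 4 * m ^ 2 := by
  set B := weightedSpecNormSq D A with hB
  have hB0 : 0 ≤ B := weightedSpecNormSq_nonneg D A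
  have h1 : B ≤ (m + √B * (1 / 2)) ^ 2 := by
    refine hA.weightedSpecNormSq_le D (fun v hv => ?_) (sq_nonneg _)
    obtain ⟨w, hw, hvw⟩ := hN v hv
    refine (Real.sqrt_le_left (by positivity)).mp ?_
    have h2 := hA.sqrt_inner_add_le (adjoint D w) (adjoint D (v - w))
    rw [← map_add, add_sub_cancel] at h2
    refine h2.trans (add_le_add (hm w hw) ?_)
    refine (Real.sqrt_le_sqrt (inner_adjoint_le_weightedSpecNormSq D A (v - w))).trans ?_
    rw [Real.sqrt_mul hB0, Real.sqrt_sq (norm_nonneg _)]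
    gcongr
  have h3 : √B ≤ m + √B * (1 / 2) := (Real.sqrt_le_left (by positivity)).mpr h1
  have h4 : √B ≤ 2 * m := by linarith
  calc B = √B ^ 2 := (Real.sq_sqrt hB0).symm
    _ ≤ (2 * m) ^ 2 := by gcongr
    _ = _ := by ring

/-- A net of the unit sphere. -/
theorem exists_sphere_net (d : ℕ) : ∃ N : Finset (State d), N.card ≤ 5 ^ d ∧ (∀ w ∈ N, ‖w‖ = 1) ∧
    ∀ v : State d, ‖v‖ = 1 → ∃ w ∈ N, ‖v - w‖ ≤ 1 / 2 := by
  classical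
  -- Radius `2` and separation `1` are the normalization under which
  -- `Besicovitch.card_le_of_separated` gives `5 ^ d`. A separated set of maximal cardinality is a
  -- net, and it is scaled by `1/2` at the end.
  let P : Finset (State d) → Prop := fun s => (∀ c ∈ s, ‖c‖ = 2) ∧
    ∀ c ∈ s, ∀ e ∈ s, c ≠ e → 1 ≤ ‖c - e‖
  have hP : ∀ s, P s → s.card ≤ 5 ^ d := fun s hs => by
    have h := Besicovitch.card_le_of_separated s (fun c hc => (hs.1 c hc).le) hs.2
    rwa [finrank_euclideanSpace_fin] at h
  obtain ⟨s, hs, hcard⟩ := Nat.findGreatest_spec (P := fun n => ∃ s, P s ∧ s.card = n)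
    (Nat.zero_le (5 ^ d)) ⟨∅, ⟨by simp, by simp⟩, rfl⟩
  have hmax : ∀ v : State d, ‖v‖ = 2 → ∃ c ∈ s, ‖v - c‖ ≤ 1 := by
    intro v hv
    by_contra! hcon
    have hvs : v ∉ s := fun h => by
      have := hcon v h
      simp at this
      linarith
    have hPi : P (insert v s) := by
      refine ⟨fun c hc => ?_, fun c hc e he hce => ?_⟩
      · rcases Finset.mem_insert.mp hc with rfl | hc
        exacts [hv, hs.1 c hc]
      · rcases Finset.mem_insert.mp hc with hc' | hc' <;>
          rcases Finset.mem_insert.mp he with he' | he'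
        · exact absurd (hc'.trans he'.symm) hce
        · exact hc' ▸ (hcon e he').le
        · rw [norm_sub_rev]; exact he' ▸ (hcon c hc').le
        · exact hs.2 c hc' e he' hce
    have hle := Nat.le_findGreatest (P := fun n => ∃ s, P s ∧ s.card = n) (hP _ hPi) ⟨_, hPi, rfl⟩
    rw [Finset.card_insert_of_notMem hvs] at hle
    omega
  refine ⟨s.image fun c => (1 / 2 : ℝ) • c, Finset.card_image_le.trans (hP s hs), ?_, ?_⟩
  · intro w hw
    obtain ⟨c, hc, rfl⟩ := Finset.mem_image.mp hw
    rw [norm_smul, hs.1 c hc]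
    norm_num
  · intro v hv
    obtain ⟨c, hc, h⟩ := hmax ((2 : ℝ) • v) (by rw [norm_smul, hv]; norm_num)
    refine ⟨_, Finset.mem_image_of_mem _ hc, ?_⟩
    have : v - (1 / 2 : ℝ) • c = (1 / 2 : ℝ) • ((2 : ℝ) • v - c) := by
      rw [smul_sub, smul_smul]; norm_num
    rw [this, norm_smul]
    norm_num
    linarith

end WeightedNorm

/-! ### The deterministic part of the confidence bound -/

section Confidence

variable {d : ℕ} {E : Type*} [NormedAddCommGroup E] [InnerProductSpace ℝ E] [CompleteSpace E]
variable {ι : Type*} [Fintype ι]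

open ContinuousLinearMap (adjoint)

theorem mul_invQuad_cov_le {lam : ℝ} (hlam : 0 < lam) (f : ι → E) (x : E) :
    lam * invQuad (cov lam f) x ≤ ‖x‖ ^ 2 := by
  have h1 := (posDefOp_smul_id (E := E) hlam).invQuad_anti (posDefOp_cov hlam f) (fun u => by
    simp only [cov_apply, inner_add_left, sum_inner, inner_smul_left, conj_trivial]
    simp only [smul_apply, ContinuousLinearMap.id_apply, inner_smul_left, conj_trivial]
    exact le_add_of_nonneg_right (Finset.sum_nonneg fun i _ => mul_self_nonneg _)) x
  have h2 : Ring.inverse (lam • ContinuousLinearMap.id ℝ E) x = lam⁻¹ • x :=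
    (posDefOp_smul_id hlam).inverse_eq (by simp [smul_smul, hlam.ne'])
  rw [invQuad.eq_def (lam • _), h2, inner_smul_left, real_inner_self_eq_norm_sq] at h1
  calc lam * invQuad (cov lam f) x ≤ lam * (lam⁻¹ * ‖x‖ ^ 2) := by gcongr; exact h1
    _ = _ := by field_simp

/-- The error of the least squares estimate is controlled by the self-normalized noise in the
directions of a net. -/
theorem weightedSpecNormSq_sub_ridgeMin_le {lam σ b : ℝ} (hlam : 0 < lam) (hσ : 0 < σ)
    (hb : 0 ≤ b) (f : ι → E) (y : ι → State d) {W : E →L[ℝ] State d}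
    (hW : lam * ‖W‖ ^ 2 = σ ^ 2) {N : Finset (State d)} (hN1 : ∀ w ∈ N, ‖w‖ = 1)
    (hN : ∀ v : State d, ‖v‖ = 1 → ∃ w ∈ N, ‖v - w‖ ≤ 1 / 2)
    (h : ∀ w ∈ N, invQuad (cov lam f) (∑ i, (inner ℝ w (y i - W (f i)) : ℝ) • f i) ≤ σ ^ 2 * b) :
    weightedSpecNormSq (W - ridgeMin lam f y) (cov lam f) ≤ σ ^ 2 * (5 * b + 20) := by
  have hA := posDefOp_cov hlam f
  have h1 := hA.weightedSpecNormSq_le_of_net (W - ridgeMin lam f y) hN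
    (m := σ * √b + σ) (by positivity) (fun w hw => by
    rw [adjoint_sub_ridgeMin hlam, hA.apply_inverse, real_inner_comm]
    change √(invQuad (cov lam f) _) ≤ _
    rw [sub_eq_add_neg, add_comm]
    refine (hA.sqrt_invQuad_add_le _ _).trans (add_le_add ?_ ?_)
    · rw [← neg_one_smul ℝ, invQuad_smul]
      norm_num
      calc _ ≤ √(σ ^ 2 * b) := Real.sqrt_le_sqrt (h w hw)
        _ = σ * √b := by rw [Real.sqrt_mul (sq_nonneg σ), Real.sqrt_sq hσ.le]
    -- The bias term is at most `σ`, since `Σ ≥ lam • I` and `lam * ‖W‖² = σ²` by the choice of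
    -- `lam`.
    · refine Real.sqrt_le_iff.mpr ⟨hσ.le, ?_⟩
      rw [invQuad_smul]
      have h2 := mul_invQuad_cov_le hlam f (adjoint W w)
      have h3 : ‖adjoint W w‖ ≤ ‖W‖ := by
        have := (adjoint W).le_opNorm w
        rwa [hN1 w hw, mul_one, LinearIsometryEquiv.norm_map] at this
      calc lam ^ 2 * invQuad (cov lam f) (adjoint W w)
          = lam * (lam * invQuad (cov lam f) (adjoint W w)) := by ring
        _ ≤ lam * ‖W‖ ^ 2 := by
            gcongr
            exact h2.trans (by gcongr)
        _ = σ ^ 2 := hW)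
  refine h1.trans ?_
  -- `4 (√b + 1)² ≤ 5 b + 20` is a rearrangement of `(√b - 4)² ≥ 0`.
  have h4 := Real.sq_sqrt hb
  have h5 := sq_nonneg (√b - 4)
  nlinarith [mul_nonneg (sq_nonneg σ) h5]

end Confidence

/-! ### Probability that the true model leaves the confidence ball -/

namespace KNR

variable {d H : ℕ} {U : Type u} {E : Type v} [NormedAddCommGroup E] [InnerProductSpace ℝ E]
variable (M : KNR d H U E)

/-- The noise in direction `w` weighted with the features. -/
noncomputable def weightedNoise (A : Algorithm d H U) (w : State d) (t : ℕ)
    (ε : ℕ → Fin H → State d) : E :=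
  ∑ i : Fin t × Fin H, (inner ℝ w (ε i.1 i.2) : ℝ) • M.features A (M.history A ε t) i

theorem weightedNoise_succ (A : Algorithm d H U) (w : State d) (t : ℕ)
    (ε : ℕ → Fin H → State d) : M.weightedNoise A w (t + 1) ε = M.weightedNoise A w t ε +
      ∑ h, (inner ℝ w (ε t h) : ℝ) • M.episodeFeatures A (M.history A ε t) (ε t) h := by
  rw [weightedNoise, ← Equiv.sum_comp (episodeEquiv t H), Fintype.sum_sum_type]
  have h := M.features_history_comp_episodeEquiv A ε t
  congr 1
  · refine Finset.sum_congr rfl fun i _ => ?_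
    have := congrFun h (Sum.inl i)
    simp only [Function.comp, Sum.elim_inl] at this
    rw [this]
    simp [episodeEquiv]
  · refine Finset.sum_congr rfl fun i _ => ?_
    have := congrFun h (Sum.inr i)
    simp only [Function.comp, Sum.elim_inr] at this
    rw [this]
    simp [episodeEquiv]

variable [CompleteSpace E]

theorem detRatio_features_history_succ {lam : ℝ} (hlam : 0 < lam) (A : Algorithm d H U)
    (ε : ℕ → Fin H → State d) (t : ℕ) :
    detRatio lam (M.features A (M.history A ε (t + 1))) =
      detRatio lam (M.features A (M.history A ε t)) *
        relDet (cov lam (M.features A (M.history A ε t)))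
          (M.episodeFeatures A (M.history A ε t) (ε t)) := by
  rw [← detRatio_comp_equiv hlam (episodeEquiv t H), features_history_comp_episodeEquiv,
    detRatio_sumElim hlam]

/-- The exponential supermartingale of the self-normalized noise in direction `w`. -/
noncomputable def expSupermartingale (lam : ℝ) (A : Algorithm d H U) (w : State d) (t : ℕ)
    (ε : ℕ → Fin H → State d) : ℝ :=
  Real.exp (invQuad (cov lam (M.features A (M.history A ε t))) (M.weightedNoise A w t ε) /
    (2 * M.σ ^ 2)) / √(detRatio lam (M.features A (M.history A ε t)))

/-- The information gain after `t` episodes. -/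
noncomputable def gain (lam : ℝ) (A : Algorithm d H U) (t : ℕ) (ε : ℕ → Fin H → State d) : ℝ :=
  Real.log (detRatio lam (M.features A (M.history A ε t)))

theorem gain_nonneg {lam : ℝ} (hlam : 0 < lam) (A : Algorithm d H U) (t : ℕ)
    (ε : ℕ → Fin H → State d) : 0 ≤ M.gain lam A t ε :=
  Real.log_nonneg (one_le_detRatio hlam _)

theorem gain_zero {lam : ℝ} (hlam : 0 < lam) (A : Algorithm d H U) (ε : ℕ → Fin H → State d) :
    M.gain lam A 0 ε = 0 := by
  rw [gain, detRatio_eq_relDet hlam, relDet_of_isEmpty, Real.log_one]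

theorem gain_succ {lam : ℝ} (hlam : 0 < lam) (A : Algorithm d H U) (t : ℕ)
    (ε : ℕ → Fin H → State d) : M.gain lam A (t + 1) ε = M.gain lam A t ε +
      Real.log (relDet (cov lam (M.features A (M.history A ε t)))
          (M.episodeFeatures A (M.history A ε t) (ε t))) := by
  rw [gain, detRatio_features_history_succ M hlam, Real.log_mul, gain]
  · have := one_le_detRatio hlam (M.features A (M.history A ε t)); positivity
  · have := (posDefOp_cov hlam (M.features A (M.history A ε t))).one_le_relDet
      (M.episodeFeatures A (M.history A ε t) (ε t))
    positivity

theorem gain_mono {lam : ℝ} (hlam : 0 < lam) (A : Algorithm d H U) (ε : ℕ → Fin H → State d) :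
    Monotone fun t => M.gain lam A t ε := by
  refine monotone_nat_of_le_succ fun t => ?_
  rw [M.gain_succ hlam]
  exact le_add_of_nonneg_right (Real.log_nonneg ((posDefOp_cov hlam _).one_le_relDet _))

variable [MeasurableSpace E] [BorelSpace E] [SecondCountableTopology E]
variable {M} {A : Algorithm d H U}

theorem Admissible.measurable_weightedNoise (hA : M.Admissible A) (w : State d) (t : ℕ) :
    Measurable fun ε => M.weightedNoise A w t ε := by
  refine Finset.measurable_sum _ fun i _ => Measurable.smul ?_
    ((measurable_pi_apply i).comp (hA.measurable_features_history t))
  exact measurable_const.inner ((measurable_pi_apply i.2).comp (measurable_pi_apply (i.1 : ℕ)))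

theorem measurable_invQuad_cov {ι : Type*} [Fintype ι] {lam : ℝ} (hlam : 0 < lam) :
    Measurable fun p : (ι → E) × E => invQuad (cov lam p.1) p.2 := by
  have h : Continuous fun p : (ι → E) × E => invQuad (cov lam p.1) p.2 :=
    continuous_inner_inverse ((continuous_cov lam).comp continuous_fst)
      (fun p => posDefOp_cov hlam p.1) continuous_snd continuous_snd
  exact h.measurable

theorem Admissible.measurable_detRatio (hA : M.Admissible A) (lam : ℝ) (t : ℕ) :
    Measurable fun ε => detRatio lam (M.features A (M.history A ε t)) :=
  (continuous_detRatio lam).measurable.comp (hA.measurable_features_history t)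

theorem Admissible.measurable_gain (hA : M.Admissible A) (lam : ℝ) (t : ℕ) :
    Measurable fun ε => M.gain lam A t ε :=
  (hA.measurable_detRatio lam t).log

theorem Admissible.measurable_invQuad_history (hA : M.Admissible A) {lam : ℝ} (hlam : 0 < lam)
    (t : ℕ) {x : (ℕ → Fin H → State d) → E} (hx : Measurable x) :
    Measurable fun ε => invQuad (cov lam (M.features A (M.history A ε t))) (x ε) := by
  have h1 : Measurable fun ε => (M.features A (M.history A ε t), x ε) :=
    (hA.measurable_features_history t).prodMk hx
  have h2 := (measurable_invQuad_cov (E := E) (ι := Fin t × Fin H) hlam).comp h1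
  exact h2

theorem Admissible.measurable_expSupermartingale (hA : M.Admissible A) {lam : ℝ} (hlam : 0 < lam)
    (w : State d) (t : ℕ) : Measurable fun ε => M.expSupermartingale lam A w t ε :=
  (((hA.measurable_invQuad_history hlam t (hA.measurable_weightedNoise w t)).div_const _).exp).div
    (hA.measurable_detRatio lam t).sqrt

/-- Given the first `t` episodes, everything but the noise of episode `t` is frozen, and
`lintegral_exp_invQuad_le` integrates that noise. -/
theorem Admissible.lintegral_expSupermartingale_le (hA : M.Admissible A) (hσ : 0 < M.σ) {lam : ℝ}
    (hlam : 0 < lam) {w : State d} (hw : ‖w‖ = 1) (t : ℕ) :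
    ∫⁻ ε, ENNReal.ofReal (M.expSupermartingale lam A w t ε) ∂noise d H M.σ ≤ 1 := by
  induction t with
  | zero =>
    have h : ∀ ε, M.expSupermartingale lam A w 0 ε = 1 := fun ε => by
      rw [expSupermartingale, detRatio_eq_relDet hlam, relDet_of_isEmpty]
      simp [weightedNoise, invQuad]
    simp [h]
  | succ t ih =>
    refine le_trans ?_ ih
    rw [lintegral_noise_splice t (hA.measurable_expSupermartingale hlam w (t + 1)).ennreal_ofReal]
    refine lintegral_mono fun ε => ?_
    set hist := M.history A ε t with hhist
    set S := M.weightedNoise A w t ε with hS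
    set B := cov lam (M.features A hist) with hB
    set D := detRatio lam (M.features A hist) with hD
    have hB' : PosDefOp B := posDefOp_cov hlam _
    have hD1 : 1 ≤ D := one_le_detRatio hlam _
    let F : (Fin H → State d) → ℝ≥0∞ := fun e => ENNReal.ofReal (Real.exp (invQuad
      (B + ∑ h, InnerProductSpace.rankOne ℝ (M.episodeFeatures A hist e h)
        (M.episodeFeatures A hist e h))
      (S + ∑ h, (inner ℝ w (e h) : ℝ) • M.episodeFeatures A hist e h) / (2 * M.σ ^ 2)) /
      √(relDet B (M.episodeFeatures A hist e)))
    have hfeat : ∀ h, Measurable fun e : Fin H → State d => M.episodeFeatures A hist e h :=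
      fun h => (hA.measurable_episodeFeatures t h).comp measurable_prodMk_left
    have hF : Measurable F := by
      refine measurable_exp_invQuad hB' _ (measurable_pi_lambda _ hfeat) ?_
      exact measurable_const.add (Finset.measurable_sum _ fun h _ =>
        Measurable.smul (measurable_const.inner (measurable_pi_apply h)) (hfeat h))
    have hrw : ∀ ε', ENNReal.ofReal (M.expSupermartingale lam A w (t + 1) (splice t ε ε')) =
        ENNReal.ofReal (√D)⁻¹ * F (ε' 0) := by
      intro ε'
      have hSt : M.weightedNoise A w t (splice t ε ε') = S := by
        rw [hS, weightedNoise, weightedNoise, history_splice_self]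
        exact Finset.sum_congr rfl fun i _ => by rw [splice_of_lt i.1.isLt]
      rw [expSupermartingale, cov_features_history_succ, weightedNoise_succ,
        detRatio_features_history_succ M hlam, hSt, history_splice_self, splice_self,
        Real.sqrt_mul (by positivity), ← ENNReal.ofReal_mul (by positivity)]
      congr 1
      rw [div_mul_eq_div_div, div_right_comm]
      ring
    rw [lintegral_congr hrw, lintegral_const_mul' _ _ ENNReal.ofReal_ne_top,
      lintegral_noise_zero hF]
    have hmean : ∀ h : Fin H, Measurable fun x => M.φ x (A t hist x h) := fun h =>
      ((hA t).2 h).comp measurable_prodMk_left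
    have hstep := lintegral_exp_invQuad_le hσ hw
      (mean := fun h x => M.Wstar (M.φ x (A t hist x h)))
      (fun h => M.Wstar.continuous.measurable.comp (hmean h)) hmean hB' S M.x₀
    refine (mul_le_mul_right hstep _).trans_eq ?_
    rw [← ENNReal.ofReal_mul (by positivity), expSupermartingale]
    exact congrArg ENNReal.ofReal (div_eq_inv_mul _ _).symm

/-- The set where the self-normalized noise in direction `w` is large. -/
def tailSet (M : KNR d H U E) (lam : ℝ) (A : Algorithm d H U) (a : ℝ) (t : ℕ) (w : State d) :
    Set (ℕ → Fin H → State d) :=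
  {ε | M.σ ^ 2 * (M.gain lam A t ε + 2 * a) <
    invQuad (cov lam (M.features A (M.history A ε t))) (M.weightedNoise A w t ε)}

theorem Admissible.measurableSet_tailSet (hA : M.Admissible A) {lam : ℝ} (hlam : 0 < lam) (a : ℝ)
    (t : ℕ) (w : State d) : MeasurableSet (M.tailSet lam A a t w) :=
  measurableSet_lt (measurable_const.mul ((hA.measurable_gain lam t).add measurable_const))
    (hA.measurable_invQuad_history hlam t (hA.measurable_weightedNoise w t))

/-- A refined Markov inequality. The supermartingale is `exp b` with `b ≥ -gain / 2`, and `b ≥ a` on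
the tail set. As `exp x - 1 - x` is non-negative everywhere and increasing for `x ≥ 0`, it is at
least `exp a - 1 - a` on that set. Since `exp b` has expectation at most `1`, what remains on the
right is the expectation of `gain / 2`, so the bound vanishes with the gain. -/
theorem Admissible.noise_tailSet_mul_le (hA : M.Admissible A) (hσ : 0 < M.σ) {lam : ℝ}
    (hlam : 0 < lam) {a : ℝ} (ha : 0 ≤ a) (t : ℕ) {w : State d} (hw : ‖w‖ = 1) :
    noise d H M.σ (M.tailSet lam A a t w) * ENNReal.ofReal (Real.exp a - 1 - a) ≤
      ∫⁻ ε, ENNReal.ofReal (M.gain lam A t ε / 2) ∂noise d H M.σ := by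
  have hea := Real.add_one_le_exp a
  have hpt : ∀ ε, (M.tailSet lam A a t w).indicator
      (fun _ => ENNReal.ofReal (Real.exp a - 1 - a)) ε + 1 ≤
      ENNReal.ofReal (M.expSupermartingale lam A w t ε) + ENNReal.ofReal (M.gain lam A t ε / 2) := by
    intro ε
    have hg := M.gain_nonneg hlam A t ε
    have hD := one_le_detRatio hlam (M.features A (M.history A ε t))
    set Q := invQuad (cov lam (M.features A (M.history A ε t))) (M.weightedNoise A w t ε) with hQ
    have hQ0 : 0 ≤ Q := (posDefOp_cov hlam _).invQuad_nonneg _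
    set g := M.gain lam A t ε with hgdef
    have hexp : M.expSupermartingale lam A w t ε = Real.exp (Q / (2 * M.σ ^ 2) - g / 2) := by
      rw [expSupermartingale, Real.exp_sub, hgdef, gain, Real.exp_half, Real.exp_log (by positivity)]
    rw [hexp, ← ENNReal.ofReal_add (Real.exp_pos _).le (by positivity)]
    set b := Q / (2 * M.σ ^ 2) - g / 2 with hb
    have hbg : 0 ≤ b + g / 2 := by rw [hb]; simp only [sub_add_cancel]; positivity
    by_cases hε : ε ∈ M.tailSet lam A a t w
    · rw [Set.indicator_of_mem hε, ← ENNReal.ofReal_one, ← ENNReal.ofReal_add (by linarith) (by simp)]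
      refine ENNReal.ofReal_le_ofReal ?_
      have hab : a ≤ b := by
        have h : M.σ ^ 2 * (g + 2 * a) < Q := hε
        rw [hb, le_sub_iff_add_le, le_div_iff₀ (by positivity)]
        linarith
      have h1 : Real.exp b = Real.exp a * Real.exp (b - a) := by rw [← Real.exp_add]; congr 1; ring
      have h2 := Real.add_one_le_exp (b - a)
      have h3 : Real.exp a * (b - a + 1) ≤ Real.exp b := by
        rw [h1]; exact mul_le_mul_of_nonneg_left h2 (Real.exp_pos a).le
      have h4 : 1 * (b - a) ≤ Real.exp a * (b - a) :=
        mul_le_mul_of_nonneg_right (by linarith) (by linarith)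
      nlinarith
    · rw [Set.indicator_of_notMem hε, zero_add, ← ENNReal.ofReal_one]
      refine ENNReal.ofReal_le_ofReal ?_
      linarith [Real.add_one_le_exp b]
  have hint := lintegral_mono (μ := noise d H M.σ) hpt
  rw [lintegral_add_right _ measurable_const, lintegral_add_left
    (hA.measurable_expSupermartingale hlam w t).ennreal_ofReal,
    lintegral_indicator_const (hA.measurableSet_tailSet hlam a t w), lintegral_const,
    measure_univ, one_mul, mul_comm, add_comm] at hint
  have h2 := hint.trans (add_le_add_left (hA.lintegral_expSupermartingale_le hσ hlam hw t) _)
  exact (ENNReal.add_le_add_iff_left ENNReal.one_ne_top).mp h2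

theorem two_add_two_mul_le_exp {a : ℝ} (ha : 2 ≤ a) : 2 + 2 * a ≤ Real.exp a := by
  have h1 : Real.exp a = Real.exp 1 * Real.exp 1 * Real.exp (a - 2) := by
    rw [← Real.exp_add, ← Real.exp_add]; congr 1; ring
  have h2 := Real.add_one_le_exp (a - 2)
  have h3 := Real.exp_one_gt_d9
  have h4 : (7 : ℝ) ≤ Real.exp 1 * Real.exp 1 := by nlinarith
  have h5 : 7 * (a - 2 + 1) ≤ Real.exp 1 * Real.exp 1 * Real.exp (a - 2) := by
    gcongr
  rw [h1]
  linarith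

theorem Admissible.noise_tailSet_le (hA : M.Admissible A) (hσ : 0 < M.σ) {lam : ℝ}
    (hlam : 0 < lam) {a : ℝ} (ha : 2 ≤ a) (t : ℕ) {w : State d} (hw : ‖w‖ = 1) :
    noise d H M.σ (M.tailSet lam A a t w) ≤ ENNReal.ofReal (Real.exp (-a)) *
      ∫⁻ ε, ENNReal.ofReal (M.gain lam A t ε) ∂noise d H M.σ := by
  have h := hA.noise_tailSet_mul_le hσ hlam (by linarith : 0 ≤ a) t hw
  have h1 := two_add_two_mul_le_exp ha
  have h2 : ENNReal.ofReal (Real.exp a / 2) ≤ ENNReal.ofReal (Real.exp a - 1 - a) :=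
    ENNReal.ofReal_le_ofReal (by linarith)
  have h3 : ∀ ε, ENNReal.ofReal (M.gain lam A t ε / 2) =
      ENNReal.ofReal (1 / 2) * ENNReal.ofReal (M.gain lam A t ε) := fun ε => by
    rw [← ENNReal.ofReal_mul (by norm_num), div_eq_inv_mul, one_div]
  rw [lintegral_congr h3, lintegral_const_mul' _ _ ENNReal.ofReal_ne_top] at h
  have h4 : ENNReal.ofReal (2 * Real.exp (-a)) * ENNReal.ofReal (Real.exp a / 2) = 1 := by
    rw [← ENNReal.ofReal_mul (by positivity), Real.exp_neg, ← ENNReal.ofReal_one]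
    congr 1
    field_simp
  calc noise d H M.σ (M.tailSet lam A a t w)
      = ENNReal.ofReal (2 * Real.exp (-a)) *
          (noise d H M.σ (M.tailSet lam A a t w) * ENNReal.ofReal (Real.exp a / 2)) := by
        rw [mul_left_comm, h4, mul_one]
    _ ≤ ENNReal.ofReal (2 * Real.exp (-a)) * (ENNReal.ofReal (1 / 2) *
          ∫⁻ ε, ENNReal.ofReal (M.gain lam A t ε) ∂noise d H M.σ) := by
        exact mul_le_mul_right ((mul_le_mul_right h2 _).trans h) _
    _ = _ := by
        rw [← mul_assoc, ← ENNReal.ofReal_mul (by positivity)]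
        congr 2
        ring

/-- The confidence event fails with small probability. -/
theorem Admissible.noise_iUnion_tailSet_le (hA : M.Admissible A) (hσ : 0 < M.σ) {lam : ℝ}
    (hlam : 0 < lam) (hd : 1 ≤ d) {t : ℕ} (ht : 1 ≤ t) {N : Finset (State d)}
    (hcard : N.card ≤ 5 ^ d) (hN : ∀ w ∈ N, ‖w‖ = 1) :
    noise d H M.σ (⋃ w ∈ N, M.tailSet lam A (2 * (d + Real.log t)) t w) ≤
      ENNReal.ofReal (1 / t ^ 2) * ∫⁻ ε, ENNReal.ofReal (M.gain lam A t ε) ∂noise d H M.σ := by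
  have ht' : (1 : ℝ) ≤ t := by exact_mod_cast ht
  have hd' : (1 : ℝ) ≤ d := by exact_mod_cast hd
  have hlog := Real.log_nonneg ht'
  set a : ℝ := 2 * (d + Real.log t) with ha
  -- As `5 ≤ exp 2`, the part `2 d` of `a` pays for the union over the net and `2 log t` leaves the
  -- summable `1 / t²`.
  have hea : (5 : ℝ) ^ d * Real.exp (-a) ≤ 1 / t ^ 2 := by
    have h1 : Real.exp (-a) = (Real.exp (-2)) ^ d * (1 / t ^ 2) := by
      rw [ha, ← Real.exp_nat_mul, mul_add, neg_add, Real.exp_add]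
      congr 1
      · congr 1; ring
      · rw [Real.exp_neg, two_mul, Real.exp_add, Real.exp_log (by positivity), sq, one_div]
    have h2 : 5 * Real.exp (-2) ≤ 1 := by
      have h3 := two_add_two_mul_le_exp (le_refl (2 : ℝ))
      rw [Real.exp_neg, ← div_eq_mul_inv, div_le_one (Real.exp_pos _)]
      linarith
    rw [h1, ← mul_assoc, ← mul_pow]
    exact mul_le_of_le_one_left (by positivity) (pow_le_one₀ (by positivity) h2)
  refine (measure_biUnion_finset_le N _).trans ?_
  refine (Finset.sum_le_card_nsmul N _ _ fun w hw =>
    hA.noise_tailSet_le hσ hlam (by linarith : 2 ≤ a) t (hN w hw)).trans ?_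
  rw [nsmul_eq_mul, ← mul_assoc]
  gcongr
  refine le_trans ?_ (ENNReal.ofReal_le_ofReal hea)
  rw [ENNReal.ofReal_mul (by positivity)]
  gcongr
  rw [← Nat.cast_ofNat, ← Nat.cast_pow, ENNReal.ofReal_natCast]
  exact_mod_cast hcard

/-- Outside of the tail events the true model is in the confidence ball. -/
theorem Wstar_mem_confidenceBall {lam : ℝ} (hlam : 0 < lam) (hσ : 0 < M.σ)
    (hW : lam * ‖M.Wstar‖ ^ 2 = M.σ ^ 2) {t : ℕ} (ht : 1 ≤ t) {N : Finset (State d)}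
    (hN1 : ∀ w ∈ N, ‖w‖ = 1) (hN : ∀ v : State d, ‖v‖ = 1 → ∃ w ∈ N, ‖v - w‖ ≤ 1 / 2)
    {ε : ℕ → Fin H → State d}
    (hε : ε ∉ ⋃ w ∈ N, M.tailSet lam A (2 * (d + Real.log t)) t w) :
    M.Wstar ∈ M.confidenceBall lam 20 A (M.history A ε t) := by
  have ht' : (1 : ℝ) ≤ t := by exact_mod_cast ht
  have hlog := Real.log_nonneg ht'
  have hg := M.gain_nonneg hlam A t ε
  have hD := one_le_detRatio hlam (M.features A (M.history A ε t))
  refine ⟨ridgeMin lam (M.features A (M.history A ε t)) (nextStates (M.history A ε t)),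
    fun W' => ridgeMin_le hlam _ _ W', ?_⟩
  refine (weightedSpecNormSq_sub_ridgeMin_le hlam hσ
    (b := M.gain lam A t ε + 2 * (2 * (d + Real.log t))) (by positivity) _ _ hW hN1 hN
    fun w hw => ?_).trans ?_
  · simp only [Set.mem_iUnion, not_exists] at hε
    have h := hε w hw
    simp only [tailSet, Set.mem_ofPred_eq, not_lt] at h
    simp only [nextStates_history_sub]
    exact h
  -- The level `4 (d + log t)` times the factor `5` gives `20 (d + log t)`; this and the bias `20`
  -- determine `C₁ = 20`.
  · rw [beta, max_eq_left ht', Real.log_mul (by positivity) (by positivity), hW]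
    change M.σ ^ 2 * (5 * (M.gain lam A t ε + _) + 20) ≤
      20 * (M.σ ^ 2 + M.σ ^ 2 * (d + (Real.log t + M.gain lam A t ε)))
    nlinarith [mul_nonneg (sq_nonneg M.σ) hg]

end KNR

/-! ### The elliptical potential -/

theorem min_one_le_log {q : ℝ} (hq : 0 ≤ q) : min 1 q ≤ 3 / 2 * Real.log (1 + q) := by
  -- At `x = 1` the claim is `log 2 ≥ 2/3`, the origin of the factor `3/2`.
  have key : ∀ x : ℝ, 0 ≤ x → x ≤ 1 → x ≤ 3 / 2 * Real.log (1 + x) := fun x hx hx1 => by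
    have h := Real.le_log_one_add_of_nonneg hx
    have h2 : 2 / 3 * x ≤ 2 * x / (x + 2) := by
      rw [le_div_iff₀ (by positivity)]
      nlinarith
    linarith
  rcases le_total q 1 with h | h
  · rw [min_eq_right h]
    exact key q hq h
  · rw [min_eq_left h]
    refine (key 1 zero_le_one le_rfl).trans ?_
    gcongr

namespace KNR

variable {d H : ℕ} {U : Type u} {E : Type v} [NormedAddCommGroup E] [InnerProductSpace ℝ E]
variable (M : KNR d H U E) [CompleteSpace E]

/-- The truncated elliptical potential of episode `t`. -/
noncomputable def potential (lam : ℝ) (A : Algorithm d H U) (t : ℕ) (ε : ℕ → Fin H → State d) : ℝ :=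
  min 1 (∑ h, invQuad (cov lam (M.features A (M.history A ε t)))
    (M.episodeFeatures A (M.history A ε t) (ε t) h))

theorem potential_nonneg {lam : ℝ} (hlam : 0 < lam) (A : Algorithm d H U) (t : ℕ)
    (ε : ℕ → Fin H → State d) : 0 ≤ M.potential lam A t ε :=
  le_min zero_le_one (Finset.sum_nonneg fun _ _ => (posDefOp_cov hlam _).invQuad_nonneg _)

theorem potential_le {lam : ℝ} (hlam : 0 < lam) (A : Algorithm d H U) (t : ℕ)
    (ε : ℕ → Fin H → State d) :
    M.potential lam A t ε ≤ 3 / 2 * (M.gain lam A (t + 1) ε - M.gain lam A t ε) := by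
  have hA := posDefOp_cov hlam (M.features A (M.history A ε t))
  have hs := Finset.sum_nonneg fun (h : Fin H) (_ : h ∈ Finset.univ) =>
    hA.invQuad_nonneg (M.episodeFeatures A (M.history A ε t) (ε t) h)
  rw [M.gain_succ hlam, add_sub_cancel_left]
  refine (min_one_le_log hs).trans ?_
  gcongr
  exact hA.one_add_sum_invQuad_le_relDet _

theorem sum_potential_le {lam : ℝ} (hlam : 0 < lam) (A : Algorithm d H U) (n : ℕ)
    (ε : ℕ → Fin H → State d) :
    ∑ t ∈ Finset.range n, M.potential lam A t ε ≤ 3 / 2 * M.gain lam A n ε := by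
  refine (Finset.sum_le_sum fun t _ => M.potential_le hlam A t ε).trans ?_
  rw [← Finset.mul_sum, Finset.sum_range_sub (fun t => M.gain lam A t ε), M.gain_zero hlam, sub_zero]

/-- The full run has seen the features of the restarted run and those of the first `s` episodes.
Additional features enlarge `Σ` and decrease the inverse quadratic form. -/
theorem potential_splice_le {lam : ℝ} (hlam : 0 < lam) (A : Algorithm d H U) (s t : ℕ)
    (ε ε' : ℕ → Fin H → State d) : M.potential lam A (s + t) (splice s ε ε') ≤
      M.potential lam (A.restart (M.history A ε s)) t ε' := by
  unfold potential
  rw [episodeFeatures_restart]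
  refine min_le_min_left _ (Finset.sum_le_sum fun h _ => ?_)
  have hinj : Function.Injective fun k : Fin t × Fin H => (Fin.natAdd s k.1, k.2) := by
    rintro ⟨i, k⟩ ⟨j, l⟩ hij
    simpa using hij
  refine invQuad_cov_anti hlam ⟨_, hinj⟩ (fun k => ?_) _
  change M.features A (M.history A (splice s ε ε') (s + t)) (Fin.natAdd s k.1, k.2) = _
  rw [features_history, features_history]
  exact congrFun (M.episodeFeatures_restart A s ε ε' k.1) k.2

variable [MeasurableSpace E] [BorelSpace E] [SecondCountableTopology E]
variable {M} {A : Algorithm d H U}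

theorem Admissible.measurable_potential (hA : M.Admissible A) {lam : ℝ} (hlam : 0 < lam) (t : ℕ) :
    Measurable fun ε => M.potential lam A t ε :=
  measurable_const.min (Finset.measurable_sum _ fun h _ =>
    hA.measurable_invQuad_history hlam t (hA.measurable_episodeFeatures_history t h))

theorem Admissible.lintegral_gain_le (hA : M.Admissible A) {lam : ℝ} (hlam : 0 < lam) {t T : ℕ}
    (htT : t ≤ T) : ∫⁻ ε, ENNReal.ofReal (M.gain lam A t ε) ∂noise d H M.σ ≤ M.infoGain lam T := by
  refine le_trans (lintegral_mono fun ε => ENNReal.ofReal_le_ofReal (M.gain_mono hlam A ε htT)) ?_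
  exact le_iSup₂ (f := fun (A : Algorithm d H U) (_ : M.Admissible A) =>
    ∫⁻ ε, ENNReal.ofReal (Real.log (detRatio lam (M.features A (M.history A ε T))))
      ∂noise d H M.σ) A hA

theorem Admissible.lintegral_sum_potential_le (hA : M.Admissible A) {lam : ℝ} (hlam : 0 < lam)
    {n T : ℕ} (hn : n ≤ T) :
    ∫⁻ ε, ∑ t ∈ Finset.range n, ENNReal.ofReal (M.potential lam A t ε) ∂noise d H M.σ ≤
      ENNReal.ofReal (3 / 2) * M.infoGain lam T := by
  refine le_trans (lintegral_mono fun ε => ?_)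
    ((lintegral_const_mul' _ _ ENNReal.ofReal_ne_top).le.trans
      (mul_le_mul_right (hA.lintegral_gain_le hlam hn) _))
  rw [← ENNReal.ofReal_sum_of_nonneg (fun t _ => M.potential_nonneg hlam A t ε),
    ← ENNReal.ofReal_mul (by norm_num)]
  exact ENNReal.ofReal_le_ofReal (M.sum_potential_le hlam A n ε)

/-- Whatever the history, the expected future potential is at most the maximum information gain. -/
theorem Admissible.lintegral_sum_potential_splice_le (hA : M.Admissible A) {lam : ℝ}
    (hlam : 0 < lam) (s : ℕ) (ε : ℕ → Fin H → State d) {n T : ℕ} (hn : n ≤ T) :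
    ∫⁻ ε', ∑ t ∈ Finset.range n, ENNReal.ofReal (M.potential lam A (s + t) (splice s ε ε'))
      ∂noise d H M.σ ≤ ENNReal.ofReal (3 / 2) * M.infoGain lam T :=
  le_trans (lintegral_mono fun ε' => Finset.sum_le_sum fun t _ =>
    ENNReal.ofReal_le_ofReal (M.potential_splice_le hlam A s t ε ε'))
    ((hA.restart (M.history A ε s)).lintegral_sum_potential_le hlam hn)

theorem Admissible.lintegral_sum_gain_mul_potential_le (hA : M.Admissible A) {lam : ℝ}
    (hlam : 0 < lam) (T : ℕ) :
    ∫⁻ ε, ∑ t ∈ Finset.range T, ENNReal.ofReal (M.gain lam A t ε) *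
      ENNReal.ofReal (M.potential lam A t ε) ∂noise d H M.σ ≤
      ENNReal.ofReal (3 / 2) * M.infoGain lam T * M.infoGain lam T := by
  let ℓ : ℕ → (ℕ → Fin H → State d) → ℝ≥0∞ := fun s ε =>
    ENNReal.ofReal (M.gain lam A (s + 1) ε - M.gain lam A s ε)
  have hℓ : ∀ s, Measurable (ℓ s) := fun s =>
    ((hA.measurable_gain lam _).sub (hA.measurable_gain lam s)).ennreal_ofReal
  have hpot : ∀ t, Measurable fun ε => ENNReal.ofReal (M.potential lam A t ε) := fun t =>
    (hA.measurable_potential hlam t).ennreal_ofReal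
  have hgain : ∀ t ε, ENNReal.ofReal (M.gain lam A t ε) = ∑ s ∈ Finset.range t, ℓ s ε := by
    intro t ε
    rw [← ENNReal.ofReal_sum_of_nonneg (fun s _ => sub_nonneg.mpr
      (M.gain_mono hlam A ε (Nat.le_succ s))), Finset.sum_range_sub (fun t => M.gain lam A t ε),
      M.gain_zero hlam, sub_zero]
  -- Summation over pairs `s < t`: the increment of episode `s` multiplies the potentials of the
  -- episodes `s + 1, …, T - 1`.
  have hswap : ∀ ε, ∑ t ∈ Finset.range T, ENNReal.ofReal (M.gain lam A t ε) *
      ENNReal.ofReal (M.potential lam A t ε) = ∑ s ∈ Finset.range T, ℓ s ε *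
        ∑ t ∈ Finset.range (T - (s + 1)), ENNReal.ofReal (M.potential lam A (s + 1 + t) ε) := by
    intro ε
    simp only [hgain, Finset.sum_mul, Finset.mul_sum]
    rw [Finset.sum_sigma', Finset.sum_sigma']
    refine Finset.sum_bij' (fun p _ => ⟨p.2, p.1 - (p.2 + 1)⟩) (fun p _ => ⟨p.1 + 1 + p.2, p.1⟩)
      ?_ ?_ ?_ ?_ ?_
    · rintro ⟨a, b⟩ h
      simp only [Finset.mem_sigma, Finset.mem_range] at h ⊢
      omega
    · rintro ⟨a, b⟩ h
      simp only [Finset.mem_sigma, Finset.mem_range] at h ⊢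
      omega
    · rintro ⟨a, b⟩ h
      simp only [Finset.mem_sigma, Finset.mem_range] at h
      have : b + 1 + (a - (b + 1)) = a := by omega
      simp [this]
    · rintro ⟨a, b⟩ h
      simp
    · rintro ⟨a, b⟩ h
      simp only [Finset.mem_sigma, Finset.mem_range] at h
      have : b + 1 + (a - (b + 1)) = a := by omega
      simp [this]
  have hterm : ∀ s ∈ Finset.range T, ∫⁻ ε, ℓ s ε *
      ∑ t ∈ Finset.range (T - (s + 1)), ENNReal.ofReal (M.potential lam A (s + 1 + t) ε)
      ∂noise d H M.σ ≤ ENNReal.ofReal (3 / 2) * M.infoGain lam T * ∫⁻ ε, ℓ s ε ∂noise d H M.σ := by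
    intro s _
    have hm : Measurable fun ε => ℓ s ε *
        ∑ t ∈ Finset.range (T - (s + 1)), ENNReal.ofReal (M.potential lam A (s + 1 + t) ε) :=
      (hℓ s).mul (Finset.measurable_sum _ fun t _ => hpot _)
    rw [lintegral_noise_splice (s + 1) hm, ← lintegral_const_mul _ (hℓ s)]
    refine lintegral_mono fun ε => ?_
    -- The increment is determined by the first `s + 1` episodes, so it leaves the inner integral
    -- and only the future potential is averaged.
    have hsp : ∀ ε', ℓ s (splice (s + 1) ε ε') = ℓ s ε := fun ε' => by
      have h1 := M.history_splice_self A (s + 1) ε ε'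
      have h2 : M.history A (splice (s + 1) ε ε') s = M.history A ε s :=
        M.history_congr A fun i hi => splice_of_lt (by omega) ε ε'
      simp only [ℓ, gain, h1, h2]
    simp only [hsp]
    have hm2 : Measurable fun ε' => ∑ t ∈ Finset.range (T - (s + 1)),
        ENNReal.ofReal (M.potential lam A (s + 1 + t) (splice (s + 1) ε ε')) :=
      (Finset.measurable_sum _ fun t _ => hpot _).comp
        ((measurable_splice (s + 1)).comp measurable_prodMk_left)
    rw [lintegral_const_mul _ hm2, mul_comm]
    exact mul_le_mul_left (hA.lintegral_sum_potential_splice_le hlam (s + 1) ε (by omega)) _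
  have hm : ∀ s ∈ Finset.range T, Measurable fun ε => ℓ s ε *
      ∑ t ∈ Finset.range (T - (s + 1)), ENNReal.ofReal (M.potential lam A (s + 1 + t) ε) :=
    fun s _ => (hℓ s).mul (Finset.measurable_sum _ fun t _ => hpot _)
  rw [lintegral_congr hswap, lintegral_finsetSum _ hm]
  refine (Finset.sum_le_sum hterm).trans ?_
  rw [← Finset.mul_sum, ← lintegral_finsetSum _ fun s _ => hℓ s]
  refine mul_le_mul_right ?_ _
  refine le_trans (le_of_eq ?_) (hA.lintegral_gain_le hlam (le_refl T))
  exact lintegral_congr fun ε => (hgain T ε).symm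

end KNR

/-! ### Inequalities for truncated sums and square roots -/

theorem sum_min_one_le_mul_min {ι : Type*} [Fintype ι] {a q : ι → ℝ} {K : ℝ}
    (hK : (Fintype.card ι : ℝ) ≤ K) (h : ∀ i, a i ≤ K * q i) :
    ∑ i, min 1 (a i) ≤ K * min 1 (∑ i, q i) := by
  have hK0 : 0 ≤ K := le_trans (by positivity) hK
  rw [mul_min_of_nonneg _ _ hK0, mul_one, Finset.mul_sum]
  refine le_min ?_ (Finset.sum_le_sum fun i _ => (min_le_right _ _).trans (h i))
  refine (Finset.sum_le_sum fun i _ => min_le_left 1 (a i)).trans ?_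
  simpa using hK

theorem le_rpow_half_of_sq_le {a b : ℝ≥0∞} (h : a ^ 2 ≤ b) : a ≤ b ^ (1 / 2 : ℝ) := by
  refine le_trans (le_of_eq ?_) (ENNReal.rpow_le_rpow h (by norm_num : (0 : ℝ) ≤ 1 / 2))
  rw [← ENNReal.rpow_natCast, ← ENNReal.rpow_mul]
  norm_num

theorem lintegral_rpow_half_le {α : Type*} [MeasurableSpace α] {μ : Measure α}
    [IsProbabilityMeasure μ] {f : α → ℝ≥0∞} (hf : Measurable f) :
    ∫⁻ a, f a ^ (1 / 2 : ℝ) ∂μ ≤ (∫⁻ a, f a ∂μ) ^ (1 / 2 : ℝ) := by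
  refine le_rpow_half_of_sq_le ((sq_lintegral_le (hf.pow_const _).aemeasurable).trans (le_of_eq ?_))
  refine lintegral_congr fun a => ?_
  rw [← ENNReal.rpow_natCast, ← ENNReal.rpow_mul]
  norm_num

theorem sum_rpow_half_le {ι : Type*} (s : Finset ι) (f : ι → ℝ≥0∞) :
    ∑ i ∈ s, f i ^ (1 / 2 : ℝ) ≤ ((s.card : ℝ≥0∞) * ∑ i ∈ s, f i) ^ (1 / 2 : ℝ) := by
  have h := ENNReal.inner_le_Lp_mul_Lq s (fun _ => 1) (fun i => f i ^ (1 / 2 : ℝ))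
    Real.HolderConjugate.two_two
  have h2 : ∀ i, (f i ^ (1 / 2 : ℝ)) ^ (2 : ℝ) = f i := fun i => by
    rw [← ENNReal.rpow_mul]; norm_num
  simp only [one_mul, ENNReal.one_rpow, h2, Finset.sum_const, nsmul_eq_mul, mul_one] at h
  rwa [ENNReal.mul_rpow_of_nonneg _ _ (by norm_num)]

theorem sum_range_one_div_sq_le (n : ℕ) :
    ∑ t ∈ Finset.range n, (1 / (t : ℝ) ^ 2) ≤ 2 := by
  -- The term `t = 0` is `0` by division by zero; from `t = 2` on the sum is compared with a
  -- telescoping one.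
  suffices h : ∀ n : ℕ, ∑ t ∈ Finset.range (n + 2), (1 / (t : ℝ) ^ 2) ≤ 2 - 1 / ((n : ℝ) + 1) by
    refine (Finset.sum_le_sum_of_subset_of_nonneg (Finset.range_mono (by omega : n ≤ n + 2))
      fun _ _ _ => by positivity).trans ((h n).trans (sub_le_self _ (by positivity)))
  intro n
  induction n with
  | zero => simp [Finset.sum_range_succ]; norm_num
  | succ n ih =>
    rw [Finset.sum_range_succ]
    refine (add_le_add_left ih _).trans ?_
    push_cast
    have h : (1 : ℝ) / (n + 2) ^ 2 ≤ 1 / (n + 1) - 1 / (n + 1 + 1) := by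
      rw [div_sub_div _ _ (by positivity) (by positivity), div_le_div_iff₀ (by positivity)
        (by positivity)]
      nlinarith
    linarith

/-! ### Costs under two models and accuracy of the balls -/

namespace KNR

variable {d H : ℕ} {U : Type u} {E : Type v} [NormedAddCommGroup E] [InnerProductSpace ℝ E]
variable (M : KNR d H U E)

theorem coe_cumCost (t : ℕ) (π : State d → Fin H → U) (x : Fin (H + 1) → State d) :
    (M.cumCost t π x : ℝ≥0∞) =
      ∑ h : Fin H, (M.c t (x h.castSucc) (π (x h.castSucc) h) : ℝ≥0∞) :=
  ENNReal.ofNNReal_finsetSum _ _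

variable [MeasurableSpace E] [BorelSpace E] {M}

theorem MeasurablePolicies.measurable_mean (hM : M.MeasurablePolicies) {π : State d → Fin H → U}
    (hπ : π ∈ M.policies) (W : E →L[ℝ] State d) (h : Fin H) :
    Measurable fun x => W (M.φ x (π x h)) :=
  W.continuous.measurable.comp (hM π hπ h).1

theorem MeasurablePolicies.measurable_traj (hM : M.MeasurablePolicies) {π : State d → Fin H → U}
    (hπ : π ∈ M.policies) (W : E →L[ℝ] State d) (i : Fin (H + 1)) :
    Measurable fun e => M.traj W π e i :=
  (measurable_path (hM.measurable_mean hπ W) i).comp measurable_prodMk_left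

theorem MeasurablePolicies.measurable_cumCost (hM : M.MeasurablePolicies)
    {π : State d → Fin H → U} (hπ : π ∈ M.policies) (W : E →L[ℝ] State d) (t : ℕ) :
    Measurable fun e => (M.cumCost t π (M.traj W π e) : ℝ≥0∞) := by
  simp only [coe_cumCost]
  exact Finset.measurable_sum _ fun h _ =>
    (((hM π hπ h).2 t).comp (hM.measurable_traj hπ W h.castSucc)).coe_nnreal_ennreal

/-- Comparison of the expected costs of a policy under the true and under another model. -/
theorem MeasurablePolicies.J_Wstar_le (hM : M.MeasurablePolicies) (hσ : 0 < M.σ)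
    {π : State d → Fin H → U} (hπ : π ∈ M.policies) (W : E →L[ℝ] State d) (t : ℕ) :
    M.J t M.Wstar π ≤ M.J t W π + (H * M.secondMoment t π) ^ (1 / 2 : ℝ) *
      (∫⁻ e, ∑ h : Fin H, ENNReal.ofReal (min 1 (‖(M.Wstar - W)
        (M.φ (M.traj M.Wstar π e h.castSucc) (π (M.traj M.Wstar π e h.castSucc) h))‖ ^ 2 /
          M.σ ^ 2)) ∂episodeNoise d H M.σ) ^ (1 / 2 : ℝ) := by
  have h := lintegral_cost_path_le hσ (hM.measurable_mean hπ M.Wstar) (hM.measurable_mean hπ W)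
    (c := fun h x => (M.c t x (π x h) : ℝ≥0∞))
    (fun h => ((hM π hπ h).2 t).coe_nnreal_ennreal) 0 M.x₀
  simp only [zero_add] at h
  simp only [J, secondMoment, coe_cumCost]
  exact h

/-- The crude bound used when confidence fails, by Jensen's inequality. -/
theorem MeasurablePolicies.J_Wstar_le_rpow_secondMoment (hM : M.MeasurablePolicies)
    {π : State d → Fin H → U} (hπ : π ∈ M.policies) (t : ℕ) :
    M.J t M.Wstar π ≤ M.secondMoment t π ^ (1 / 2 : ℝ) :=
  le_rpow_half_of_sq_le (sq_lintegral_le (hM.measurable_cumCost hπ M.Wstar t).aemeasurable)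

variable {A : Algorithm d H U}

theorem MeasurableCosts.measurable_cumCost [SecondCountableTopology E] (hC : M.MeasurableCosts A)
    (hA : M.Admissible A) (t : ℕ) : Measurable fun p : History d H t × (Fin H → State d) =>
      M.cumCost t (A t p.1) (M.traj M.Wstar (A t p.1) p.2) :=
  Finset.measurable_sum _ fun h _ =>
    (hC t h).comp (measurable_fst.prodMk (hA.measurable_traj t h.castSucc))

theorem MeasurableCosts.measurable_realizedCost [SecondCountableTopology E]
    (hC : M.MeasurableCosts A) (hA : M.Admissible A) (t : ℕ) :
    Measurable fun ε => M.realizedCost A ε t := by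
  have h1 : Measurable fun ε : ℕ → Fin H → State d => (M.history A ε t, ε t) :=
    (hA.measurable_history t).prodMk (measurable_pi_apply t)
  have h2 := (hC.measurable_cumCost hA t).comp h1
  exact h2

/-- The noise of episode `t` is independent of the history, which alone determines the policy. -/
theorem lintegral_realizedCost [SecondCountableTopology E] (hM : M.MeasurablePolicies)
    (hA : M.Admissible A) (hC : M.MeasurableCosts A) (t : ℕ) :
    ∫⁻ ε, (M.realizedCost A ε t : ℝ≥0∞) ∂noise d H M.σ =
      ∫⁻ ε, M.J t M.Wstar (A t (M.history A ε t)) ∂noise d H M.σ := by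
  rw [lintegral_noise_splice t (hC.measurable_realizedCost hA t).coe_nnreal_ennreal]
  refine lintegral_congr fun ε => ?_
  simp only [realizedCost, history_splice_self, splice_self]
  exact lintegral_noise_zero (hM.measurable_cumCost ((hA t).1 _) M.Wstar t)

variable [CompleteSpace E]

/-- The minimizer is unique, so both models are compared with one centre, and `‖a - b‖² ≤ 2 ‖a‖² + 2
‖b‖²` gives the factor `4`. -/
theorem norm_sub_apply_sq_le_of_mem_confidenceBall {lam C : ℝ} (hlam : 0 < lam) {t : ℕ}
    {hist : History d H t} {W W' : E →L[ℝ] State d} (hW : W ∈ M.confidenceBall lam C A hist)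
    (hW' : W' ∈ M.confidenceBall lam C A hist) (x : E) :
    ‖(W - W') x‖ ^ 2 ≤ 4 * M.beta lam C A hist *
      invQuad (cov lam (M.features A hist)) x := by
  obtain ⟨R, hR, hWR⟩ := hW
  obtain ⟨R', hR', hWR'⟩ := hW'
  rw [eq_ridgeMin hlam _ _ hR] at hWR
  rw [eq_ridgeMin hlam _ _ hR'] at hWR'
  set R := ridgeMin lam (M.features A hist) (nextStates hist)
  have hP := posDefOp_cov hlam (M.features A hist)
  have hq := hP.invQuad_nonneg x
  have h1 := (hP.norm_apply_sq_le (W - R) x).trans (mul_le_mul_of_nonneg_right hWR hq)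
  have h2 := (hP.norm_apply_sq_le (W' - R) x).trans (mul_le_mul_of_nonneg_right hWR' hq)
  have h3 : (W - W') x = (W - R) x - (W' - R) x := by simp
  have h4 := norm_sub_le ((W - R) x) ((W' - R) x)
  rw [← h3] at h4
  have h5 := norm_nonneg ((W - W') x)
  nlinarith [sq_nonneg (‖(W - R) x‖ - ‖(W' - R) x‖)]

/-- Before any data `Σ = lam • I`, and the initial ball acts as a confidence ball centred at `0`. -/
theorem norm_sub_apply_sq_le_of_norm_le {lam C : ℝ} (hlam : 0 < lam)
    {hist : History d H 0} {W W' : E →L[ℝ] State d}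
    (hW : lam * ‖W‖ ^ 2 ≤ C * (lam * ‖M.Wstar‖ ^ 2 + M.σ ^ 2 * d))
    (hW' : lam * ‖W'‖ ^ 2 ≤ C * (lam * ‖M.Wstar‖ ^ 2 + M.σ ^ 2 * d)) (x : E) :
    ‖(W - W') x‖ ^ 2 ≤ 4 * M.beta lam C A hist *
      invQuad (cov lam (M.features A hist)) x := by
  have hcov : cov lam (M.features A hist) = lam • ContinuousLinearMap.id ℝ E := by
    simp [cov]
  have hinv : invQuad (cov lam (M.features A hist)) x = lam⁻¹ * ‖x‖ ^ 2 := by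
    rw [hcov, invQuad, (posDefOp_smul_id hlam).inverse_eq (y := lam⁻¹ • x) (by
      simp [smul_smul, hlam.ne']), inner_smul_left, real_inner_self_eq_norm_sq]
    rfl
  have hbeta : M.beta lam C A hist = C * (lam * ‖M.Wstar‖ ^ 2 + M.σ ^ 2 * d) := by
    rw [beta, detRatio_eq_relDet hlam, relDet_of_isEmpty]
    simp
  rw [hbeta, hinv]
  set B := C * (lam * ‖M.Wstar‖ ^ 2 + M.σ ^ 2 * d)
  have h4 : ‖(W - W') x‖ ≤ (‖W‖ + ‖W'‖) * ‖x‖ :=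
    ((W - W').le_opNorm x).trans (mul_le_mul_of_nonneg_right (norm_sub_le _ _) (norm_nonneg _))
  have h5 : lam * (‖W‖ + ‖W'‖) ^ 2 ≤ 4 * B := by
    nlinarith [mul_nonneg hlam.le (sq_nonneg (‖W‖ - ‖W'‖))]
  calc ‖(W - W') x‖ ^ 2 ≤ ((‖W‖ + ‖W'‖) * ‖x‖) ^ 2 := by gcongr
    _ = lam * (‖W‖ + ‖W'‖) ^ 2 * (lam⁻¹ * ‖x‖ ^ 2) := by field_simp
    _ ≤ _ := by gcongr

end KNR

/-! ### The expected excess cost of an episode -/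

namespace KNR

variable {d H : ℕ} {U : Type u} {E : Type v} [NormedAddCommGroup E] [InnerProductSpace ℝ E]
variable (M : KNR d H U E) [CompleteSpace E]

/-- A bound for the statistical error of episode `t`. -/
noncomputable def episodeError (lam : ℝ) (T : ℕ) (A : Algorithm d H U) (t : ℕ)
    (ε : ℕ → Fin H → State d) : ℝ :=
  160 * (d + Real.log T + H + M.gain lam A t ε) * M.potential lam A t ε

theorem episodeError_splice (lam : ℝ) (T : ℕ) (A : Algorithm d H U) (t : ℕ)
    (ε ε' : ℕ → Fin H → State d) : M.episodeError lam T A t (splice t ε ε') =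
      160 * (d + Real.log T + H + M.gain lam A t ε) *
        min 1 (∑ h, invQuad (cov lam (M.features A (M.history A ε t)))
          (M.episodeFeatures A (M.history A ε t) (ε' 0) h)) := by
  simp only [episodeError, gain, potential, history_splice_self, splice_self]

/-- `4 C₁ = 80`, doubled because the summand `1` from `lam * ‖W⋆‖² = σ²` is absorbed using `1 ≤ d`.
-/
theorem four_mul_beta_div_le {lam : ℝ} (hlam : 0 < lam) (hσ : 0 < M.σ)
    (hW : lam * ‖M.Wstar‖ ^ 2 = M.σ ^ 2) (hd : 1 ≤ d) {t T : ℕ} (htT : t < T)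
    (A : Algorithm d H U) (ε : ℕ → Fin H → State d) :
    4 * M.beta lam 20 A (M.history A ε t) / M.σ ^ 2 ≤
      160 * (d + Real.log T + H + M.gain lam A t ε) := by
  have hd' : (1 : ℝ) ≤ d := by exact_mod_cast hd
  have hm : (1 : ℝ) ≤ max (t : ℝ) 1 := le_max_right _ _
  have hmT : max (t : ℝ) 1 ≤ T := max_le (by exact_mod_cast htT.le)
    (by exact_mod_cast (by omega : 1 ≤ T))
  have hlog : Real.log (max (t : ℝ) 1) ≤ Real.log T := by gcongr
  have hlog0 := Real.log_nonneg hm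
  have hg := M.gain_nonneg hlam A t ε
  have hD := one_le_detRatio hlam (M.features A (M.history A ε t))
  rw [beta, Real.log_mul (by positivity) (by positivity), hW, div_le_iff₀ (by positivity)]
  change 4 * (20 * (M.σ ^ 2 + M.σ ^ 2 * (d + (_ + M.gain lam A t ε)))) ≤ _
  have hH : (0 : ℝ) ≤ H := by positivity
  have h : 4 * (20 * (1 + (d + (Real.log (max (t : ℝ) 1) + M.gain lam A t ε)))) ≤
      160 * (d + Real.log T + H + M.gain lam A t ε) := by linarith
  nlinarith [mul_le_mul_of_nonneg_right h (sq_nonneg M.σ)]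

/-- Merging `H` truncations at `1` into a single one needs a coefficient of at least `H`; this is
the source of the `H` in `dTilde`. -/
theorem le_episodeError_coeff {lam : ℝ} (hlam : 0 < lam) (T t : ℕ) (A : Algorithm d H U)
    (ε : ℕ → Fin H → State d) :
    (H : ℝ) ≤ 160 * (d + Real.log T + H + M.gain lam A t ε) := by
  have hg := M.gain_nonneg hlam A t ε
  have hlog := Real.log_natCast_nonneg T
  have hH : (0 : ℝ) ≤ H := by positivity
  have hd : (0 : ℝ) ≤ d := by positivity
  linarith

variable [MeasurableSpace E] [BorelSpace E] [SecondCountableTopology E] {M} {A : Algorithm d H U}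

theorem Admissible.measurable_episodeError (hA : M.Admissible A) {lam : ℝ} (hlam : 0 < lam)
    (T t : ℕ) : Measurable fun ε => M.episodeError lam T A t ε :=
  (measurable_const.mul (measurable_const.add (hA.measurable_gain lam t))).mul
    (hA.measurable_potential hlam t)

/-- The excess cost of an optimistic policy, when the optimistic model is accurate. -/
theorem J_Wstar_le_of_accurate (hA : M.Admissible A) (hM : M.MeasurablePolicies) (hσ : 0 < M.σ)
    {lam : ℝ} (hlam : 0 < lam) (hW : lam * ‖M.Wstar‖ ^ 2 = M.σ ^ 2) (hd : 1 ≤ d) {t T : ℕ}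
    (htT : t < T) {V : ℝ≥0∞} (hV : ∀ π ∈ M.policies, M.secondMoment t π ≤ V)
    {ε : ℕ → Fin H → State d} {W : E →L[ℝ] State d}
    (hacc : ∀ x, ‖(M.Wstar - W) x‖ ^ 2 ≤ 4 * M.beta lam 20 A (M.history A ε t) *
      invQuad (cov lam (M.features A (M.history A ε t))) x)
    (hopt : ∀ π ∈ M.policies, M.J t W (A t (M.history A ε t)) ≤ M.J t M.Wstar π) :
    M.J t M.Wstar (A t (M.history A ε t)) ≤ M.Jstar t + (H * V) ^ (1 / 2 : ℝ) *
      (∫⁻ ε', ENNReal.ofReal (M.episodeError lam T A t (splice t ε ε')) ∂noise d H M.σ) ^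
        (1 / 2 : ℝ) := by
  have hπ := (hA t).1 (M.history A ε t)
  refine (hM.J_Wstar_le hσ hπ W t).trans ?_
  gcongr
  · exact le_iInf₂ hopt
  · exact hV _ hπ
  have hmeas : Measurable fun e => ∑ h : Fin H, ENNReal.ofReal (min 1 (‖(M.Wstar - W)
      (M.episodeFeatures A (M.history A ε t) e h)‖ ^ 2 / M.σ ^ 2)) := by
    refine Finset.measurable_sum _ fun h _ => ENNReal.measurable_ofReal.comp
      (measurable_const.min ((Measurable.pow_const ?_ 2).div_const _))
    have h1 : Measurable fun e => M.episodeFeatures A (M.history A ε t) e h :=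
      (hA.measurable_episodeFeatures t h).comp measurable_prodMk_left
    exact ((M.Wstar - W).continuous.measurable.comp h1).norm
  refine (lintegral_noise_zero hmeas).symm.le.trans (lintegral_mono fun ε' => ?_)
  rw [← ENNReal.ofReal_sum_of_nonneg fun h _ => le_min zero_le_one (by positivity),
    episodeError_splice]
  refine ENNReal.ofReal_le_ofReal (sum_min_one_le_mul_min ?_ fun h => ?_)
  · simpa using M.le_episodeError_coeff hlam T t A ε
  · rw [div_le_iff₀ (by positivity)]
    refine (hacc _).trans ?_
    have hq := (posDefOp_cov hlam (M.features A (M.history A ε t))).invQuad_nonneg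
      (M.episodeFeatures A (M.history A ε t) (ε' 0) h)
    have h4 := (div_le_iff₀ (by positivity)).mp (M.four_mul_beta_div_le hlam hσ hW hd htT A ε)
    refine (mul_le_mul_of_nonneg_right h4 hq).trans (le_of_eq (by ring))

/-- The expected cost of an episode, when the chosen model is accurate and optimistic outside of
the event `B`. -/
theorem lintegral_realizedCost_le (hA : M.Admissible A) (hM : M.MeasurablePolicies)
    (hC : M.MeasurableCosts A) (hσ : 0 < M.σ)
    {lam : ℝ} (hlam : 0 < lam) (hW : lam * ‖M.Wstar‖ ^ 2 = M.σ ^ 2) (hd : 1 ≤ d) {t T : ℕ}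
    (htT : t < T) {V : ℝ≥0∞} (hV : ∀ π ∈ M.policies, M.secondMoment t π ≤ V)
    {B : Set (ℕ → Fin H → State d)} (hB : MeasurableSet B)
    (hgood : ∀ ε ∉ B, ∃ W : E →L[ℝ] State d,
      (∀ x, ‖(M.Wstar - W) x‖ ^ 2 ≤ 4 * M.beta lam 20 A (M.history A ε t) *
        invQuad (cov lam (M.features A (M.history A ε t))) x) ∧
      ∀ π ∈ M.policies, M.J t W (A t (M.history A ε t)) ≤ M.J t M.Wstar π) :
    ∫⁻ ε, (M.realizedCost A ε t : ℝ≥0∞) ∂noise d H M.σ ≤ M.Jstar t + (H * V) ^ (1 / 2 : ℝ) *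
      (∫⁻ ε, ENNReal.ofReal (M.episodeError lam T A t ε) ∂noise d H M.σ) ^ (1 / 2 : ℝ) +
        V ^ (1 / 2 : ℝ) * noise d H M.σ B := by
  have hF := (hA.measurable_episodeError hlam T t).ennreal_ofReal
  set D : (ℕ → Fin H → State d) → ℝ≥0∞ := fun ε =>
    ∫⁻ ε', ENNReal.ofReal (M.episodeError lam T A t (splice t ε ε')) ∂noise d H M.σ with hD
  have hDm : Measurable D := by
    have h1 : Measurable fun p : (ℕ → Fin H → State d) × (ℕ → Fin H → State d) =>
      ENNReal.ofReal (M.episodeError lam T A t (splice t p.1 p.2)) := hF.comp (measurable_splice t)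
    exact h1.lintegral_prod_right'
  rw [lintegral_realizedCost hM hA hC, lintegral_noise_splice t hF]
  calc ∫⁻ ε, M.J t M.Wstar (A t (M.history A ε t)) ∂noise d H M.σ
      ≤ ∫⁻ ε, ((M.Jstar t + (H * V) ^ (1 / 2 : ℝ) * D ε ^ (1 / 2 : ℝ)) +
          V ^ (1 / 2 : ℝ) * B.indicator 1 ε) ∂noise d H M.σ := by
        refine lintegral_mono fun ε => ?_
        by_cases hε : ε ∈ B
        · have hπ := (hA t).1 (M.history A ε t)
          simp only [Set.indicator_of_mem hε, Pi.one_apply, mul_one]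
          exact (((hM.J_Wstar_le_rpow_secondMoment hπ t).trans
            (ENNReal.rpow_le_rpow (hV _ hπ) (by norm_num))).trans le_add_self)
        · obtain ⟨W, hacc, hopt⟩ := hgood ε hε
          exact (J_Wstar_le_of_accurate hA hM hσ hlam hW hd htT hV hacc hopt).trans le_self_add
    _ = M.Jstar t + (H * V) ^ (1 / 2 : ℝ) * ∫⁻ ε, D ε ^ (1 / 2 : ℝ) ∂noise d H M.σ +
          V ^ (1 / 2 : ℝ) * noise d H M.σ B := by
        rw [lintegral_add_right _ ((measurable_one.indicator hB).const_mul _),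
          lintegral_add_left measurable_const, lintegral_const_mul _ (hDm.pow_const _),
          lintegral_const_mul _ (measurable_one.indicator hB), lintegral_indicator_one hB]
        simp
    _ ≤ _ := by
        gcongr
        exact lintegral_rpow_half_le hDm

theorem Admissible.lintegral_sum_episodeError_le (hA : M.Admissible A) {lam : ℝ} (hlam : 0 < lam)
    (T : ℕ) : ∑ t ∈ Finset.range T,
      ∫⁻ ε, ENNReal.ofReal (M.episodeError lam T A t ε) ∂noise d H M.σ ≤
      ENNReal.ofReal 240 * (M.infoGain lam T *
        (M.infoGain lam T + ENNReal.ofReal (d + Real.log T + H))) := by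
  set g : ℝ := d + Real.log T + H with hg
  have hg0 : 0 ≤ g := by have := Real.log_natCast_nonneg T; positivity
  have hpm : ∀ t, Measurable fun ε => ENNReal.ofReal (M.potential lam A t ε) := fun t =>
    (hA.measurable_potential hlam t).ennreal_ofReal
  have hgm : ∀ t, Measurable fun ε => ENNReal.ofReal (M.gain lam A t ε) *
      ENNReal.ofReal (M.potential lam A t ε) := fun t =>
    (hA.measurable_gain lam t).ennreal_ofReal.mul (hpm t)
  have hterm : ∀ t, ∫⁻ ε, ENNReal.ofReal (M.episodeError lam T A t ε) ∂noise d H M.σ =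
      ENNReal.ofReal 160 * (ENNReal.ofReal g *
        ∫⁻ ε, ENNReal.ofReal (M.potential lam A t ε) ∂noise d H M.σ +
        ∫⁻ ε, ENNReal.ofReal (M.gain lam A t ε) * ENNReal.ofReal (M.potential lam A t ε)
          ∂noise d H M.σ) := by
    intro t
    rw [← lintegral_const_mul _ (hpm t), ← lintegral_add_right _ (hgm t),
      ← lintegral_const_mul' _ _ ENNReal.ofReal_ne_top]
    refine lintegral_congr fun ε => ?_
    have h1 := M.gain_nonneg hlam A t ε
    have h2 := M.potential_nonneg hlam A t ε
    rw [← add_mul, ← ENNReal.ofReal_add hg0 h1, ← ENNReal.ofReal_mul (by positivity),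
      ← ENNReal.ofReal_mul (by positivity), episodeError, mul_assoc]
  have h1 := hA.lintegral_sum_potential_le hlam (le_refl T)
  have h2 := hA.lintegral_sum_gain_mul_potential_le hlam T
  rw [lintegral_finsetSum _ fun t _ => hpm t] at h1
  rw [lintegral_finsetSum _ fun t _ => hgm t] at h2
  simp only [hterm]
  rw [← Finset.mul_sum, Finset.sum_add_distrib, ← Finset.mul_sum]
  refine (mul_le_mul_right (add_le_add (mul_le_mul_right h1 _) h2) _).trans (le_of_eq ?_)
  -- `160` from the coefficient of `episodeError`, `3/2` from the potential.
  have h3 : ENNReal.ofReal 240 = ENNReal.ofReal 160 * ENNReal.ofReal (3 / 2) := by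
    rw [← ENNReal.ofReal_mul (by norm_num)]; norm_num
  rw [h3]
  ring

end KNR

/-! ### Summation over the episodes -/

theorem ofReal_rpow_half {x : ℝ} (hx : 0 ≤ x) :
    ENNReal.ofReal x ^ (1 / 2 : ℝ) = ENNReal.ofReal √x := by
  rw [ENNReal.ofReal_rpow_of_nonneg hx (by norm_num), Real.sqrt_eq_rpow]

/-- The main term has the constant `√240 ≤ 16`. Since `γ ≤ √(γ (γ + g))` and `1 ≤ H T`, the failures
add at most `2`, which leaves room below `20`. -/
theorem regret_bound_le {γ v g : ℝ} (hγ : 0 ≤ γ) (hv : 0 ≤ v) (hg : 0 ≤ g) {H T : ℕ} (hH : 1 ≤ H)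
    (hT : 1 ≤ T) (b : ℝ) :
    √(H * v) * √(T * (240 * (γ * (γ + g)))) + √v * (2 * γ + b) ≤
      20 * √(γ * (γ + g)) * √(v * H * T) + b * √v := by
  have hHT : (1 : ℝ) ≤ H * T := by exact_mod_cast Nat.mul_pos hH hT
  have h1 : √(H * v) * √(T * (240 * (γ * (γ + g)))) =
      √240 * (√(γ * (γ + g)) * √(v * H * T)) := by
    rw [← Real.sqrt_mul (by positivity), ← Real.sqrt_mul (by positivity),
      ← Real.sqrt_mul (by positivity)]
    congr 1
    ring
  have h2 : √240 ≤ 16 := Real.sqrt_le_iff.mpr (by norm_num)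
  have h3 : γ ≤ √(γ * (γ + g)) := Real.le_sqrt_of_sq_le (by nlinarith [mul_nonneg hγ hg])
  have h4 : √v ≤ √(v * H * T) := Real.sqrt_le_sqrt (by
    rw [mul_assoc]; exact le_mul_of_one_le_right hv hHT)
  have h5 : √v * γ ≤ √(γ * (γ + g)) * √(v * H * T) := by
    rw [mul_comm]
    gcongr
  have h6 : 0 ≤ √(γ * (γ + g)) * √(v * H * T) := by positivity
  rw [h1]
  nlinarith [mul_le_mul_of_nonneg_right h2 h6]

namespace KNR

variable {d H : ℕ} {U : Type u} {E : Type v} [NormedAddCommGroup E] [InnerProductSpace ℝ E]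
variable [CompleteSpace E] [MeasurableSpace E] [BorelSpace E] {M : KNR d H U E}
variable {A : Algorithm d H U} {lam : ℝ} {Ball₀ : Set (E →L[ℝ] State d)}

theorem IsLC3.exists_accurate (hLC : M.IsLC3 lam 20 Ball₀ A) (hlam : 0 < lam) {t : ℕ} (ht : 1 ≤ t)
    {hist : History d H t} (hmem : M.Wstar ∈ M.confidenceBall lam 20 A hist) :
    ∃ W : E →L[ℝ] State d,
      (∀ x, ‖(M.Wstar - W) x‖ ^ 2 ≤ 4 * M.beta lam 20 A hist *
        invQuad (cov lam (M.features A hist)) x) ∧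
      ∀ π ∈ M.policies, M.J t W (A t hist) ≤ M.J t M.Wstar π := by
  obtain ⟨-, W, hW, hopt⟩ := hLC t hist
  simp only [ball, if_neg (by omega : t ≠ 0)] at hW hopt
  exact ⟨W, norm_sub_apply_sq_le_of_mem_confidenceBall hlam hmem hW, fun π hπ => hopt π hπ _ hmem⟩

theorem IsLC3.exists_accurate_zero (hLC : M.IsLC3 lam 20 Ball₀ A) (hlam : 0 < lam)
    (hmem : M.Wstar ∈ Ball₀)
    (hBall : ∀ W ∈ Ball₀, lam * ‖W‖ ^ 2 ≤ 20 * (lam * ‖M.Wstar‖ ^ 2 + M.σ ^ 2 * d))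
    (hist : History d H 0) :
    ∃ W : E →L[ℝ] State d,
      (∀ x, ‖(M.Wstar - W) x‖ ^ 2 ≤ 4 * M.beta lam 20 A hist *
        invQuad (cov lam (M.features A hist)) x) ∧
      ∀ π ∈ M.policies, M.J 0 W (A 0 hist) ≤ M.J 0 M.Wstar π := by
  obtain ⟨-, W, hW, hopt⟩ := hLC 0 hist
  simp only [ball, if_true] at hW hopt
  exact ⟨W, norm_sub_apply_sq_le_of_norm_le hlam (hBall _ hmem) (hBall _ hW),
    fun π hπ => hopt π hπ _ hmem⟩

variable [SecondCountableTopology E]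

theorem IsLC3.lintegral_sum_realizedCost_le (hLC : M.IsLC3 lam 20 Ball₀ A) (hA : M.Admissible A)
    (hM : M.MeasurablePolicies) (hC : M.MeasurableCosts A) (hσ : 0 < M.σ)
    (hlam : 0 < lam) (hW : lam * ‖M.Wstar‖ ^ 2 = M.σ ^ 2) (hd : 1 ≤ d)
    {V : ℝ≥0∞} (hV : ∀ t, ∀ π ∈ M.policies, M.secondMoment t π ≤ V)
    {B₀ : Set (ℕ → Fin H → State d)} (hB₀ : MeasurableSet B₀)
    (hgood₀ : ∀ ε ∉ B₀, ∃ W : E →L[ℝ] State d,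
      (∀ x, ‖(M.Wstar - W) x‖ ^ 2 ≤ 4 * M.beta lam 20 A (M.history A ε 0) *
        invQuad (cov lam (M.features A (M.history A ε 0))) x) ∧
      ∀ π ∈ M.policies, M.J 0 W (A 0 (M.history A ε 0)) ≤ M.J 0 M.Wstar π) (T : ℕ) :
    ∑ t ∈ Finset.range T, ∫⁻ ε, (M.realizedCost A ε t : ℝ≥0∞) ∂noise d H M.σ ≤
      ∑ t ∈ Finset.range T, M.Jstar t + ((H * V) ^ (1 / 2 : ℝ) *
        (T * (ENNReal.ofReal 240 * (M.infoGain lam T *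
          (M.infoGain lam T + ENNReal.ofReal (d + Real.log T + H))))) ^ (1 / 2 : ℝ) +
        V ^ (1 / 2 : ℝ) * (2 * M.infoGain lam T + noise d H M.σ B₀)) := by
  obtain ⟨N, hcard, hN1, hN⟩ := exists_sphere_net d
  -- At `t = 0` the coefficient `1 / t²` is `0`, and only the exceptional set `B₀` of the initial
  -- ball counts.
  have hterm : ∀ t ∈ Finset.range T,
      ∫⁻ ε, (M.realizedCost A ε t : ℝ≥0∞) ∂noise d H M.σ ≤
        M.Jstar t + (H * V) ^ (1 / 2 : ℝ) *
        (∫⁻ ε, ENNReal.ofReal (M.episodeError lam T A t ε) ∂noise d H M.σ) ^ (1 / 2 : ℝ) +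
        V ^ (1 / 2 : ℝ) * (ENNReal.ofReal (1 / (t : ℝ) ^ 2) * M.infoGain lam T +
          if t = 0 then noise d H M.σ B₀ else 0) := by
    intro t ht
    have htT := Finset.mem_range.mp ht
    rcases Nat.eq_zero_or_pos t with rfl | ht1
    · refine (lintegral_realizedCost_le hA hM hC hσ hlam hW hd htT (hV 0) hB₀ hgood₀).trans ?_
      simp
    · have hB : MeasurableSet (⋃ w ∈ N, M.tailSet lam A (2 * (d + Real.log t)) t w) :=
        Finset.measurableSet_biUnion _ fun w _ => hA.measurableSet_tailSet hlam _ t w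
      refine (lintegral_realizedCost_le hA hM hC hσ hlam hW hd htT (hV t) hB fun ε hε =>
        hLC.exists_accurate hlam ht1
          (Wstar_mem_confidenceBall hlam hσ hW ht1 hN1 hN hε)).trans ?_
      rw [if_neg ht1.ne', add_zero]
      gcongr
      refine (hA.noise_iUnion_tailSet_le hσ hlam hd ht1 hcard hN1).trans ?_
      gcongr
      exact hA.lintegral_gain_le hlam htT.le
  refine (Finset.sum_le_sum hterm).trans ?_
  rw [Finset.sum_add_distrib, Finset.sum_add_distrib, ← Finset.mul_sum, ← Finset.mul_sum, add_assoc,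
    Finset.sum_add_distrib, ← Finset.sum_mul]
  gcongr
  · refine (sum_rpow_half_le _ _).trans ?_
    rw [Finset.card_range]
    gcongr
    exact hA.lintegral_sum_episodeError_le hlam T
  · rw [← ENNReal.ofReal_sum_of_nonneg fun _ _ => by positivity]
    refine (ENNReal.ofReal_le_ofReal (sum_range_one_div_sq_le T)).trans (by norm_num)
  · rw [Finset.sum_ite_eq' (Finset.range T) 0 fun _ => noise d H M.σ B₀]
    split_ifs
    · exact le_rfl
    · exact zero_le

theorem lintegral_realizedCost_ne_top (hA : M.Admissible A)
    (hM : M.MeasurablePolicies) (hC : M.MeasurableCosts A) {V : ℝ≥0∞} (hVtop : V ≠ ∞) (t : ℕ)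
    (hV : ∀ π ∈ M.policies, M.secondMoment t π ≤ V) :
    ∫⁻ ε, (M.realizedCost A ε t : ℝ≥0∞) ∂noise d H M.σ ≠ ∞ := by
  have hV' : V ^ (1 / 2 : ℝ) ≠ ∞ := ENNReal.rpow_ne_top_of_nonneg (by norm_num) hVtop
  rw [lintegral_realizedCost hM hA hC]
  refine ne_top_of_le_ne_top hV' ?_
  refine (lintegral_mono (g := fun _ => V ^ (1 / 2 : ℝ)) fun ε => ?_).trans (by simp)
  have hπ := (hA t).1 (M.history A ε t)
  exact (hM.J_Wstar_le_rpow_secondMoment hπ t).trans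
    (ENNReal.rpow_le_rpow (hV _ hπ) (by norm_num))

theorem integrable_realizedCost (hA : M.Admissible A)
    (hM : M.MeasurablePolicies) (hC : M.MeasurableCosts A) {V : ℝ≥0∞} (hVtop : V ≠ ∞) (t : ℕ)
    (hV : ∀ π ∈ M.policies, M.secondMoment t π ≤ V) :
    Integrable (fun ε => (M.realizedCost A ε t : ℝ)) (noise d H M.σ) := by
  refine ⟨(hC.measurable_realizedCost hA t).coe_nnreal_real.aestronglyMeasurable, ?_⟩
  rw [hasFiniteIntegral_iff_enorm]
  refine lt_of_eq_of_lt (lintegral_congr fun ε => ?_)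
    (lintegral_realizedCost_ne_top hA hM hC hVtop t hV).lt_top
  simp [enorm]

theorem Jstar_ne_top (hA : M.Admissible A) (hM : M.MeasurablePolicies) {V : ℝ≥0∞}
    (hVtop : V ≠ ∞) (t : ℕ) (hV : ∀ π ∈ M.policies, M.secondMoment t π ≤ V) :
    M.Jstar t ≠ ∞ := by
  -- The zero history serves only to exhibit a feasible policy.
  have hπ := (hA t).1 0
  refine ne_top_of_le_ne_top (ENNReal.rpow_ne_top_of_nonneg (by norm_num : (0 : ℝ) ≤ 1 / 2) hVtop)
    ((iInf₂_le _ hπ).trans ((hM.J_Wstar_le_rpow_secondMoment hπ t).trans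
      (ENNReal.rpow_le_rpow (hV _ hπ) (by norm_num))))

theorem integrable_regret (hA : M.Admissible A)
    (hM : M.MeasurablePolicies) (hC : M.MeasurableCosts A) {V : ℝ≥0∞} (hVtop : V ≠ ∞)
    (hV : ∀ t, ∀ π ∈ M.policies, M.secondMoment t π ≤ V) (T : ℕ) :
    Integrable (M.regret A T) (noise d H M.σ) := by
  have h := (integrable_finsetSum (Finset.range T) fun t _ =>
    integrable_realizedCost hA hM hC hVtop t (hV t)).sub
      (integrable_const (∑ t ∈ Finset.range T, (M.Jstar t).toReal))
  exact h

theorem integral_regret (hA : M.Admissible A)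
    (hM : M.MeasurablePolicies) (hC : M.MeasurableCosts A) {V : ℝ≥0∞} (hVtop : V ≠ ∞)
    (hV : ∀ t, ∀ π ∈ M.policies, M.secondMoment t π ≤ V) (T : ℕ) :
    ∫ ε, M.regret A T ε ∂noise d H M.σ =
      (∑ t ∈ Finset.range T, ∫⁻ ε, (M.realizedCost A ε t : ℝ≥0∞) ∂noise d H M.σ).toReal -
        (∑ t ∈ Finset.range T, M.Jstar t).toReal := by
  have hi : ∀ t ∈ Finset.range T,
      Integrable (fun ε => (M.realizedCost A ε t : ℝ)) (noise d H M.σ) := fun t _ =>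
    integrable_realizedCost hA hM hC hVtop t (hV t)
  simp only [regret]
  rw [integral_sub (integrable_finsetSum _ hi) (integrable_const _), integral_finsetSum _ hi,
    ENNReal.toReal_sum fun t _ => lintegral_realizedCost_ne_top hA hM hC hVtop t (hV t),
    ENNReal.toReal_sum fun t _ => Jstar_ne_top hA hM hVtop t (hV t)]
  congr 1
  · refine Finset.sum_congr rfl fun t _ => ?_
    rw [integral_eq_lintegral_of_nonneg_ae (Filter.Eventually.of_forall fun _ => NNReal.coe_nonneg _)
      (hC.measurable_realizedCost hA t).coe_nnreal_real.aestronglyMeasurable]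
    simp only [ENNReal.ofReal_coe_nnreal]
  · simp

theorem IsLC3.integral_regret_le (hLC : M.IsLC3 lam 20 Ball₀ A) (hA : M.Admissible A)
    (hM : M.MeasurablePolicies) (hC : M.MeasurableCosts A) (hσ : 0 < M.σ)
    (hlam : 0 < lam) (hW : lam * ‖M.Wstar‖ ^ 2 = M.σ ^ 2) (hd : 1 ≤ d)
    {v : ℝ} (hv : 0 ≤ v) (hV : ∀ t, ∀ π ∈ M.policies, M.secondMoment t π ≤ ENNReal.ofReal v)
    {B₀ : Set (ℕ → Fin H → State d)} (hB₀ : MeasurableSet B₀)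
    (hgood₀ : ∀ ε ∉ B₀, ∃ W : E →L[ℝ] State d,
      (∀ x, ‖(M.Wstar - W) x‖ ^ 2 ≤ 4 * M.beta lam 20 A (M.history A ε 0) *
        invQuad (cov lam (M.features A (M.history A ε 0))) x) ∧
      ∀ π ∈ M.policies, M.J 0 W (A 0 (M.history A ε 0)) ≤ M.J 0 M.Wstar π) (T : ℕ)
    (hγ : M.infoGain lam T ≠ ∞) :
    ∫ ε, M.regret A T ε ∂noise d H M.σ ≤ 20 * dTilde (M.infoGain lam T).toReal d H T *
      √(v * H * T) + (noise d H M.σ).real B₀ * √v := by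
  by_cases hHT : 1 ≤ H ∧ 1 ≤ T
  · obtain ⟨hH, hT⟩ := hHT
    set γ := (M.infoGain lam T).toReal with hγr
    have hγ0 : 0 ≤ γ := ENNReal.toReal_nonneg
    set g : ℝ := d + Real.log T + H with hg
    have hg0 : 0 ≤ g := by have := Real.log_natCast_nonneg T; positivity
    have hb : noise d H M.σ B₀ = ENNReal.ofReal ((noise d H M.σ).real B₀) :=
      (ofReal_measureReal (measure_ne_top _ _)).symm
    set b := (noise d H M.σ).real B₀ with hbdef
    have hb0 : 0 ≤ b := measureReal_nonneg
    have h := hLC.lintegral_sum_realizedCost_le hA hM hC hσ hlam hW hd hV hB₀ hgood₀ T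
    have hX : ((H * ENNReal.ofReal v) ^ (1 / 2 : ℝ) *
        (T * (ENNReal.ofReal 240 * (M.infoGain lam T *
          (M.infoGain lam T + ENNReal.ofReal (d + Real.log T + H))))) ^ (1 / 2 : ℝ) +
        ENNReal.ofReal v ^ (1 / 2 : ℝ) * (2 * M.infoGain lam T + noise d H M.σ B₀)) =
        ENNReal.ofReal (√(H * v) * √(T * (240 * (γ * (γ + g)))) + √v * (2 * γ + b)) := by
      have h2 : (2 : ℝ≥0∞) = ENNReal.ofReal 2 := by norm_num
      rw [← ENNReal.ofReal_toReal hγ, ← hγr, hb, ← hg, ← ENNReal.ofReal_natCast H,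
        ← ENNReal.ofReal_natCast T, h2, ← ENNReal.ofReal_mul (by positivity),
        ← ENNReal.ofReal_add hγ0 hg0, ← ENNReal.ofReal_mul hγ0,
        ← ENNReal.ofReal_mul (by positivity), ← ENNReal.ofReal_mul (by positivity),
        ← ENNReal.ofReal_mul (by positivity), ← ENNReal.ofReal_add (by positivity) hb0,
        ofReal_rpow_half (by positivity), ofReal_rpow_half (by positivity),
        ofReal_rpow_half hv, ← ENNReal.ofReal_mul (by positivity),
        ← ENNReal.ofReal_mul (by positivity), ← ENNReal.ofReal_add (by positivity) (by positivity)]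
    rw [hX] at h
    have hJ : ∑ t ∈ Finset.range T, M.Jstar t ≠ ∞ :=
      ENNReal.sum_ne_top.mpr fun t _ => Jstar_ne_top hA hM ENNReal.ofReal_ne_top t (hV t)
    have h3 := ENNReal.toReal_mono (ENNReal.add_ne_top.mpr ⟨hJ, ENNReal.ofReal_ne_top⟩) h
    rw [ENNReal.toReal_add hJ ENNReal.ofReal_ne_top, ENNReal.toReal_ofReal (by positivity)] at h3
    rw [integral_regret hA hM hC ENNReal.ofReal_ne_top hV, dTilde]
    have h4 := regret_bound_le hγ0 hv hg0 hH hT b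
    have h5 : γ + d + Real.log T + H = γ + g := by rw [hg]; ring
    rw [h5]
    linarith
  -- Without steps or without episodes no cost is incurred, and the regret is at most `0`.
  · have h0 : ∀ ε, ∑ t ∈ Finset.range T, (M.realizedCost A ε t : ℝ) = 0 := by
      intro ε
      rcases Nat.eq_zero_or_pos T with rfl | hT
      · simp
      · obtain rfl : H = 0 := by omega
        simp [realizedCost, cumCost]
    refine (integral_nonpos fun ε => ?_).trans (by rw [dTilde]; positivity)
    simp only [regret, h0, zero_sub, Pi.zero_apply]
    exact neg_nonpos.mpr (Finset.sum_nonneg fun _ _ => ENNReal.toReal_nonneg)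

end KNR

end LC3

/-! ### The regret bound -/

theorem theorem1 :
    ∃ C₁ C₂ : ℝ, 0 < C₁ ∧ C₁ ≤ 20 ∧ 0 < C₂ ∧ C₂ ≤ 20 ∧
      ∀ (d H : ℕ) (U : Type u) (E : Type v) [NormedAddCommGroup E] [InnerProductSpace ℝ E]
        [CompleteSpace E] [TopologicalSpace.SeparableSpace E] [MeasurableSpace E] [BorelSpace E]
        (M : LC3.KNR d H U E) (Vmax lam : ℝ) (Ball₀ : Set (E →L[ℝ] LC3.State d))
        (A : LC3.Algorithm d H U),
        0 < M.σ → M.Wstar ≠ 0 → M.MeasurablePolicies →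
        (∀ t, ∀ π ∈ M.policies, M.secondMoment t π ≤ ENNReal.ofReal Vmax) →
        lam = M.σ ^ 2 / ‖M.Wstar‖ ^ 2 →
        M.Wstar ∈ Ball₀ →
        M.Admissible A → M.MeasurableCosts A → M.IsLC3 lam C₁ Ball₀ A →
        ∀ T : ℕ, Integrable (M.regret A T) (LC3.noise d H M.σ) ∧ (M.infoGain lam T ≠ ∞ →
          ((∀ W ∈ Ball₀, lam * ‖W‖ ^ 2 ≤ C₁ * (lam * ‖M.Wstar‖ ^ 2 + M.σ ^ 2 * d)) →
            ∫ ε, M.regret A T ε ∂LC3.noise d H M.σ ≤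
              C₂ * LC3.dTilde (M.infoGain lam T).toReal d H T * √(Vmax * H * T)) ∧
          ∫ ε, M.regret A T ε ∂LC3.noise d H M.σ ≤
            C₂ * LC3.dTilde (M.infoGain lam T).toReal d H T * √(Vmax * H * T) + √Vmax) := by
  refine ⟨20, 20, by norm_num, le_rfl, by norm_num, le_rfl, ?_⟩
  intro d H U E _ _ _ _ _ _ M Vmax lam Ball₀ A hσ hWstar hM hV hlamdef hmem hA hC hLC T
  have : SecondCountableTopology E := UniformSpace.secondCountable_of_separable E
  have hnorm : 0 < ‖M.Wstar‖ := norm_pos_iff.mpr hWstar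
  have hlam : 0 < lam := by rw [hlamdef]; positivity
  have hW : lam * ‖M.Wstar‖ ^ 2 = M.σ ^ 2 := by rw [hlamdef]; field_simp
  have hd : 1 ≤ d := by
    rcases Nat.eq_zero_or_pos d with rfl | hd
    · exact absurd (ContinuousLinearMap.ext fun x => Subsingleton.elim _ _) hWstar
    · exact hd
  -- `Vmax` is not assumed to be non-negative; replacing it by `max Vmax 0` changes neither the
  -- moment bound nor the square roots, which vanish for negative arguments.
  have hV' : ∀ t, ∀ π ∈ M.policies, M.secondMoment t π ≤ ENNReal.ofReal (max Vmax 0) :=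
    fun t π hπ => (hV t π hπ).trans (ENNReal.ofReal_le_ofReal (le_max_left _ _))
  have hsqrt : ∀ a : ℝ, 0 ≤ a → √(max Vmax 0 * a) ≤ √(Vmax * a) := fun a ha => by
    rcases le_total Vmax 0 with h | h
    · simp [max_eq_right h]
    · rw [max_eq_left h]
  have hsqrt1 := hsqrt 1 zero_le_one
  have hsqrt2 := hsqrt (H * T) (by positivity)
  rw [mul_one, mul_one] at hsqrt1
  rw [← mul_assoc, ← mul_assoc] at hsqrt2
  have hd0 : 0 ≤ LC3.dTilde (M.infoGain lam T).toReal d H T := Real.sqrt_nonneg _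
  refine ⟨LC3.KNR.integrable_regret hA hM hC ENNReal.ofReal_ne_top hV T, fun hγ =>
    ⟨fun hBall => ?_, ?_⟩⟩
  -- Episode `0` is accurate for every noise, so its exceptional set is empty.
  · refine (hLC.integral_regret_le hA hM hC hσ hlam hW hd (le_max_right Vmax 0) hV'
      MeasurableSet.empty (fun ε _ => hLC.exists_accurate_zero hlam hmem hBall _) T hγ).trans ?_
    rw [measureReal_empty, zero_mul, add_zero]
    gcongr
  -- Nothing is known about the initial ball: all of episode `0` is exceptional and costs `√Vmax`.
  · refine (hLC.integral_regret_le hA hM hC hσ hlam hW hd (le_max_right Vmax 0) hV'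
      MeasurableSet.univ (fun ε hε => absurd (Set.mem_univ ε) hε) T hγ).trans ?_
    rw [probReal_univ, one_mul]
    gcongr
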